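/- Let $(M_1,g_1)$ be a closed (compact, without boundary) oriented Riemannian surface with a spin structure, and let $\mathbb S\to M_1$ be its real rank-two (Majorana) spinor bundle. That is, $\mathbb S$ is a rank-two bundle with a fibre metric $\langle\cdot,\cdot\rangle_{\mathbb S}$ and an area form, hence a hermitian complex line bundle $W$, together with an isometric isomorphism of complex line bundles $W\otimes W\simeq TM_1$, $s\otimes t\mapsto s\cdot t$. Let $\omega_1^*$ be the induced area form on $\mathbb S^*$, let $\gamma\colon T^*M_1\to\mathrm{End}(\mathbb S)$, $\langle\gamma(v^\flat)s,t\rangle_{\mathbb S}=g_1(v,s\cdot t)$, be the Clifford map (so $\gamma(\alpha)$ is symmetric and $\gamma(\alpha)^2=|\alpha|^2$), acting on $\mathbb S^*\simeq\mathbb S$ by $(\gamma(\alpha)\sigma)(s)=\sigma(\gamma(\alpha)s)$, and let $\nabla^{\mathbb S}$ be the spin connection, i.e. the metric connection on $\mathbb S$ that induces the Levi-Civita connection on $TM_1\simeq W\otimes W$. Let $(M_2,g_2)$ be a Riemannian manifold and $\varphi\colon M_1\to M_2$ a smooth map. Let $E=\mathbb S^*\otimes\varphi^*TM_2$, with the connection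 $\nabla$ induced by $\nabla^{\mathbb S}$ and the pullback of the Levi-Civita connection of $M_2$, and let $D=\sum_k\gamma(e^k)\nabla_{e_k}$ (for local orthonormal frames $e_k$ of $TM_1$ with dual frames $e^k$) be the twisted spin Dirac operator. Let $\Lambda=\Lambda^+\oplus\Lambda^-$ be the Grassmann algebra of a finite-dimensional real vector space, with its even and odd parts, let $E_\Lambda=E\otimes\Lambda$, and extend $D$ to sections of $E_\Lambda$ as $D\otimes 1$. Define on $E_\Lambda$ the $\Lambda$-valued graded inner product $$(z_1\otimes\lambda_1,z_2\otimes\lambda_2)_E=\langle z_1,z_2\rangle_E\,\lambda_1\wedge\lambda_2,\qquad \langle s_1^*\otimes y_1,s_2^*\otimes y_2\rangle_E=\omega_1^*(s_1^*,s_2^*)\,g_2(y_1,y_2).$$ Then for all smooth odd sections $\psi,\chi$ of $E_\Lambda$ (sections of $E\otimes\Lambda^-$) the functions $(\psi,\chi)_E$, $(\psi,D\chi)_E$ and $(D\psi,\chi)_E$ are integrable over $M_1$, and the scalar product $$((\psi,\chi))=\int_{M_1}(\psi,\chi)_E\,d\mathrm{vol}(g_1)$$ satisfies $((\psi,\chi))=((\chi,\psi))\in\Lambda^+$.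 With respect to it the Dirac operator is symmetric on odd sections: $$((\psi,D\chi))=((D\psi,\chi)).$$ -/

import Mathlib

open Bundle Manifold MeasureTheory
open scoped ContDiff TensorProduct

set_option linter.unusedSectionVars false

noncomputable section

namespace SuperDirac

/-! ### Area forms on Riemannian vector bundles of rank two -/

section AreaForm

variable {B : Type*} [TopologicalSpace B] {EB : Type*} [NormedAddCommGroup EB] [NormedSpace ℝ EB]
  {HB : Type*} [TopologicalSpace HB] (IB : ModelWithCorners ℝ EB HB) [ChartedSpace HB B]
  (F : Type*) [NormedAddCommGroup F] [NormedSpace ℝ F]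
  (V : B → Type*) [TopologicalSpace (TotalSpace F V)]
  [∀ x, NormedAddCommGroup (V x)] [∀ x, InnerProductSpace ℝ (V x)]
  [FiberBundle F V] [VectorBundle ℝ F V]

/-- A smooth alternating 2-form on the fibres of a Riemannian vector bundle, of unit length:
`a(v, w)² = |v|² |w|² - ⟨v, w⟩²`. On a bundle of rank two this is an orientation, recorded by its
area form: `a(v, w) = ±1` on every orthonormal basis `v, w`, with `+1` on the oriented ones. -/
structure AreaForm where
  toFun : ∀ x, V x →L[ℝ] V x →L[ℝ] ℝ
  contMDiff : ContMDiff IB (IB.prod 𝓘(ℝ, F →L[ℝ] F →L[ℝ] ℝ)) ∞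
    (fun x ↦ TotalSpace.mk' (F →L[ℝ] F →L[ℝ] ℝ) x (toFun x))
  alternating : ∀ x v, toFun x v v = 0
  sq_eq : ∀ x v w, toFun x v w ^ 2 = ‖v‖ ^ 2 * ‖w‖ ^ 2 - inner ℝ v w ^ 2

variable {IB F V}

/-- The almost complex structure `J` defined by an area form through `⟨J v, w⟩ = a(v, w)`, that is
`J v = ∑ₖ a(v, bₖ) bₖ` for an orthonormal basis `b`. -/
def AreaForm.rotation [FiniteDimensional ℝ F] (a : AreaForm IB F V) (x : B) : V x →L[ℝ] V x :=
  haveI : FiniteDimensional ℝ (V x) := VectorBundle.finiteDimensional ℝ F V x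
  ∑ k, ((a.toFun x).flip (stdOrthonormalBasis ℝ (V x) k)).smulRight (stdOrthonormalBasis ℝ (V x) k)

end AreaForm

/-! ### Levi-Civita connection and Riemannian measure -/

section Riemannian

variable {n : ℕ} {M : Type*} [TopologicalSpace M]
  [ChartedSpace (EuclideanSpace ℝ (Fin n)) M] [IsManifold (𝓡 n) ∞ M]
  [RiemannianBundle (fun x : M ↦ TangentSpace (𝓡 n) x)]

/-- `cov` is the Levi-Civita connection: the smooth, torsion-free connection on the tangent bundle
which is compatible with the metric. -/
structure IsLeviCivita
    [IsContMDiffRiemannianBundle (𝓡 n) ∞ (EuclideanSpace ℝ (Fin n))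
      (fun x : M ↦ TangentSpace (𝓡 n) x)]
    (cov : CovariantDerivative (𝓡 n) (EuclideanSpace ℝ (Fin n))
      (fun x : M ↦ TangentSpace (𝓡 n) x)) : Prop where
  smooth : cov.ContMDiffCovariantDerivative ∞
  torsion_eq_zero : cov.torsion = 0
  metric :
    haveI : IsContMDiffRiemannianBundle (𝓡 n) 1 (EuclideanSpace ℝ (Fin n))
      (fun x : M ↦ TangentSpace (𝓡 n) x) := .of_le (n := ∞) (by norm_cast)
    cov.IsMetricCompatible

/-- The Riemannian volume density `√det(⟨∂ᵢ, ∂ⱼ⟩)` in the coordinates of the chart at `c`, as a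
function on the target of that chart. -/
def chartDensity (c : M) (y : EuclideanSpace ℝ (Fin n)) : ℝ :=
  let del (i : Fin n) : TangentSpace (𝓡 n) ((chartAt (EuclideanSpace ℝ (Fin n)) c).symm y) :=
    mfderiv (𝓡 n) (𝓡 n) (chartAt (EuclideanSpace ℝ (Fin n)) c).symm y (EuclideanSpace.single i 1)
  √(Matrix.of fun i j : Fin n ↦ inner ℝ (del i) (del j)).det

variable (n M) in
/-- The Riemannian volume measure `dvol(g)`. The measures `√det g dy¹ ⋯ dyⁿ` on the domains of the
charts agree on overlaps; their supremum is the measure on `M` obtained by gluing them. -/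
def riemannianMeasure [MeasurableSpace M] : Measure M :=
  ⨆ c : M, Measure.map (chartAt (EuclideanSpace ℝ (Fin n)) c).symm
    ((volume.restrict (chartAt (EuclideanSpace ℝ (Fin n)) c).target).withDensity
      fun y ↦ ENNReal.ofReal (chartDensity c y))

end Riemannian

/-! ### Algebraic and topological structure on the fibres of a pullback bundle -/

section Pullback

variable {B' B : Type*} (f : B' → B) (E : B → Type*) (x : B')

instance instAddCommGroupPullback [∀ q, AddCommGroup (E q)] : AddCommGroup ((f *ᵖ E) x) :=
  inferInstanceAs (AddCommGroup (E (f x)))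

instance instIsTopologicalAddGroupPullback [∀ q, AddCommGroup (E q)] [∀ q, TopologicalSpace (E q)]
    [∀ q, IsTopologicalAddGroup (E q)] : IsTopologicalAddGroup ((f *ᵖ E) x) :=
  inferInstanceAs (IsTopologicalAddGroup (E (f x)))

instance instContinuousSMulPullback [∀ q, AddCommGroup (E q)] [∀ q, Module ℝ (E q)]
    [∀ q, TopologicalSpace (E q)] [∀ q, ContinuousSMul ℝ (E q)] :
    ContinuousSMul ℝ ((f *ᵖ E) x) :=
  inferInstanceAs (ContinuousSMul ℝ (E (f x)))

end Pullback

/-! ### Spin structures on an oriented Riemannian surface and the spin connection -/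

variable {M₁ : Type*} [TopologicalSpace M₁] [ChartedSpace (EuclideanSpace ℝ (Fin 2)) M₁]
  [IsManifold (𝓡 2) ∞ M₁]
  [RiemannianBundle (fun x : M₁ ↦ TangentSpace (𝓡 2) x)]
  [IsContMDiffRiemannianBundle (𝓡 2) ∞ (EuclideanSpace ℝ (Fin 2))
    (fun x : M₁ ↦ TangentSpace (𝓡 2) x)]
  {S : M₁ → Type*} [TopologicalSpace (TotalSpace (EuclideanSpace ℝ (Fin 2)) S)]
  [∀ x, NormedAddCommGroup (S x)] [∀ x, InnerProductSpace ℝ (S x)]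
  [FiberBundle (EuclideanSpace ℝ (Fin 2)) S] [VectorBundle ℝ (EuclideanSpace ℝ (Fin 2)) S]
  [ContMDiffVectorBundle ∞ (EuclideanSpace ℝ (Fin 2)) S (𝓡 2)]
  [IsContMDiffRiemannianBundle (𝓡 2) ∞ (EuclideanSpace ℝ (Fin 2)) S]

variable (S) in
/-- A spin structure on an oriented Riemannian surface `M₁` with area form `ω₁`, given by its
Majorana spinor bundle: a Riemannian vector bundle `S` of rank two with an area form (hence a
complex line bundle `W` with a hermitian metric), and an isometric isomorphism of complex line
bundles `W ⊗ W ≃ TM₁`, recorded as the complex bilinear symmetric map `sq : S × S → TM₁`.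
On unit vectors, `s ↦ sq s s` is the double cover of the oriented orthonormal frame bundle of `M₁`
(a circle bundle) which is equivariant under `Spin(2) → SO(2)`, `z ↦ z²`. -/
structure SpinStructure
    (ω₁ : AreaForm (𝓡 2) (EuclideanSpace ℝ (Fin 2)) (fun x : M₁ ↦ TangentSpace (𝓡 2) x)) where
  area : AreaForm (𝓡 2) (EuclideanSpace ℝ (Fin 2)) S
  sq : ∀ x, S x →L[ℝ] S x →L[ℝ] TangentSpace (𝓡 2) x
  contMDiff : ContMDiff (𝓡 2) ((𝓡 2).prod 𝓘(ℝ, EuclideanSpace ℝ (Fin 2) →L[ℝ]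
      EuclideanSpace ℝ (Fin 2) →L[ℝ] EuclideanSpace ℝ (Fin 2))) ∞
    (fun x ↦ TotalSpace.mk' (EuclideanSpace ℝ (Fin 2) →L[ℝ]
      EuclideanSpace ℝ (Fin 2) →L[ℝ] EuclideanSpace ℝ (Fin 2))
      (E := fun x : M₁ ↦ S x →L[ℝ] S x →L[ℝ] TangentSpace (𝓡 2) x) x (sq x))
  symm : ∀ x s t, sq x s t = sq x t s
  norm_eq : ∀ x s t, ‖sq x s t‖ = ‖s‖ * ‖t‖
  rotation_left : ∀ x s t, sq x (area.rotation x s) t = ω₁.rotation x (sq x s t)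

variable
  {ω₁ : AreaForm (𝓡 2) (EuclideanSpace ℝ (Fin 2)) (fun x : M₁ ↦ TangentSpace (𝓡 2) x)}

/-- Clifford multiplication `γ(v♭) : S → S`, defined by `⟨γ(v♭) s, t⟩ = ⟨v, sq s t⟩`, that is
`γ(v♭) s = ∑ₖ ⟨v, sq s bₖ⟩ bₖ` for an orthonormal basis `b` of the fibre. In terms of
`W ⊗ W ≃ TM₁` it is `s ↦ v ⊗ s̄`. It is the symmetric real representation of the Clifford algebra
`Cl₂,₀`, with `γ(v♭)² = |v|²`. -/
def SpinStructure.clifford (σ : SpinStructure S ω₁) (x : M₁) (v : TangentSpace (𝓡 2) x) :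
    S x →L[ℝ] S x :=
  haveI : FiniteDimensional ℝ (S x) :=
    VectorBundle.finiteDimensional ℝ (EuclideanSpace ℝ (Fin 2)) S x
  ∑ k, ((innerSL ℝ v).comp ((σ.sq x).flip (stdOrthonormalBasis ℝ (S x) k))).smulRight
    (stdOrthonormalBasis ℝ (S x) k)

/-- `covS` is the spin connection: the lift of the Levi-Civita connection `cov₁` to the spinor
bundle, that is the smooth metric connection on `S` which induces `cov₁` on `TM₁ ≃ W ⊗ W`. -/
structure IsSpinConnection (σ : SpinStructure S ω₁)
    (cov₁ : CovariantDerivative (𝓡 2) (EuclideanSpace ℝ (Fin 2))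
      (fun x : M₁ ↦ TangentSpace (𝓡 2) x))
    (covS : CovariantDerivative (𝓡 2) (EuclideanSpace ℝ (Fin 2)) S) : Prop where
  smooth : covS.ContMDiffCovariantDerivative ∞
  metric :
    haveI : IsContMDiffRiemannianBundle (𝓡 2) 1 (EuclideanSpace ℝ (Fin 2)) S :=
      .of_le (n := ∞) (by norm_cast)
    haveI : ContMDiffVectorBundle 1 (EuclideanSpace ℝ (Fin 2)) S (𝓡 2) :=
      .of_le (n := ∞) (by norm_cast)
    covS.IsMetricCompatible
  lift : ∀ (s t : Π x, S x) (x : M₁),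
    MDifferentiableAt (𝓡 2) ((𝓡 2).prod 𝓘(ℝ, EuclideanSpace ℝ (Fin 2)))
      (fun y ↦ TotalSpace.mk' (EuclideanSpace ℝ (Fin 2)) y (s y)) x →
    MDifferentiableAt (𝓡 2) ((𝓡 2).prod 𝓘(ℝ, EuclideanSpace ℝ (Fin 2)))
      (fun y ↦ TotalSpace.mk' (EuclideanSpace ℝ (Fin 2)) y (t y)) x →
    ∀ v : TangentSpace (𝓡 2) x,
      cov₁ (fun y ↦ σ.sq y (s y) (t y)) x v =
        σ.sq x (covS s x v) (t x) + σ.sq x (s x) (covS t x v)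

/-! ### The twisted spinor bundle `E = S* ⊗ φ*TM₂` and its Dirac operator -/

variable {n : ℕ} {M₂ : Type*} [TopologicalSpace M₂] [ChartedSpace (EuclideanSpace ℝ (Fin n)) M₂]
  [IsManifold (𝓡 n) ∞ M₂]

/-- The local frame of `TM₂` around `q₀` given by the trivialization of `TM₂` at `q₀`. -/
def targetFrame (q₀ : M₂) (a : Fin n) (q : M₂) : TangentSpace (𝓡 n) q :=
  (trivializationAt (EuclideanSpace ℝ (Fin n)) (fun q : M₂ ↦ TangentSpace (𝓡 n) q) q₀).symm q
    (EuclideanSpace.single a 1)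

/-- The frame of the fibre of `φ*TM₂` at `x` given by `targetFrame (φ x)`. -/
def pullbackFrame (φ : C^∞⟮𝓡 2, M₁; 𝓡 n, M₂⟯) (x : M₁) (a : Fin n) :
    ((φ : M₁ → M₂) *ᵖ (fun q : M₂ ↦ TangentSpace (𝓡 n) q)) x :=
  targetFrame (φ x) a (φ x)

/-- For the local frame `eₐ = targetFrame (φ x) a`, the map `v ↦ ∇_{dφ(v)} eₐ` on `TₓM₁`. -/
def pullbackFrameCov
    (cov₂ : CovariantDerivative (𝓡 n) (EuclideanSpace ℝ (Fin n))
      (fun q : M₂ ↦ TangentSpace (𝓡 n) q))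
    (φ : C^∞⟮𝓡 2, M₁; 𝓡 n, M₂⟯) (x : M₁) (a : Fin n) :
    TangentSpace (𝓡 2) x →L[ℝ] ((φ : M₁ → M₂) *ᵖ (fun q : M₂ ↦ TangentSpace (𝓡 n) q)) x :=
  (cov₂ (targetFrame (φ x) a) (φ x)).comp (mfderiv (𝓡 2) (𝓡 n) φ x)

/-- The coefficients of a section `y` of `φ*TM₂` in the local frame `targetFrame (φ x) a ∘ φ`
around `x`. -/
def pullbackCoeff (φ : C^∞⟮𝓡 2, M₁; 𝓡 n, M₂⟯)
    (y : Π x, ((φ : M₁ → M₂) *ᵖ (fun q : M₂ ↦ TangentSpace (𝓡 n) q)) x) (x : M₁) (a : Fin n)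
    (x' : M₁) : ℝ :=
  (trivializationAt (EuclideanSpace ℝ (Fin n))
    ((φ : M₁ → M₂) *ᵖ (fun q : M₂ ↦ TangentSpace (𝓡 n) q)) x).continuousLinearMapAt ℝ x' (y x') a

/-- The pullback of a connection on `TM₂` along `φ : M₁ → M₂`. If `y = ∑ₐ yᵃ • (eₐ ∘ φ)` for the
local frame `eₐ` of `TM₂` around `φ x` given by a trivialization, then
`∇ᵥ y = ∑ₐ (dyᵃ(v) eₐ + yᵃ ∇_{dφ(v)} eₐ)`. -/
def pullbackCov
    (cov₂ : CovariantDerivative (𝓡 n) (EuclideanSpace ℝ (Fin n))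
      (fun q : M₂ ↦ TangentSpace (𝓡 n) q))
    (φ : C^∞⟮𝓡 2, M₁; 𝓡 n, M₂⟯)
    (y : Π x, ((φ : M₁ → M₂) *ᵖ (fun q : M₂ ↦ TangentSpace (𝓡 n) q)) x) (x : M₁) :
    TangentSpace (𝓡 2) x →L[ℝ] ((φ : M₁ → M₂) *ᵖ (fun q : M₂ ↦ TangentSpace (𝓡 n) q)) x :=
  ∑ a, ((mvfderiv (𝓡 2) (pullbackCoeff φ y x a) x).smulRight (pullbackFrame φ x a) +
    pullbackCoeff φ y x a x • pullbackFrameCov cov₂ φ x a)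

/-- The fibre `S*ₓ ⊗ T_{φ(x)}M₂ = Hom(Sₓ, T_{φ(x)}M₂)` of the twisted spinor bundle. -/
abbrev TwistedFiber (S : M₁ → Type*) [∀ x, NormedAddCommGroup (S x)]
    [∀ x, InnerProductSpace ℝ (S x)] (φ : C^∞⟮𝓡 2, M₁; 𝓡 n, M₂⟯) (x : M₁) : Type _ :=
  S x →L[ℝ] ((φ : M₁ → M₂) *ᵖ (fun q : M₂ ↦ TangentSpace (𝓡 n) q)) x

/-- Smooth sections of the twisted spinor bundle. -/
abbrev TwistedSection (S : M₁ → Type*) [TopologicalSpace (TotalSpace (EuclideanSpace ℝ (Fin 2)) S)]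
    [∀ x, NormedAddCommGroup (S x)] [∀ x, InnerProductSpace ℝ (S x)]
    [FiberBundle (EuclideanSpace ℝ (Fin 2)) S] [VectorBundle ℝ (EuclideanSpace ℝ (Fin 2)) S]
    (φ : C^∞⟮𝓡 2, M₁; 𝓡 n, M₂⟯) : Type _ :=
  ContMDiffSection (𝓡 2) (EuclideanSpace ℝ (Fin 2) →L[ℝ] EuclideanSpace ℝ (Fin n)) ∞
    (fun x : M₁ ↦ TwistedFiber S φ x)

/-- The local frame of `S` around `x` given by the trivialization of `S` at `x`. -/
def spinorFrame (S : M₁ → Type*) [TopologicalSpace (TotalSpace (EuclideanSpace ℝ (Fin 2)) S)]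
    [∀ x, NormedAddCommGroup (S x)] [∀ x, InnerProductSpace ℝ (S x)]
    [FiberBundle (EuclideanSpace ℝ (Fin 2)) S] [VectorBundle ℝ (EuclideanSpace ℝ (Fin 2)) S]
    (x : M₁) (k : Fin 2) (x' : M₁) : S x' :=
  (trivializationAt (EuclideanSpace ℝ (Fin 2)) S x).symm x' (EuclideanSpace.single k 1)

/-- The dual frame, at `x`, of `spinorFrame S x`. -/
def spinorCoframe (S : M₁ → Type*) [TopologicalSpace (TotalSpace (EuclideanSpace ℝ (Fin 2)) S)]
    [∀ x, NormedAddCommGroup (S x)] [∀ x, InnerProductSpace ℝ (S x)]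
    [FiberBundle (EuclideanSpace ℝ (Fin 2)) S] [VectorBundle ℝ (EuclideanSpace ℝ (Fin 2)) S]
    (x : M₁) (k : Fin 2) : S x →L[ℝ] ℝ :=
  (EuclideanSpace.proj k).comp
    ((trivializationAt (EuclideanSpace ℝ (Fin 2)) S x).continuousLinearMapAt ℝ x)

/-- The connection on `E = Hom(S, φ*TM₂)` induced by a connection on `S` and the pullback of a
connection on `TM₂`: `(∇ᵥ ψ)(s) = ∇ᵥ(ψ(s)) - ψ(∇ᵥ s)`, evaluated on a local frame of `S`. -/
def twistedCov
    (covS : CovariantDerivative (𝓡 2) (EuclideanSpace ℝ (Fin 2)) S)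
    (cov₂ : CovariantDerivative (𝓡 n) (EuclideanSpace ℝ (Fin n))
      (fun q : M₂ ↦ TangentSpace (𝓡 n) q))
    (φ : C^∞⟮𝓡 2, M₁; 𝓡 n, M₂⟯) (ψ : Π x, TwistedFiber S φ x) (x : M₁)
    (v : TangentSpace (𝓡 2) x) : TwistedFiber S φ x :=
  ∑ k, (spinorCoframe S x k).smulRight
    (pullbackCov cov₂ φ (fun x' ↦ ψ x' (spinorFrame S x k x')) x v -
      ψ x (covS (spinorFrame S x k) x v))

/-- The twisted spin Dirac operator `D = δ_γ(∇)`, `D ψ = ∑ₖ γᵏ ∇_{eₖ} ψ` for an orthonormal basis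
`eₖ` of `TₓM₁`. Clifford multiplication acts on `S* ≃ S` (identified by the spinor metric) as
`(γ(α) ψ)(s) = ψ(γ(α) s)`. -/
def dirac (σ : SpinStructure S ω₁)
    (covS : CovariantDerivative (𝓡 2) (EuclideanSpace ℝ (Fin 2)) S)
    (cov₂ : CovariantDerivative (𝓡 n) (EuclideanSpace ℝ (Fin n))
      (fun q : M₂ ↦ TangentSpace (𝓡 n) q))
    (φ : C^∞⟮𝓡 2, M₁; 𝓡 n, M₂⟯) (ψ : Π x, TwistedFiber S φ x) (x : M₁) : TwistedFiber S φ x :=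
  haveI : FiniteDimensional ℝ (TangentSpace (𝓡 2) x) :=
    inferInstanceAs (FiniteDimensional ℝ (EuclideanSpace ℝ (Fin 2)))
  ∑ k, (twistedCov covS cov₂ φ ψ x (stdOrthonormalBasis ℝ (TangentSpace (𝓡 2) x) k)).comp
    (σ.clifford x (stdOrthonormalBasis ℝ (TangentSpace (𝓡 2) x) k))

/-- The value of a smooth section of `E` at `x`, as a linear map. -/
def evalSection (φ : C^∞⟮𝓡 2, M₁; 𝓡 n, M₂⟯) (x : M₁) :
    TwistedSection S φ →ₗ[ℝ] TwistedFiber S φ x where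
  toFun ψ := ψ x
  map_add' _ _ := rfl
  map_smul' _ _ := rfl

section Linear

theorem mdifferentiableAt_pullbackCoeff (φ : C^∞⟮𝓡 2, M₁; 𝓡 n, M₂⟯)
    {y : Π x, ((φ : M₁ → M₂) *ᵖ (fun q : M₂ ↦ TangentSpace (𝓡 n) q)) x} {x : M₁}
    (hy : MDifferentiableAt (𝓡 2) ((𝓡 2).prod 𝓘(ℝ, EuclideanSpace ℝ (Fin n)))
      (fun x' ↦ TotalSpace.mk' (EuclideanSpace ℝ (Fin n)) x' (y x')) x) (a : Fin n) :
    MDifferentiableAt (𝓡 2) 𝓘(ℝ) (pullbackCoeff φ y x a) x := by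
  have h := (mdifferentiableAt_section _ _).1 hy
  have h2 := ((EuclideanSpace.proj a :
    EuclideanSpace ℝ (Fin n) →L[ℝ] ℝ).mdifferentiableAt).comp x h
  refine h2.congr_of_eventuallyEq ?_
  filter_upwards [(trivializationAt (EuclideanSpace ℝ (Fin n))
    ((φ : M₁ → M₂) *ᵖ (fun q : M₂ ↦ TangentSpace (𝓡 n) q)) x).open_baseSet.mem_nhds
    (FiberBundle.mem_baseSet_trivializationAt' x)] with x' hx'
  simp only [pullbackCoeff, Function.comp]
  rw [Trivialization.continuousLinearMapAt_apply, Trivialization.linearMapAt_apply, if_pos hx']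
  rfl

theorem pullbackCov_add
    (cov₂ : CovariantDerivative (𝓡 n) (EuclideanSpace ℝ (Fin n))
      (fun q : M₂ ↦ TangentSpace (𝓡 n) q))
    (φ : C^∞⟮𝓡 2, M₁; 𝓡 n, M₂⟯)
    {y z : Π x, ((φ : M₁ → M₂) *ᵖ (fun q : M₂ ↦ TangentSpace (𝓡 n) q)) x} {x : M₁}
    (hy : MDifferentiableAt (𝓡 2) ((𝓡 2).prod 𝓘(ℝ, EuclideanSpace ℝ (Fin n)))
      (fun x' ↦ TotalSpace.mk' (EuclideanSpace ℝ (Fin n)) x' (y x')) x)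
    (hz : MDifferentiableAt (𝓡 2) ((𝓡 2).prod 𝓘(ℝ, EuclideanSpace ℝ (Fin n)))
      (fun x' ↦ TotalSpace.mk' (EuclideanSpace ℝ (Fin n)) x' (z x')) x) :
    pullbackCov cov₂ φ (fun x' ↦ y x' + z x') x =
      pullbackCov cov₂ φ y x + pullbackCov cov₂ φ z x := by
  unfold pullbackCov
  rw [← Finset.sum_add_distrib]
  refine Finset.sum_congr rfl fun a _ ↦ ?_
  have h : pullbackCoeff φ (fun x' ↦ y x' + z x') x a =
      pullbackCoeff φ y x a + pullbackCoeff φ z x a := by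
    funext x'; simp [pullbackCoeff]
  rw [h, mvfderiv_add (mdifferentiableAt_pullbackCoeff φ hy a)
    (mdifferentiableAt_pullbackCoeff φ hz a)]
  ext v
  simp only [_root_.add_apply, ContinuousLinearMap.smulRight_apply, Pi.add_apply,
    _root_.smul_apply, add_smul]
  abel

theorem pullbackCov_smul
    (cov₂ : CovariantDerivative (𝓡 n) (EuclideanSpace ℝ (Fin n))
      (fun q : M₂ ↦ TangentSpace (𝓡 n) q))
    (φ : C^∞⟮𝓡 2, M₁; 𝓡 n, M₂⟯) (c : ℝ)
    {y : Π x, ((φ : M₁ → M₂) *ᵖ (fun q : M₂ ↦ TangentSpace (𝓡 n) q)) x} {x : M₁}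
    (hy : MDifferentiableAt (𝓡 2) ((𝓡 2).prod 𝓘(ℝ, EuclideanSpace ℝ (Fin n)))
      (fun x' ↦ TotalSpace.mk' (EuclideanSpace ℝ (Fin n)) x' (y x')) x) :
    pullbackCov cov₂ φ (fun x' ↦ c • y x') x = c • pullbackCov cov₂ φ y x := by
  unfold pullbackCov
  rw [Finset.smul_sum]
  refine Finset.sum_congr rfl fun a _ ↦ ?_
  have h : pullbackCoeff φ (fun x' ↦ c • y x') x a =
      (fun _ : M₁ ↦ c) • pullbackCoeff φ y x a := by
    funext x'; simp [pullbackCoeff]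
  rw [h, mvfderiv_smul mdifferentiableAt_const (mdifferentiableAt_pullbackCoeff φ hy a)]
  ext v
  simp [smul_smul, mvfderiv_const]

theorem mdifferentiableAt_apply_spinorFrame (φ : C^∞⟮𝓡 2, M₁; 𝓡 n, M₂⟯)
    (ψ : TwistedSection S φ) (x : M₁) (k : Fin 2) :
    MDifferentiableAt (𝓡 2) ((𝓡 2).prod 𝓘(ℝ, EuclideanSpace ℝ (Fin n)))
      (fun x' ↦ TotalSpace.mk' (EuclideanSpace ℝ (Fin n))
        (E := (φ : M₁ → M₂) *ᵖ (fun q : M₂ ↦ TangentSpace (𝓡 n) q)) x'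
        (ψ x' (spinorFrame S x k x'))) x := by
  refine MDifferentiableAt.clm_bundle_apply (F₁ := EuclideanSpace ℝ (Fin 2)) (E₁ := S)
    ψ.mdifferentiableAt ?_
  refine (mdifferentiableAt_section _ _).2 ?_
  refine (mdifferentiableAt_const (c := EuclideanSpace.single k (1 : ℝ))).congr_of_eventuallyEq ?_
  filter_upwards [(trivializationAt (EuclideanSpace ℝ (Fin 2)) S x).open_baseSet.mem_nhds
    (FiberBundle.mem_baseSet_trivializationAt' x)] with x' hx'
  rw [spinorFrame, Trivialization.apply_mk_symm _ hx']

theorem twistedCov_add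
    (covS : CovariantDerivative (𝓡 2) (EuclideanSpace ℝ (Fin 2)) S)
    (cov₂ : CovariantDerivative (𝓡 n) (EuclideanSpace ℝ (Fin n))
      (fun q : M₂ ↦ TangentSpace (𝓡 n) q))
    (φ : C^∞⟮𝓡 2, M₁; 𝓡 n, M₂⟯) (ψ χ : TwistedSection S φ) (x : M₁)
    (v : TangentSpace (𝓡 2) x) :
    twistedCov covS cov₂ φ (ψ + χ : TwistedSection S φ) x v =
      twistedCov covS cov₂ φ ψ x v + twistedCov covS cov₂ φ χ x v := by
  unfold twistedCov
  rw [← Finset.sum_add_distrib]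
  refine Finset.sum_congr rfl fun k _ ↦ ?_
  have h := pullbackCov_add cov₂ φ (mdifferentiableAt_apply_spinorFrame φ ψ x k)
    (mdifferentiableAt_apply_spinorFrame φ χ x k)
  have h' : (fun x' ↦ (ψ + χ : TwistedSection S φ) x' (spinorFrame S x k x')) =
    fun x' ↦ ψ x' (spinorFrame S x k x') + χ x' (spinorFrame S x k x') := rfl
  rw [h', h]
  ext s
  simp only [ContMDiffSection.coe_add, Pi.add_apply, _root_.add_apply,
    ContinuousLinearMap.smulRight_apply, ← smul_add]
  congr 1
  abel

theorem twistedCov_smul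
    (covS : CovariantDerivative (𝓡 2) (EuclideanSpace ℝ (Fin 2)) S)
    (cov₂ : CovariantDerivative (𝓡 n) (EuclideanSpace ℝ (Fin n))
      (fun q : M₂ ↦ TangentSpace (𝓡 n) q))
    (φ : C^∞⟮𝓡 2, M₁; 𝓡 n, M₂⟯) (c : ℝ) (ψ : TwistedSection S φ) (x : M₁)
    (v : TangentSpace (𝓡 2) x) :
    twistedCov covS cov₂ φ (c • ψ : TwistedSection S φ) x v =
      c • twistedCov covS cov₂ φ ψ x v := by
  unfold twistedCov
  rw [Finset.smul_sum]
  refine Finset.sum_congr rfl fun k _ ↦ ?_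
  have h := pullbackCov_smul cov₂ φ c (mdifferentiableAt_apply_spinorFrame φ ψ x k)
  have h' : (fun x' ↦ (c • ψ : TwistedSection S φ) x' (spinorFrame S x k x')) =
    fun x' ↦ c • ψ x' (spinorFrame S x k x') := rfl
  rw [h', h]
  ext s
  simp only [ContMDiffSection.coe_smul, Pi.smul_apply, _root_.smul_apply,
    ContinuousLinearMap.smulRight_apply, ← smul_sub]
  rw [smul_comm]

end Linear

/-- The Dirac operator on smooth sections of `E`, followed by evaluation at `x`. -/
def diracAt (σ : SpinStructure S ω₁)
    (covS : CovariantDerivative (𝓡 2) (EuclideanSpace ℝ (Fin 2)) S)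
    (cov₂ : CovariantDerivative (𝓡 n) (EuclideanSpace ℝ (Fin n))
      (fun q : M₂ ↦ TangentSpace (𝓡 n) q))
    (φ : C^∞⟮𝓡 2, M₁; 𝓡 n, M₂⟯) (x : M₁) : TwistedSection S φ →ₗ[ℝ] TwistedFiber S φ x where
  toFun ψ := dirac σ covS cov₂ φ ψ x
  map_add' ψ χ := by
    simp only [dirac, twistedCov_add, ContinuousLinearMap.add_comp, Finset.sum_add_distrib]
  map_smul' c ψ := by
    simp only [dirac, twistedCov_smul, ContinuousLinearMap.smul_comp, Finset.smul_sum,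
      RingHom.id_apply]

/-! ### The Grassmann extension -/

variable (V : Type*) [AddCommGroup V] [Module ℝ V]

/-- Smooth sections of the Grassmann extension `E_Λ = E ⊗ Λ`, where `Λ = ⋀ V` for a
finite-dimensional real vector space `V`: since `Λ` is finite-dimensional, these are
`Γ(E) ⊗ Λ`. -/
abbrev GrassmannSection (S : M₁ → Type*)
    [TopologicalSpace (TotalSpace (EuclideanSpace ℝ (Fin 2)) S)]
    [∀ x, NormedAddCommGroup (S x)] [∀ x, InnerProductSpace ℝ (S x)]
    [FiberBundle (EuclideanSpace ℝ (Fin 2)) S] [VectorBundle ℝ (EuclideanSpace ℝ (Fin 2)) S]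
    (φ : C^∞⟮𝓡 2, M₁; 𝓡 n, M₂⟯) : Type _ :=
  TwistedSection S φ ⊗[ℝ] ExteriorAlgebra ℝ V

/-- The even (`i = 0`) and odd (`i = 1`) parts `Λ⁺`, `Λ⁻` of the Grassmann algebra. -/
abbrev grassmannPart (i : ZMod 2) : Submodule ℝ (ExteriorAlgebra ℝ V) :=
  CliffordAlgebra.evenOdd (0 : QuadraticForm ℝ V) i

/-- The odd sections of `E_Λ`: the sections of `E ⊗ Λ⁻`. -/
def oddSections (S : M₁ → Type*)
    [TopologicalSpace (TotalSpace (EuclideanSpace ℝ (Fin 2)) S)]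
    [∀ x, NormedAddCommGroup (S x)] [∀ x, InnerProductSpace ℝ (S x)]
    [FiberBundle (EuclideanSpace ℝ (Fin 2)) S] [VectorBundle ℝ (EuclideanSpace ℝ (Fin 2)) S]
    (φ : C^∞⟮𝓡 2, M₁; 𝓡 n, M₂⟯) : Submodule ℝ (GrassmannSection V S φ) :=
  LinearMap.range ((grassmannPart V 1).subtype.lTensor (TwistedSection S φ))

variable {V}

/-- The value at `x` of a section of `E_Λ`, an element of the fibre `E_x ⊗ Λ`. -/
def evalGrassmann (φ : C^∞⟮𝓡 2, M₁; 𝓡 n, M₂⟯) (ψ : GrassmannSection V S φ) (x : M₁) :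
    TwistedFiber S φ x ⊗[ℝ] ExteriorAlgebra ℝ V :=
  (evalSection φ x).rTensor (ExteriorAlgebra ℝ V) ψ

/-- The Dirac operator `D ⊗ 1` on sections of `E_Λ = E ⊗ Λ`. -/
def diracGrassmann (σ : SpinStructure S ω₁)
    (covS : CovariantDerivative (𝓡 2) (EuclideanSpace ℝ (Fin 2)) S)
    (cov₂ : CovariantDerivative (𝓡 n) (EuclideanSpace ℝ (Fin n))
      (fun q : M₂ ↦ TangentSpace (𝓡 n) q))
    (φ : C^∞⟮𝓡 2, M₁; 𝓡 n, M₂⟯) (ψ : GrassmannSection V S φ) (x : M₁) :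
    TwistedFiber S φ x ⊗[ℝ] ExteriorAlgebra ℝ V :=
  (diracAt σ covS cov₂ φ x).rTensor (ExteriorAlgebra ℝ V) ψ

variable [RiemannianBundle (fun q : M₂ ↦ TangentSpace (𝓡 n) q)]

/-- The inner product `⟨s₁* ⊗ y₁, s₂* ⊗ y₂⟩_E = ω₁*(s₁*, s₂*) g₂(y₁, y₂)` on
`S* ⊗ φ*TM₂ = Hom(S, φ*TM₂)`. For an oriented orthonormal basis `b₁, b₂` of the fibre of `S`
it is `g₂(A b₁, B b₂) - g₂(A b₂, B b₁) = ∑ₖ g₂(A bₖ, B (J bₖ))`, and the last expression does not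
depend on the orthonormal basis. -/
def twistedInner (σ : SpinStructure S ω₁) (φ : C^∞⟮𝓡 2, M₁; 𝓡 n, M₂⟯) (x : M₁) :
    TwistedFiber S φ x →ₗ[ℝ] TwistedFiber S φ x →ₗ[ℝ] ℝ :=
  haveI : FiniteDimensional ℝ (S x) :=
    VectorBundle.finiteDimensional ℝ (EuclideanSpace ℝ (Fin 2)) S x
  LinearMap.mk₂ ℝ (fun A B ↦ ∑ k,
      @inner ℝ (TangentSpace (𝓡 n) (φ x)) _ (A (stdOrthonormalBasis ℝ (S x) k))
        (B (σ.area.rotation x (stdOrthonormalBasis ℝ (S x) k))))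
    (fun A A' B ↦ by
      rw [← Finset.sum_add_distrib]
      exact Finset.sum_congr rfl fun k _ ↦
        inner_add_left (E := TangentSpace (𝓡 n) (φ x)) _ _ _)
    (fun c A B ↦ by
      rw [Finset.smul_sum]
      exact Finset.sum_congr rfl fun k _ ↦
        real_inner_smul_left (F := TangentSpace (𝓡 n) (φ x)) _ _ _)
    (fun A B B' ↦ by
      rw [← Finset.sum_add_distrib]
      exact Finset.sum_congr rfl fun k _ ↦
        inner_add_right (E := TangentSpace (𝓡 n) (φ x)) _ _ _)
    (fun c A B ↦ by
      rw [Finset.smul_sum]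
      exact Finset.sum_congr rfl fun k _ ↦
        real_inner_smul_right (F := TangentSpace (𝓡 n) (φ x)) _ _ _)

variable (V) in
/-- The `Λ`-valued graded inner product on the fibres of `E_Λ`,
`(z₁ ⊗ λ₁, z₂ ⊗ λ₂)_E = ⟨z₁, z₂⟩_E λ₁ ∧ λ₂`. -/
def gradedInner (σ : SpinStructure S ω₁) (φ : C^∞⟮𝓡 2, M₁; 𝓡 n, M₂⟯) (x : M₁) :
    TwistedFiber S φ x ⊗[ℝ] ExteriorAlgebra ℝ V →ₗ[ℝ]
      TwistedFiber S φ x ⊗[ℝ] ExteriorAlgebra ℝ V →ₗ[ℝ] ExteriorAlgebra ℝ V :=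
  (TensorProduct.map₂ (twistedInner σ φ x) (LinearMap.mul ℝ (ExteriorAlgebra ℝ V))).compr₂
    (TensorProduct.lid ℝ (ExteriorAlgebra ℝ V)).toLinearMap

theorem gradedInner_tmul (σ : SpinStructure S ω₁) (φ : C^∞⟮𝓡 2, M₁; 𝓡 n, M₂⟯) (x : M₁)
    (z₁ z₂ : TwistedFiber S φ x) (l₁ l₂ : ExteriorAlgebra ℝ V) :
    gradedInner V σ φ x (z₁ ⊗ₜ l₁) (z₂ ⊗ₜ l₂) = twistedInner σ φ x z₁ z₂ • (l₁ * l₂) := rfl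

/-- A `Λ`-valued function is integrable if all its components are. -/
def GrassmannIntegrable {X : Type*} [MeasurableSpace X] (μ : Measure X)
    (f : X → ExteriorAlgebra ℝ V) : Prop :=
  ∀ l : ExteriorAlgebra ℝ V →ₗ[ℝ] ℝ, Integrable (fun x ↦ l (f x)) μ

/-- The integral of a `Λ`-valued function, computed in the basis of `Λ = ⋀ V` consisting of the
products of elements of a basis of `V`. -/
def grassmannIntegral [Module.Finite ℝ V] {X : Type*} [MeasurableSpace X] (μ : Measure X)
    (f : X → ExteriorAlgebra ℝ V) : ExteriorAlgebra ℝ V :=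
  let b := (Module.finBasis ℝ V).ExteriorAlgebra
  ∑ i, (∫ x, b.repr (f x) i ∂μ) • b i

/-- The scalar product `((a, b)) = ∫_{M₁} (a, b)_E dvol(g₁)` of two sections of `E_Λ`, with values
in `Λ`. -/
def scalarProduct [Module.Finite ℝ V] [MeasurableSpace M₁]
    (σ : SpinStructure S ω₁) (φ : C^∞⟮𝓡 2, M₁; 𝓡 n, M₂⟯)
    (a b : Π x, TwistedFiber S φ x ⊗[ℝ] ExteriorAlgebra ℝ V) : ExteriorAlgebra ℝ V :=
  grassmannIntegral (riemannianMeasure 2 M₁) fun x ↦ gradedInner V σ φ x (a x) (b x)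

end SuperDirac
end

/-! Everything reduces to real sections. The pairing `⟨·,·⟩_E` is skew, being the skew form `ω₁*`
tensored with the symmetric form `g₂`, while odd elements of `Λ` anticommute. The two signs cancel,
so the `Λ`-valued pairing of odd sections is symmetric, and it is even because odd times odd is
even. Integration commutes with the `Λ`-bilinear extension (`grassmannIntegral_grassmannForm`), so
symmetry of `D` on `E_Λ` follows from its symmetry with respect to the real pairing `∫ ⟨ψ, χ⟩_E`
(`integral_twistedInner_dirac`).

That real statement is local. Take an oriented orthonormal frame `b₁, b₂` of `S` and put `e₁ =
b₁·b₁`, `e₂ = b₁·b₂`, an orthonormal frame of `TM₁` in which `γ(e₁)` and `γ(e₂)` are the matrices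
`diag(1, -1)` and `antidiag(1, 1)`. Let `θ = ⟨b₂, ∇b₁⟩` be the connection form of `S`. Since `TM₁ ≃
W ⊗ W` doubles it and the Levi-Civita connection has no torsion, `[e₁, e₂] = -2θ(e₁) e₁ - 2θ(e₂) e₂`
(`IsSpinFrameOn.mlieBracket_sq`). With `ψᵢ = ψ(bᵢ)`, `χᵢ = χ(bᵢ)` and `P = g₂(ψ₁, χ₁) - g₂(ψ₂, χ₂)`,
`Q = g₂(ψ₁, χ₂) + g₂(ψ₂, χ₁)`, the product rule gives `⟨ψ, Dχ⟩ - ⟨Dψ, χ⟩ = -e₁(Q) + e₂(P) - 2θ(e₁) P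
- 2θ(e₂) Q`, which by the bracket formula is the divergence of `-Q e₁ + P e₂`
(`twistedInner_dirac_sub`).

A partition of unity cuts `ψ` into pieces supported in the domain of a spin frame and of a chart.
There the Riemannian density is `1 / |det(e₁, e₂)|`, and density times divergence is a Euclidean
divergence of a compactly supported `C¹` field, whose integral vanishes
(`integral_divergence_eq_zero`). This requires that the supremum defining `riemannianMeasure`
restricts on each chart domain to that chart's own measure, which is the change of variables
formula. Integrability holds because all integrands are continuous on a compact space and the
measure is locally finite. -/

noncomputable section

namespace SuperDirac

/-! ### Orthonormal bases and traces -/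

section LinearAlgebra

variable {E F ι κ : Type*} [NormedAddCommGroup E] [InnerProductSpace ℝ E] [AddCommGroup F]
  [Module ℝ F] [Fintype ι] [Fintype κ]

/-- The trace of a bilinear map does not depend on the orthonormal basis. -/
theorem sum_bilin_orthonormalBasis (b : OrthonormalBasis ι ℝ E) (c : OrthonormalBasis κ ℝ E)
    (f : E →ₗ[ℝ] E →ₗ[ℝ] F) : ∑ i, f (b i) (b i) = ∑ j, f (c j) (c j) := by
  have h1 (i : ι) : f (b i) (b i) =
      ∑ j, ∑ k, (inner ℝ (c j) (b i) * inner ℝ (c k) (b i)) • f (c j) (c k) := by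
    conv_lhs => rw [← c.sum_repr' (b i)]
    simp only [map_sum, LinearMap.sum_apply, map_smul, LinearMap.smul_apply, Finset.smul_sum,
      smul_smul]
    rw [Finset.sum_comm]
    exact Finset.sum_congr rfl fun _ _ ↦ Finset.sum_congr rfl fun _ _ ↦ by rw [mul_comm]
  simp only [h1]
  rw [Finset.sum_comm]
  refine Finset.sum_congr rfl fun j _ ↦ ?_
  rw [Finset.sum_comm]
  simp only [← Finset.sum_smul]
  -- By Parseval for `b` the coefficient of `f (c j) (c k)` is `⟨c j, c k⟩`, so only the diagonal
  -- survives.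
  rw [Finset.sum_eq_single_of_mem j (Finset.mem_univ _)]
  · have := b.sum_inner_mul_inner (c j) (c j)
    simp only [real_inner_comm (c j)] at this ⊢
    rw [this, real_inner_self_eq_norm_sq]; simp
  · intro k _ hk
    have := b.sum_inner_mul_inner (c j) (c k)
    simp only [real_inner_comm (c k)] at this ⊢
    rw [this, c.inner_eq_zero hk]; simp

theorem exists_orthonormalBasis_of_pair (h2 : Module.finrank ℝ E = 2) {u v : E} (hu : ‖u‖ = 1)
    (hv : ‖v‖ = 1) (huv : inner ℝ u v = 0) :
    ∃ b : OrthonormalBasis (Fin 2) ℝ E, b 0 = u ∧ b 1 = v := by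
  have ho : Orthonormal ℝ ![u, v] := by
    refine ⟨fun i ↦ by fin_cases i <;> simp [hu, hv], fun i j hij ↦ ?_⟩
    fin_cases i <;> fin_cases j <;> simp_all [real_inner_comm]
  have hb := coe_basisOfOrthonormalOfCardEqFinrank ho (by simp [h2])
  refine ⟨(basisOfOrthonormalOfCardEqFinrank ho (by simp [h2])).toOrthonormalBasis
    (by rw [hb]; exact ho), ?_, ?_⟩ <;> simp [hb]

theorem eq_of_inner_pair (h2 : Module.finrank ℝ E = 2) {u v : E} (hu : ‖u‖ = 1)
    (hv : ‖v‖ = 1) (huv : inner ℝ u v = 0) (w : E) : w = inner ℝ u w • u + inner ℝ v w • v := by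
  obtain ⟨b, rfl, rfl⟩ := exists_orthonormalBasis_of_pair h2 hu hv huv
  simpa using (b.sum_repr' w).symm

end LinearAlgebra

/-! ### The rotation of an area form -/

section AreaForm

variable {B : Type*} [TopologicalSpace B] {EB : Type*} [NormedAddCommGroup EB] [NormedSpace ℝ EB]
  {HB : Type*} [TopologicalSpace HB] {IB : ModelWithCorners ℝ EB HB} [ChartedSpace HB B]
  {F : Type*} [NormedAddCommGroup F] [NormedSpace ℝ F]
  {V : B → Type*} [TopologicalSpace (TotalSpace F V)]
  [∀ x, NormedAddCommGroup (V x)] [∀ x, InnerProductSpace ℝ (V x)]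
  [FiberBundle F V] [VectorBundle ℝ F V]

theorem AreaForm.swap (a : AreaForm IB F V) (x : B) (v w : V x) :
    a.toFun x v w = -a.toFun x w v := by
  have h := a.alternating x (v + w)
  simp only [map_add, _root_.add_apply, a.alternating] at h
  linarith

/-- The basis-free characterization of `J`; after it, the arbitrary basis used to define `rotation`
no longer matters. -/
theorem AreaForm.inner_rotation [FiniteDimensional ℝ F] (a : AreaForm IB F V) (x : B) (v w : V x) :
    inner ℝ (a.rotation x v) w = a.toFun x v w := by
  have : FiniteDimensional ℝ (V x) := VectorBundle.finiteDimensional ℝ F V x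
  set b := stdOrthonormalBasis ℝ (V x)
  conv_rhs => rw [← b.sum_repr' w]
  simp only [rotation, FunLike.coe_sum, Finset.sum_apply, ContinuousLinearMap.smulRight_apply,
    sum_inner, real_inner_smul_left, map_sum, map_smul, smul_eq_mul, ContinuousLinearMap.flip_apply]
  exact Finset.sum_congr rfl fun _ _ ↦ mul_comm _ _

end AreaForm

/-! ### Spinor algebra in one fibre -/

section Fibre

variable {M₁ : Type*} [TopologicalSpace M₁] [ChartedSpace (EuclideanSpace ℝ (Fin 2)) M₁]
  [IsManifold (𝓡 2) ∞ M₁]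
  [RiemannianBundle (fun x : M₁ ↦ TangentSpace (𝓡 2) x)]
  [IsContMDiffRiemannianBundle (𝓡 2) ∞ (EuclideanSpace ℝ (Fin 2))
    (fun x : M₁ ↦ TangentSpace (𝓡 2) x)]
  {S : M₁ → Type*} [TopologicalSpace (TotalSpace (EuclideanSpace ℝ (Fin 2)) S)]
  [∀ x, NormedAddCommGroup (S x)] [∀ x, InnerProductSpace ℝ (S x)]
  [FiberBundle (EuclideanSpace ℝ (Fin 2)) S] [VectorBundle ℝ (EuclideanSpace ℝ (Fin 2)) S]
  [ContMDiffVectorBundle ∞ (EuclideanSpace ℝ (Fin 2)) S (𝓡 2)]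
  [IsContMDiffRiemannianBundle (𝓡 2) ∞ (EuclideanSpace ℝ (Fin 2)) S]
  {ω₁ : AreaForm (𝓡 2) (EuclideanSpace ℝ (Fin 2)) (fun x : M₁ ↦ TangentSpace (𝓡 2) x)}

theorem finrank_fibre_eq_two (V : M₁ → Type*)
    [TopologicalSpace (TotalSpace (EuclideanSpace ℝ (Fin 2)) V)] [∀ x, AddCommGroup (V x)]
    [∀ x, Module ℝ (V x)] [∀ x, TopologicalSpace (V x)] [FiberBundle (EuclideanSpace ℝ (Fin 2)) V]
    [VectorBundle ℝ (EuclideanSpace ℝ (Fin 2)) V] (x : M₁) : Module.finrank ℝ (V x) = 2 := by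
  rw [((trivializationAt (EuclideanSpace ℝ (Fin 2)) V x).continuousLinearEquivAt ℝ x
    (FiberBundle.mem_baseSet_trivializationAt' x)).toLinearEquiv.finrank_eq]
  simp

/-- An oriented orthonormal basis of a fibre of the spinor bundle. -/
structure IsSpinPair (σ : SpinStructure S ω₁) {x : M₁} (u v : S x) : Prop where
  norm_left : ‖u‖ = 1
  norm_right : ‖v‖ = 1
  inner_eq : inner ℝ u v = 0
  area_eq : σ.area.toFun x u v = 1

namespace IsSpinPair

variable {σ : SpinStructure S ω₁} {x : M₁} {u v : S x}

theorem exists_basis (h : IsSpinPair σ u v) :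
    ∃ b : OrthonormalBasis (Fin 2) ℝ (S x), b 0 = u ∧ b 1 = v :=
  exists_orthonormalBasis_of_pair (finrank_fibre_eq_two S x) h.norm_left h.norm_right h.inner_eq

theorem eq_add (h : IsSpinPair σ u v) (w : S x) : w = inner ℝ u w • u + inner ℝ v w • v :=
  eq_of_inner_pair (finrank_fibre_eq_two S x) h.norm_left h.norm_right h.inner_eq w

theorem rotation_left (h : IsSpinPair σ u v) : σ.area.rotation x u = v := by
  rw [h.eq_add (σ.area.rotation x u), real_inner_comm, real_inner_comm _ v,
    AreaForm.inner_rotation, AreaForm.inner_rotation, AreaForm.alternating, h.area_eq]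
  simp

theorem rotation_right (h : IsSpinPair σ u v) : σ.area.rotation x v = -u := by
  rw [h.eq_add (σ.area.rotation x v), real_inner_comm, real_inner_comm _ v,
    AreaForm.inner_rotation, AreaForm.inner_rotation, AreaForm.alternating, AreaForm.swap,
    h.area_eq]
  simp

theorem norm_sq_left (h : IsSpinPair σ u v) : ‖σ.sq x u u‖ = 1 := by
  rw [σ.norm_eq, h.norm_left]; norm_num

theorem norm_sq_right (h : IsSpinPair σ u v) : ‖σ.sq x u v‖ = 1 := by
  rw [σ.norm_eq, h.norm_left, h.norm_right]; norm_num

theorem norm_add_eq (h : IsSpinPair σ u v) : ‖u + v‖ ^ 2 = 2 ∧ ‖u - v‖ ^ 2 = 2 := by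
  rw [@norm_add_sq_real, @norm_sub_sq_real, h.norm_left, h.norm_right, h.inner_eq]; norm_num

/-- The product multiplies norms, so `|u·(u + v)|² = |u + v|² = 2`. Expanding the left side as `1 +
1 + 2⟨u·u, u·v⟩` forces the inner product to vanish. -/
theorem inner_sq (h : IsSpinPair σ u v) : inner ℝ (σ.sq x u u) (σ.sq x u v) = 0 := by
  have h1 := @norm_add_sq_real _ _ _ (σ.sq x u u) (σ.sq x u v)
  rw [← map_add, σ.norm_eq, mul_pow, h.norm_left, h.norm_add_eq.1, h.norm_sq_left,
    h.norm_sq_right] at h1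
  linarith

/-- By multiplicativity of the norm `|u·u - v·v|² = |u + v|² |u - v|² = 4`. Two unit vectors at
distance `2` are opposite. -/
theorem sq_right_right (h : IsSpinPair σ u v) : σ.sq x v v = -σ.sq x u u := by
  have h0 : ‖σ.sq x v v‖ = 1 := by rw [σ.norm_eq, h.norm_right]; norm_num
  have h1 : σ.sq x (u + v) (u - v) = σ.sq x u u - σ.sq x v v := by
    simp only [map_add, map_sub, _root_.add_apply, σ.symm x v u]; abel
  have h2 := @norm_sub_sq_real _ _ _ (σ.sq x u u) (σ.sq x v v)
  rw [← h1, σ.norm_eq, mul_pow, h.norm_add_eq.1, h.norm_add_eq.2, h0, h.norm_sq_left] at h2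
  have h3 := @norm_add_sq_real _ _ _ (σ.sq x v v) (σ.sq x u u)
  rw [h0, h.norm_sq_left, real_inner_comm] at h3
  have h4 : ‖σ.sq x v v + σ.sq x u u‖ ^ 2 = 0 := by rw [h3]; linarith
  exact eq_neg_of_add_eq_zero_left (by simpa using h4)

theorem exists_tangent_basis (h : IsSpinPair σ u v) :
    ∃ b : OrthonormalBasis (Fin 2) ℝ (TangentSpace (𝓡 2) x),
      b 0 = σ.sq x u u ∧ b 1 = σ.sq x u v :=
  exists_orthonormalBasis_of_pair (finrank_fibre_eq_two (fun x : M₁ ↦ TangentSpace (𝓡 2) x) x)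
    h.norm_sq_left h.norm_sq_right h.inner_sq

end IsSpinPair

/-- The defining adjunction of Clifford multiplication, free of the basis chosen in `clifford`. -/
theorem SpinStructure.inner_clifford (σ : SpinStructure S ω₁) (x : M₁) (v : TangentSpace (𝓡 2) x)
    (s t : S x) : inner ℝ (σ.clifford x v s) t = inner ℝ v (σ.sq x s t) := by
  have : FiniteDimensional ℝ (S x) :=
    VectorBundle.finiteDimensional ℝ (EuclideanSpace ℝ (Fin 2)) S x
  set b := stdOrthonormalBasis ℝ (S x)
  conv_rhs => rw [← b.sum_repr' t]
  simp only [clifford, FunLike.coe_sum, Finset.sum_apply, ContinuousLinearMap.smulRight_apply,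
    sum_inner, real_inner_smul_left, map_sum, map_smul, ContinuousLinearMap.flip_apply,
    ContinuousLinearMap.comp_apply, inner_sum, real_inner_smul_right, innerSL_apply_apply]
  exact Finset.sum_congr rfl fun _ _ ↦ mul_comm _ _

namespace IsSpinPair

variable {σ : SpinStructure S ω₁} {x : M₁} {u v : S x}

/-- This lemma and the three after it are the columns of the matrices of `γ(e₁)` and `γ(e₂)` in the
basis `u, v`, where `e₁ = u·u` and `e₂ = u·v`: `diag(1, -1)` and `antidiag(1, 1)`. They are read off
from `inner_clifford`, the orthonormality of `e₁, e₂`, and `v·v = -e₁`. -/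
theorem clifford_left_left (h : IsSpinPair σ u v) : σ.clifford x (σ.sq x u u) u = u := by
  rw [h.eq_add (σ.clifford x _ u), real_inner_comm, real_inner_comm _ v, σ.inner_clifford,
    σ.inner_clifford, h.inner_sq, real_inner_self_eq_norm_sq, h.norm_sq_left]
  simp

theorem clifford_left_right (h : IsSpinPair σ u v) : σ.clifford x (σ.sq x u u) v = -v := by
  rw [h.eq_add (σ.clifford x _ v), real_inner_comm, real_inner_comm _ v, σ.inner_clifford,
    σ.inner_clifford, σ.symm x v u, h.inner_sq, h.sq_right_right, inner_neg_right,
    real_inner_self_eq_norm_sq, h.norm_sq_left]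
  simp

theorem clifford_right_left (h : IsSpinPair σ u v) : σ.clifford x (σ.sq x u v) u = v := by
  have h0 := h.inner_sq
  rw [real_inner_comm] at h0
  rw [h.eq_add (σ.clifford x _ u), real_inner_comm, real_inner_comm _ v, σ.inner_clifford,
    σ.inner_clifford, h0, real_inner_self_eq_norm_sq, h.norm_sq_right]
  simp

theorem clifford_right_right (h : IsSpinPair σ u v) : σ.clifford x (σ.sq x u v) v = u := by
  have h0 := h.inner_sq
  rw [real_inner_comm] at h0
  rw [h.eq_add (σ.clifford x _ v), real_inner_comm, real_inner_comm _ v, σ.inner_clifford,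
    σ.inner_clifford, σ.symm x v u, h.sq_right_right, inner_neg_right, h0,
    real_inner_self_eq_norm_sq, h.norm_sq_right]
  simp

end IsSpinPair
end Fibre

/-! ### The Dirac operator and the pairing in a spin basis -/

section DiracFormula

variable {M₁ : Type*} [TopologicalSpace M₁] [ChartedSpace (EuclideanSpace ℝ (Fin 2)) M₁]
  [IsManifold (𝓡 2) ∞ M₁]
  [RiemannianBundle (fun x : M₁ ↦ TangentSpace (𝓡 2) x)]
  [IsContMDiffRiemannianBundle (𝓡 2) ∞ (EuclideanSpace ℝ (Fin 2))
    (fun x : M₁ ↦ TangentSpace (𝓡 2) x)]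
  {S : M₁ → Type*} [TopologicalSpace (TotalSpace (EuclideanSpace ℝ (Fin 2)) S)]
  [∀ x, NormedAddCommGroup (S x)] [∀ x, InnerProductSpace ℝ (S x)]
  [FiberBundle (EuclideanSpace ℝ (Fin 2)) S] [VectorBundle ℝ (EuclideanSpace ℝ (Fin 2)) S]
  [ContMDiffVectorBundle ∞ (EuclideanSpace ℝ (Fin 2)) S (𝓡 2)]
  [IsContMDiffRiemannianBundle (𝓡 2) ∞ (EuclideanSpace ℝ (Fin 2)) S]
  {ω₁ : AreaForm (𝓡 2) (EuclideanSpace ℝ (Fin 2)) (fun x : M₁ ↦ TangentSpace (𝓡 2) x)}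
  {n : ℕ} {M₂ : Type*} [TopologicalSpace M₂] [ChartedSpace (EuclideanSpace ℝ (Fin n)) M₂]
  [IsManifold (𝓡 n) ∞ M₂]

theorem pullbackCov_eq_of_eventuallyEq
    (cov₂ : CovariantDerivative (𝓡 n) (EuclideanSpace ℝ (Fin n))
      (fun q : M₂ ↦ TangentSpace (𝓡 n) q))
    (φ : C^∞⟮𝓡 2, M₁; 𝓡 n, M₂⟯)
    {y z : Π x, ((φ : M₁ → M₂) *ᵖ (fun q : M₂ ↦ TangentSpace (𝓡 n) q)) x} {x : M₁}
    (h : ∀ᶠ x' in nhds x, y x' = z x') : pullbackCov cov₂ φ y x = pullbackCov cov₂ φ z x := by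
  unfold pullbackCov
  have h0 (a : Fin n) : pullbackCoeff φ y x a =ᶠ[nhds x] pullbackCoeff φ z x a :=
    h.mono fun x' hx' ↦ by simp only [pullbackCoeff, hx']
  refine Finset.sum_congr rfl fun a _ ↦ ?_
  rw [(h0 a).eq_of_nhds, mvfderiv, mvfderiv, (h0 a).mfderiv_eq]
  rfl

theorem twistedCov_add_vector
    (covS : CovariantDerivative (𝓡 2) (EuclideanSpace ℝ (Fin 2)) S)
    (cov₂ : CovariantDerivative (𝓡 n) (EuclideanSpace ℝ (Fin n))
      (fun q : M₂ ↦ TangentSpace (𝓡 n) q))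
    (φ : C^∞⟮𝓡 2, M₁; 𝓡 n, M₂⟯) (ψ : Π x, TwistedFiber S φ x) (x : M₁)
    (v w : TangentSpace (𝓡 2) x) :
    twistedCov covS cov₂ φ ψ x (v + w) =
      twistedCov covS cov₂ φ ψ x v + twistedCov covS cov₂ φ ψ x w := by
  unfold twistedCov
  rw [← Finset.sum_add_distrib]
  refine Finset.sum_congr rfl fun k _ ↦ ?_
  ext s
  simp only [map_add, _root_.add_apply, ContinuousLinearMap.smulRight_apply, ← smul_add]
  congr 1
  abel

theorem twistedCov_smul_vector
    (covS : CovariantDerivative (𝓡 2) (EuclideanSpace ℝ (Fin 2)) S)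
    (cov₂ : CovariantDerivative (𝓡 n) (EuclideanSpace ℝ (Fin n))
      (fun q : M₂ ↦ TangentSpace (𝓡 n) q))
    (φ : C^∞⟮𝓡 2, M₁; 𝓡 n, M₂⟯) (ψ : Π x, TwistedFiber S φ x) (x : M₁)
    (c : ℝ) (v : TangentSpace (𝓡 2) x) :
    twistedCov covS cov₂ φ ψ x (c • v) = c • twistedCov covS cov₂ φ ψ x v := by
  unfold twistedCov
  rw [Finset.smul_sum]
  refine Finset.sum_congr rfl fun k _ ↦ ?_
  ext s
  simp only [map_smul, _root_.smul_apply, ContinuousLinearMap.smulRight_apply, ← smul_sub]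
  rw [smul_comm]

theorem clifford_add (σ : SpinStructure S ω₁) (x : M₁) (v w : TangentSpace (𝓡 2) x) :
    σ.clifford x (v + w) = σ.clifford x v + σ.clifford x w := by
  ext s
  refine ext_inner_right ℝ fun t ↦ ?_
  rw [_root_.add_apply, inner_add_left, σ.inner_clifford, σ.inner_clifford, σ.inner_clifford,
    inner_add_left]

theorem clifford_smul (σ : SpinStructure S ω₁) (x : M₁) (c : ℝ) (v : TangentSpace (𝓡 2) x) :
    σ.clifford x (c • v) = c • σ.clifford x v := by
  ext s
  refine ext_inner_right ℝ fun t ↦ ?_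
  rw [_root_.smul_apply, real_inner_smul_left, σ.inner_clifford, σ.inner_clifford,
    real_inner_smul_left]

/-- The bilinear map `(v, w) ↦ γ(v) ∇_w ψ` whose trace is the Dirac operator. -/
def cliffordCov (σ : SpinStructure S ω₁)
    (covS : CovariantDerivative (𝓡 2) (EuclideanSpace ℝ (Fin 2)) S)
    (cov₂ : CovariantDerivative (𝓡 n) (EuclideanSpace ℝ (Fin n))
      (fun q : M₂ ↦ TangentSpace (𝓡 n) q))
    (φ : C^∞⟮𝓡 2, M₁; 𝓡 n, M₂⟯) (ψ : Π x, TwistedFiber S φ x) (x : M₁) :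
    TangentSpace (𝓡 2) x →ₗ[ℝ] TangentSpace (𝓡 2) x →ₗ[ℝ] TwistedFiber S φ x :=
  LinearMap.mk₂ ℝ (fun v w ↦ (twistedCov covS cov₂ φ ψ x v).comp (σ.clifford x w))
    (fun v v' w ↦ by rw [twistedCov_add_vector, ContinuousLinearMap.add_comp])
    (fun c v w ↦ by rw [twistedCov_smul_vector, ContinuousLinearMap.smul_comp])
    (fun v w w' ↦ by rw [clifford_add, ContinuousLinearMap.comp_add])
    (fun c v w ↦ by rw [clifford_smul, ContinuousLinearMap.comp_smul])

/-- `D` is the trace of a bilinear map, so the basis chosen pointwise in its definition, which need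
not vary continuously, may be replaced by `e₁ = u·u`, `e₂ = u·v`. -/
theorem dirac_eq_sum (σ : SpinStructure S ω₁)
    (covS : CovariantDerivative (𝓡 2) (EuclideanSpace ℝ (Fin 2)) S)
    (cov₂ : CovariantDerivative (𝓡 n) (EuclideanSpace ℝ (Fin n))
      (fun q : M₂ ↦ TangentSpace (𝓡 n) q))
    (φ : C^∞⟮𝓡 2, M₁; 𝓡 n, M₂⟯) (ψ : Π x, TwistedFiber S φ x) {x : M₁} {u v : S x}
    (h : IsSpinPair σ u v) :
    dirac σ covS cov₂ φ ψ x =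
      (twistedCov covS cov₂ φ ψ x (σ.sq x u u)).comp (σ.clifford x (σ.sq x u u)) +
      (twistedCov covS cov₂ φ ψ x (σ.sq x u v)).comp (σ.clifford x (σ.sq x u v)) := by
  have : FiniteDimensional ℝ (TangentSpace (𝓡 2) x) :=
    inferInstanceAs (FiniteDimensional ℝ (EuclideanSpace ℝ (Fin 2)))
  obtain ⟨b, hb0, hb1⟩ := h.exists_tangent_basis
  have h1 := sum_bilin_orthonormalBasis (stdOrthonormalBasis ℝ (TangentSpace (𝓡 2) x)) b
    (cliffordCov σ covS cov₂ φ ψ x)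
  rw [Fin.sum_univ_two, hb0, hb1] at h1
  exact h1

theorem dirac_apply_left (σ : SpinStructure S ω₁)
    (covS : CovariantDerivative (𝓡 2) (EuclideanSpace ℝ (Fin 2)) S)
    (cov₂ : CovariantDerivative (𝓡 n) (EuclideanSpace ℝ (Fin n))
      (fun q : M₂ ↦ TangentSpace (𝓡 n) q))
    (φ : C^∞⟮𝓡 2, M₁; 𝓡 n, M₂⟯) (ψ : Π x, TwistedFiber S φ x) {x : M₁} {u v : S x}
    (h : IsSpinPair σ u v) :
    dirac σ covS cov₂ φ ψ x u =
      twistedCov covS cov₂ φ ψ x (σ.sq x u u) u + twistedCov covS cov₂ φ ψ x (σ.sq x u v) v := by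
  rw [dirac_eq_sum σ covS cov₂ φ ψ h, _root_.add_apply, ContinuousLinearMap.comp_apply,
    ContinuousLinearMap.comp_apply, h.clifford_left_left, h.clifford_right_left]

theorem dirac_apply_right (σ : SpinStructure S ω₁)
    (covS : CovariantDerivative (𝓡 2) (EuclideanSpace ℝ (Fin 2)) S)
    (cov₂ : CovariantDerivative (𝓡 n) (EuclideanSpace ℝ (Fin n))
      (fun q : M₂ ↦ TangentSpace (𝓡 n) q))
    (φ : C^∞⟮𝓡 2, M₁; 𝓡 n, M₂⟯) (ψ : Π x, TwistedFiber S φ x) {x : M₁} {u v : S x}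
    (h : IsSpinPair σ u v) :
    dirac σ covS cov₂ φ ψ x v =
      -twistedCov covS cov₂ φ ψ x (σ.sq x u u) v + twistedCov covS cov₂ φ ψ x (σ.sq x u v) u := by
  rw [dirac_eq_sum σ covS cov₂ φ ψ h, _root_.add_apply, ContinuousLinearMap.comp_apply,
    ContinuousLinearMap.comp_apply, h.clifford_left_right, h.clifford_right_right, map_neg]

variable [RiemannianBundle (fun q : M₂ ↦ TangentSpace (𝓡 n) q)]

/-- The metric of `φ*TM₂`. -/
def pullbackInner (φ : C^∞⟮𝓡 2, M₁; 𝓡 n, M₂⟯) (x : M₁) :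
    ((φ : M₁ → M₂) *ᵖ (fun q : M₂ ↦ TangentSpace (𝓡 n) q)) x →ₗ[ℝ]
      ((φ : M₁ → M₂) *ᵖ (fun q : M₂ ↦ TangentSpace (𝓡 n) q)) x →ₗ[ℝ] ℝ :=
  LinearMap.mk₂ ℝ (fun v w ↦ @inner ℝ (TangentSpace (𝓡 n) (φ x)) _ v w)
    (fun _ _ _ ↦ inner_add_left (E := TangentSpace (𝓡 n) (φ x)) _ _ _)
    (fun _ _ _ ↦ real_inner_smul_left (F := TangentSpace (𝓡 n) (φ x)) _ _ _)
    (fun _ _ _ ↦ inner_add_right (E := TangentSpace (𝓡 n) (φ x)) _ _ _)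
    (fun _ _ _ ↦ real_inner_smul_right (F := TangentSpace (𝓡 n) (φ x)) _ _ _)

theorem pullbackInner_comm (φ : C^∞⟮𝓡 2, M₁; 𝓡 n, M₂⟯) (x : M₁)
    (v w : ((φ : M₁ → M₂) *ᵖ (fun q : M₂ ↦ TangentSpace (𝓡 n) q)) x) :
    pullbackInner φ x v w = pullbackInner φ x w v :=
  real_inner_comm (F := TangentSpace (𝓡 n) (φ x)) _ _

/-- Again independence of the trace from the basis, now for `(s, t) ↦ g₂(A s, B (J t))`, with `J u =
v` and `J v = -u`. -/
theorem twistedInner_eq (σ : SpinStructure S ω₁) (φ : C^∞⟮𝓡 2, M₁; 𝓡 n, M₂⟯) {x : M₁}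
    {u v : S x} (h : IsSpinPair σ u v) (A B : TwistedFiber S φ x) :
    twistedInner σ φ x A B = pullbackInner φ x (A u) (B v) - pullbackInner φ x (A v) (B u) := by
  have : FiniteDimensional ℝ (S x) :=
    VectorBundle.finiteDimensional ℝ (EuclideanSpace ℝ (Fin 2)) S x
  obtain ⟨b, hb0, hb1⟩ := h.exists_basis
  have h1 := sum_bilin_orthonormalBasis (stdOrthonormalBasis ℝ (S x)) b
    ((pullbackInner φ x).compl₁₂ A.toLinearMap (B.comp (σ.area.rotation x)).toLinearMap)
  rw [Fin.sum_univ_two, hb0, hb1] at h1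
  refine Eq.trans h1 ?_
  simp only [LinearMap.compl₁₂_apply, ContinuousLinearMap.coe_coe, ContinuousLinearMap.comp_apply,
    h.rotation_left, h.rotation_right, map_neg, sub_eq_add_neg]

end DiracFormula

/-! ### Connections on frame expansions -/

section Frames

variable {EB : Type*} [NormedAddCommGroup EB] [NormedSpace ℝ EB]
  {HB : Type*} [TopologicalSpace HB] {I : ModelWithCorners ℝ EB HB}
  {M : Type*} [TopologicalSpace M] [ChartedSpace HB M]

theorem mvfderiv_congr {f g : M → ℝ} {x : M} (h : f =ᶠ[nhds x] g) :
    mvfderiv I f x = mvfderiv I g x := by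
  rw [mvfderiv, mvfderiv, h.mfderiv_eq]
  rfl

theorem mvfderiv_finset_sum {ι : Type*} (s : Finset ι) {f : ι → M → ℝ} {x : M}
    (hf : ∀ i ∈ s, MDifferentiableAt I 𝓘(ℝ) (f i) x) :
    MDifferentiableAt I 𝓘(ℝ) (∑ i ∈ s, f i) x ∧
      mvfderiv I (∑ i ∈ s, f i) x = ∑ i ∈ s, mvfderiv I (f i) x := by
  classical
  induction s using Finset.induction_on with
  | empty => exact ⟨mdifferentiableAt_const (c := (0 : ℝ)), by simp⟩
  | insert i s hi ih =>
    obtain ⟨h1, h2⟩ := ih fun j hj ↦ hf j (Finset.mem_insert_of_mem hj)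
    have h3 := hf i (Finset.mem_insert_self i s)
    rw [Finset.sum_insert hi, Finset.sum_insert hi]
    exact ⟨h3.add h1, by rw [mvfderiv_add h3 h1, h2]⟩

variable {F : Type*} [NormedAddCommGroup F] [NormedSpace ℝ F]
  {V : M → Type*} [TopologicalSpace (TotalSpace F V)]
  [∀ x, AddCommGroup (V x)] [∀ x, Module ℝ (V x)] [∀ x : M, TopologicalSpace (V x)]
  [∀ x, IsTopologicalAddGroup (V x)] [∀ x, ContinuousSMul ℝ (V x)]
  [FiberBundle F V] [VectorBundle ℝ F V]

/-- Leibniz rule for a frame expansion; every comparison of connections below expands a section in a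
local frame and applies this. -/
theorem covariantDerivative_sum_smul (cov : CovariantDerivative I F V) {ι : Type*} (s : Finset ι)
    {c : ι → M → ℝ} {e : ι → Π x, V x} {x : M}
    (hc : ∀ i ∈ s, MDifferentiableAt I 𝓘(ℝ) (c i) x)
    (he : ∀ i ∈ s, MDifferentiableAt I (I.prod 𝓘(ℝ, F)) (fun y ↦ TotalSpace.mk' F y (e i y)) x) :
    cov (fun y ↦ ∑ i ∈ s, c i y • e i y) x =
      ∑ i ∈ s, (c i x • cov (e i) x + (mvfderiv I (c i) x).smulRight (e i x)) := by
  classical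
  induction s using Finset.induction_on with
  | empty =>
    simp only [Finset.sum_empty]
    exact congrFun cov.zero x
  | insert i s hi ih =>
    simp only [Finset.sum_insert hi]
    have h3 := hc i (Finset.mem_insert_self i s)
    have h4 := he i (Finset.mem_insert_self i s)
    have h5 : MDifferentiableAt I (I.prod 𝓘(ℝ, F))
        (fun y ↦ TotalSpace.mk' F y (∑ i ∈ s, c i y • e i y)) x :=
      .sum_section fun j hj ↦ (hc j (Finset.mem_insert_of_mem hj)).smul_section
        (he j (Finset.mem_insert_of_mem hj))
    have h6 := cov.isCovariantDerivativeOnUniv.add (h3.smul_section h4) h5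
    rw [← ih (fun j hj ↦ hc j (Finset.mem_insert_of_mem hj))
      (fun j hj ↦ he j (Finset.mem_insert_of_mem hj)),
      ← cov.isCovariantDerivativeOnUniv.leibniz h4 h3]
    exact h6

theorem covariantDerivative_congr (cov : CovariantDerivative I F V) {s t : Π x, V x} {x : M}
    (hs : MDifferentiableAt I (I.prod 𝓘(ℝ, F)) (fun y ↦ TotalSpace.mk' F y (s y)) x)
    (h : ∀ᶠ y in nhds x, s y = t y) : cov s x = cov t x := by
  refine cov.isCovariantDerivativeOnUniv.congr_of_eventuallyEq hs ?_ Filter.univ_mem h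
  exact hs.congr_of_eventuallyEq (h.mono fun y hy ↦ by simp only [hy])

end Frames

/-! ### The local frame of a trivialization -/

section TrivializationFrame

variable {EB : Type*} [NormedAddCommGroup EB] [NormedSpace ℝ EB]
  {HB : Type*} [TopologicalSpace HB] {I : ModelWithCorners ℝ EB HB}
  {M : Type*} [TopologicalSpace M] [ChartedSpace HB M] {m : ℕ}
  {V : M → Type*} [TopologicalSpace (TotalSpace (EuclideanSpace ℝ (Fin m)) V)]
  [∀ x, AddCommGroup (V x)] [∀ x, Module ℝ (V x)] [∀ x : M, TopologicalSpace (V x)]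
  [FiberBundle (EuclideanSpace ℝ (Fin m)) V] [VectorBundle ℝ (EuclideanSpace ℝ (Fin m)) V]

theorem contMDiffAt_symm_const [IsManifold I ∞ M]
    [ContMDiffVectorBundle ∞ (EuclideanSpace ℝ (Fin m)) V I] (x₀ : M)
    (w : EuclideanSpace ℝ (Fin m)) {x : M}
    (hx : x ∈ (trivializationAt (EuclideanSpace ℝ (Fin m)) V x₀).baseSet) :
    ContMDiffAt I (I.prod 𝓘(ℝ, EuclideanSpace ℝ (Fin m))) ∞ (fun y ↦ TotalSpace.mk'
      (EuclideanSpace ℝ (Fin m)) y ((trivializationAt (EuclideanSpace ℝ (Fin m)) V x₀).symm y w))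
      x := by
  rw [(trivializationAt (EuclideanSpace ℝ (Fin m)) V x₀).contMDiffAt_section_iff hx]
  refine (contMDiffAt_const (c := w)).congr_of_eventuallyEq ?_
  filter_upwards [(trivializationAt (EuclideanSpace ℝ (Fin m)) V x₀).open_baseSet.mem_nhds hx]
    with y hy
  rw [Trivialization.apply_mk_symm _ hy]

theorem eq_sum_trivialization (x₀ : M) {x : M}
    (hx : x ∈ (trivializationAt (EuclideanSpace ℝ (Fin m)) V x₀).baseSet) (s : V x) :
    s = ∑ k, (trivializationAt (EuclideanSpace ℝ (Fin m)) V x₀ ⟨x, s⟩).2 k •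
      (trivializationAt (EuclideanSpace ℝ (Fin m)) V x₀).symm x (EuclideanSpace.single k 1) := by
  set e := trivializationAt (EuclideanSpace ℝ (Fin m)) V x₀
  have h1 : (e ⟨x, s⟩).2 = ∑ k, (e ⟨x, s⟩).2 k • EuclideanSpace.single k (1 : ℝ) := by
    ext j
    simp [Finset.sum_apply, Pi.single_apply]
  have h2 : e.symmL ℝ x (e ⟨x, s⟩).2 = s := by
    rw [Trivialization.symmL_apply _ hx]
    exact e.symm_proj_apply ⟨x, s⟩ hx
  conv_lhs => rw [← h2, h1, map_sum]
  refine Finset.sum_congr rfl fun k _ ↦ ?_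
  rw [map_smul, Trivialization.symmL_apply _ hx]

theorem mdifferentiableAt_trivialization_coeff {s : Π x, V x} {x : M}
    (hs : MDifferentiableAt I (I.prod 𝓘(ℝ, EuclideanSpace ℝ (Fin m)))
      (fun y ↦ TotalSpace.mk' (EuclideanSpace ℝ (Fin m)) y (s y)) x) (k : Fin m) :
    MDifferentiableAt I 𝓘(ℝ)
      (fun y ↦ (trivializationAt (EuclideanSpace ℝ (Fin m)) V x ⟨y, s y⟩).2 k) x :=
  ((EuclideanSpace.proj k : EuclideanSpace ℝ (Fin m) →L[ℝ] ℝ).mdifferentiableAt).comp x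
    ((mdifferentiableAt_section _ _).1 hs)

end TrivializationFrame

/-! ### The pullback connection and the twisted connection -/

section PullbackConnection

variable {M₁ : Type*} [TopologicalSpace M₁] [ChartedSpace (EuclideanSpace ℝ (Fin 2)) M₁]
  [IsManifold (𝓡 2) ∞ M₁]
  [RiemannianBundle (fun x : M₁ ↦ TangentSpace (𝓡 2) x)]
  [IsContMDiffRiemannianBundle (𝓡 2) ∞ (EuclideanSpace ℝ (Fin 2))
    (fun x : M₁ ↦ TangentSpace (𝓡 2) x)]
  {S : M₁ → Type*} [TopologicalSpace (TotalSpace (EuclideanSpace ℝ (Fin 2)) S)]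
  [∀ x, NormedAddCommGroup (S x)] [∀ x, InnerProductSpace ℝ (S x)]
  [FiberBundle (EuclideanSpace ℝ (Fin 2)) S] [VectorBundle ℝ (EuclideanSpace ℝ (Fin 2)) S]
  [ContMDiffVectorBundle ∞ (EuclideanSpace ℝ (Fin 2)) S (𝓡 2)]
  [IsContMDiffRiemannianBundle (𝓡 2) ∞ (EuclideanSpace ℝ (Fin 2)) S]
  {ω₁ : AreaForm (𝓡 2) (EuclideanSpace ℝ (Fin 2)) (fun x : M₁ ↦ TangentSpace (𝓡 2) x)}
  {n : ℕ} {M₂ : Type*} [TopologicalSpace M₂] [ChartedSpace (EuclideanSpace ℝ (Fin n)) M₂]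
  [IsManifold (𝓡 n) ∞ M₂]

/-- The identification of `T_{φ(x)}M₂` with the fibre of `φ*TM₂` at `x`. -/
def toPullback (φ : C^∞⟮𝓡 2, M₁; 𝓡 n, M₂⟯) (x : M₁) : TangentSpace (𝓡 n) (φ x) →L[ℝ]
    ((φ : M₁ → M₂) *ᵖ (fun q : M₂ ↦ TangentSpace (𝓡 n) q)) x :=
  ContinuousLinearMap.id ℝ (TangentSpace (𝓡 n) (φ x))

/-- The trivialization of `φ*TM₂` at `x` is that of `TM₂` at `φ x`, so sections of `φ*TM₂` can be
treated as vector fields along `φ`; the base component is `φ` itself, which is smooth. -/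
theorem contMDiffAt_pullback_iff (φ : C^∞⟮𝓡 2, M₁; 𝓡 n, M₂⟯)
    {y : Π x, ((φ : M₁ → M₂) *ᵖ (fun q : M₂ ↦ TangentSpace (𝓡 n) q)) x} {x : M₁} :
    ContMDiffAt (𝓡 2) ((𝓡 2).prod 𝓘(ℝ, EuclideanSpace ℝ (Fin n))) ∞
      (fun x' ↦ TotalSpace.mk' (EuclideanSpace ℝ (Fin n)) x' (y x')) x ↔
    ContMDiffAt (𝓡 2) ((𝓡 n).prod 𝓘(ℝ, EuclideanSpace ℝ (Fin n))) ∞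
      (fun x' ↦ TotalSpace.mk' (EuclideanSpace ℝ (Fin n))
        (E := fun q : M₂ ↦ TangentSpace (𝓡 n) q) (φ x') (y x')) x := by
  rw [contMDiffAt_section, contMDiffAt_totalSpace]
  exact ⟨fun h ↦ ⟨φ.contMDiff x, h⟩, fun h ↦ h.2⟩

theorem pullbackCoeff_eq (φ : C^∞⟮𝓡 2, M₁; 𝓡 n, M₂⟯)
    (y : Π x, ((φ : M₁ → M₂) *ᵖ (fun q : M₂ ↦ TangentSpace (𝓡 n) q)) x) {x x' : M₁}
    (hx : φ x' ∈ (trivializationAt (EuclideanSpace ℝ (Fin n))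
      (fun q : M₂ ↦ TangentSpace (𝓡 n) q) (φ x)).baseSet) (a : Fin n) :
    pullbackCoeff φ y x a x' = (trivializationAt (EuclideanSpace ℝ (Fin n))
      (fun q : M₂ ↦ TangentSpace (𝓡 n) q) (φ x) ⟨φ x', y x'⟩).2 a := by
  unfold pullbackCoeff
  rw [Trivialization.continuousLinearMapAt_apply, Trivialization.linearMapAt_apply, if_pos]
  · rfl
  · exact hx

theorem eventually_mem_baseSet_comp (φ : C^∞⟮𝓡 2, M₁; 𝓡 n, M₂⟯) (x : M₁) :
    ∀ᶠ x' in nhds x, φ x' ∈ (trivializationAt (EuclideanSpace ℝ (Fin n))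
      (fun q : M₂ ↦ TangentSpace (𝓡 n) q) (φ x)).baseSet :=
  φ.contMDiff.continuous.continuousAt.eventually_mem
    ((trivializationAt (EuclideanSpace ℝ (Fin n))
      (fun q : M₂ ↦ TangentSpace (𝓡 n) q) (φ x)).open_baseSet.mem_nhds
      (FiberBundle.mem_baseSet_trivializationAt' (φ x)))

theorem eq_sum_pullbackCoeff (φ : C^∞⟮𝓡 2, M₁; 𝓡 n, M₂⟯)
    (y : Π x, ((φ : M₁ → M₂) *ᵖ (fun q : M₂ ↦ TangentSpace (𝓡 n) q)) x) {x x' : M₁}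
    (hx : φ x' ∈ (trivializationAt (EuclideanSpace ℝ (Fin n))
      (fun q : M₂ ↦ TangentSpace (𝓡 n) q) (φ x)).baseSet) :
    y x' = ∑ a, pullbackCoeff φ y x a x' • toPullback φ x' (targetFrame (φ x) a (φ x')) := by
  simp only [pullbackCoeff_eq φ y hx]
  exact eq_sum_trivialization (V := fun q : M₂ ↦ TangentSpace (𝓡 n) q) (φ x) hx (y x')

theorem mdifferentiableAt_targetFrame (q₀ : M₂) (a : Fin n) {q : M₂}
    (hq : q ∈ (trivializationAt (EuclideanSpace ℝ (Fin n))
      (fun q : M₂ ↦ TangentSpace (𝓡 n) q) q₀).baseSet) :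
    MDifferentiableAt (𝓡 n) ((𝓡 n).prod 𝓘(ℝ, EuclideanSpace ℝ (Fin n)))
      (fun q ↦ TotalSpace.mk' (EuclideanSpace ℝ (Fin n))
        (E := fun q : M₂ ↦ TangentSpace (𝓡 n) q) q (targetFrame q₀ a q)) q :=
  (contMDiffAt_symm_const (I := 𝓡 n) (V := fun q : M₂ ↦ TangentSpace (𝓡 n) q) q₀ _ hq
    ).mdifferentiableAt (by norm_num)

/-- The pullback of a connection is a connection. -/
def pullbackConnection
    (cov₂ : CovariantDerivative (𝓡 n) (EuclideanSpace ℝ (Fin n))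
      (fun q : M₂ ↦ TangentSpace (𝓡 n) q))
    (φ : C^∞⟮𝓡 2, M₁; 𝓡 n, M₂⟯) :
    CovariantDerivative (𝓡 2) (EuclideanSpace ℝ (Fin n))
      ((φ : M₁ → M₂) *ᵖ (fun q : M₂ ↦ TangentSpace (𝓡 n) q)) where
  toFun := pullbackCov cov₂ φ
  isCovariantDerivativeOnUniv := {
    add := fun hy hz _ ↦ pullbackCov_add cov₂ φ hy hz
    leibniz := by
      intro y g x hy hg _
      have h (a : Fin n) : pullbackCoeff φ (g • y) x a = g • pullbackCoeff φ y x a := by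
        funext x'
        simp only [pullbackCoeff, Pi.smul_apply', map_smul]
        rfl
      -- Expanding `y x` in the frame at `x` puts the term `dg(v) y` of the Leibniz rule in the same
      -- form as the sum defining `pullbackCov`, to be compared coefficient by coefficient.
      have hs := eq_sum_pullbackCoeff φ y (x := x) (x' := x)
        (FiberBundle.mem_baseSet_trivializationAt' (φ x))
      ext v
      simp only [pullbackCov, h, mvfderiv_smul hg (mdifferentiableAt_pullbackCoeff φ hy _)]
      rw [_root_.add_apply, ContinuousLinearMap.smulRight_apply]
      conv_rhs => rw [hs]
      rw [_root_.smul_apply, FunLike.coe_sum, Finset.sum_apply, FunLike.coe_sum, Finset.sum_apply,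
        Finset.smul_sum, Finset.smul_sum, ← Finset.sum_add_distrib]
      refine Finset.sum_congr rfl fun a _ ↦ ?_
      simp only [_root_.add_apply, ContinuousLinearMap.smulRight_apply, _root_.smul_apply,
        Pi.smul_apply', smul_eq_mul]
      have : pullbackFrame φ x a = toPullback φ x (targetFrame (φ x) a (φ x)) := rfl
      rw [this]
      module }

/-- The chain rule that characterizes a pullback connection. The coefficients of `s ∘ φ` are those
of `s` composed with `φ`. Its role is to remove the frame from `pullbackCov`, whose definition uses
a different frame at each base point. -/
theorem pullbackCov_comp
    (cov₂ : CovariantDerivative (𝓡 n) (EuclideanSpace ℝ (Fin n))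
      (fun q : M₂ ↦ TangentSpace (𝓡 n) q))
    (φ : C^∞⟮𝓡 2, M₁; 𝓡 n, M₂⟯) {s : Π q : M₂, TangentSpace (𝓡 n) q} {x : M₁}
    (hs : MDifferentiableAt (𝓡 n) ((𝓡 n).prod 𝓘(ℝ, EuclideanSpace ℝ (Fin n)))
      (fun q ↦ TotalSpace.mk' (EuclideanSpace ℝ (Fin n)) q (s q)) (φ x)) :
    pullbackCov cov₂ φ (fun x' ↦ toPullback φ x' (s (φ x'))) x =
      (toPullback φ x).comp ((cov₂ s (φ x)).comp (mfderiv (𝓡 2) (𝓡 n) φ x)) := by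
  have hbase := FiberBundle.mem_baseSet_trivializationAt' (F := EuclideanSpace ℝ (Fin n))
    (E := fun q : M₂ ↦ TangentSpace (𝓡 n) q) (φ x)
  set c : Fin n → M₂ → ℝ := fun a q ↦ (trivializationAt (EuclideanSpace ℝ (Fin n))
    (fun q : M₂ ↦ TangentSpace (𝓡 n) q) (φ x) ⟨q, s q⟩).2 a
  have hc (a : Fin n) : MDifferentiableAt (𝓡 n) 𝓘(ℝ) (c a) (φ x) :=
    mdifferentiableAt_trivialization_coeff hs a
  have h1 : cov₂ s (φ x) = ∑ a, (c a (φ x) • cov₂ (targetFrame (φ x) a) (φ x) +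
      (mvfderiv (𝓡 n) (c a) (φ x)).smulRight (targetFrame (φ x) a (φ x))) := by
    rw [← covariantDerivative_sum_smul cov₂ Finset.univ (fun a _ ↦ hc a)
      (fun a _ ↦ mdifferentiableAt_targetFrame (φ x) a hbase)]
    refine covariantDerivative_congr cov₂ hs ?_
    filter_upwards [(trivializationAt (EuclideanSpace ℝ (Fin n))
      (fun q : M₂ ↦ TangentSpace (𝓡 n) q) (φ x)).open_baseSet.mem_nhds hbase] with q hq
    exact eq_sum_trivialization (V := fun q : M₂ ↦ TangentSpace (𝓡 n) q) (φ x) hq (s q)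
  have h2 (a : Fin n) : pullbackCoeff φ (fun x' ↦ toPullback φ x' (s (φ x'))) x a
      =ᶠ[nhds x] c a ∘ φ :=
    (eventually_mem_baseSet_comp φ x).mono fun x' hx' ↦ pullbackCoeff_eq φ _ hx' a
  rw [h1]
  unfold pullbackCov
  ext v
  rw [ContinuousLinearMap.comp_apply, ContinuousLinearMap.comp_apply, FunLike.coe_sum,
    Finset.sum_apply, FunLike.coe_sum, Finset.sum_apply, map_sum]
  refine Finset.sum_congr rfl fun a _ ↦ ?_
  rw [mvfderiv_congr (h2 a), (h2 a).eq_of_nhds,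
    mvfderiv_comp x (hc a) (φ.mdifferentiableAt)]
  simp only [_root_.add_apply, ContinuousLinearMap.smulRight_apply, _root_.smul_apply,
    ContinuousLinearMap.comp_apply, map_add, map_smul]
  rw [add_comm]
  rfl

/-- `twistedCov` is defined on the trivialization frame at `x` only. If `b = ∑ cₐ sₐ`, then both
`∇ᵥ(ψ(b))` and `ψ(∇ᵥ b)` contain the terms `dcₐ(v) ψ(sₐ)`; these cancel in the difference, so the
product rule holds for every differentiable `b`, in particular for orthonormal frames. -/
theorem twistedCov_apply
    (covS : CovariantDerivative (𝓡 2) (EuclideanSpace ℝ (Fin 2)) S)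
    (cov₂ : CovariantDerivative (𝓡 n) (EuclideanSpace ℝ (Fin n))
      (fun q : M₂ ↦ TangentSpace (𝓡 n) q))
    (φ : C^∞⟮𝓡 2, M₁; 𝓡 n, M₂⟯) (ψ : TwistedSection S φ) {b : Π x, S x} {x : M₁}
    (hb : MDifferentiableAt (𝓡 2) ((𝓡 2).prod 𝓘(ℝ, EuclideanSpace ℝ (Fin 2)))
      (fun y ↦ TotalSpace.mk' (EuclideanSpace ℝ (Fin 2)) y (b y)) x)
    (v : TangentSpace (𝓡 2) x) :
    twistedCov covS cov₂ φ ψ x v (b x) =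
      pullbackCov cov₂ φ (fun x' ↦ ψ x' (b x')) x v - ψ x (covS b x v) := by
  have hbase := FiberBundle.mem_baseSet_trivializationAt' (F := EuclideanSpace ℝ (Fin 2))
    (E := S) x
  set c : Fin 2 → M₁ → ℝ := fun a y ↦ (trivializationAt (EuclideanSpace ℝ (Fin 2)) S x ⟨y, b y⟩).2 a
  have hc (a : Fin 2) : MDifferentiableAt (𝓡 2) 𝓘(ℝ) (c a) x :=
    mdifferentiableAt_trivialization_coeff hb a
  have hframe (a : Fin 2) : MDifferentiableAt (𝓡 2) ((𝓡 2).prod 𝓘(ℝ, EuclideanSpace ℝ (Fin 2)))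
      (fun y ↦ TotalSpace.mk' (EuclideanSpace ℝ (Fin 2)) y (spinorFrame S x a y)) x :=
    (contMDiffAt_symm_const (I := 𝓡 2) (V := S) x
    (EuclideanSpace.single a 1) hbase).mdifferentiableAt (n := ∞) (by norm_num)
  have hsum : ∀ᶠ y in nhds x, b y = ∑ a, c a y • spinorFrame S x a y := by
    filter_upwards [(trivializationAt (EuclideanSpace ℝ (Fin 2)) S x).open_baseSet.mem_nhds hbase]
      with y hy using eq_sum_trivialization x hy (b y)
  have h1 : covS b x = ∑ a, (c a x • covS (spinorFrame S x a) x +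
      (mvfderiv (𝓡 2) (c a) x).smulRight (spinorFrame S x a x)) := by
    rw [← covariantDerivative_sum_smul covS Finset.univ (fun a _ ↦ hc a) (fun a _ ↦ hframe a)]
    exact covariantDerivative_congr covS hb hsum
  have hψb : MDifferentiableAt (𝓡 2) ((𝓡 2).prod 𝓘(ℝ, EuclideanSpace ℝ (Fin n)))
      (fun x' ↦ TotalSpace.mk' (EuclideanSpace ℝ (Fin n))
        (E := (φ : M₁ → M₂) *ᵖ (fun q : M₂ ↦ TangentSpace (𝓡 n) q)) x' (ψ x' (b x'))) x :=
    MDifferentiableAt.clm_bundle_apply (F₁ := EuclideanSpace ℝ (Fin 2)) (E₁ := S)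
      ψ.mdifferentiableAt hb
  have h2 : pullbackCov cov₂ φ (fun x' ↦ ψ x' (b x')) x =
      ∑ a, (c a x • pullbackCov cov₂ φ (fun x' ↦ ψ x' (spinorFrame S x a x')) x +
      (mvfderiv (𝓡 2) (c a) x).smulRight (ψ x (spinorFrame S x a x))) := by
    have h3 := covariantDerivative_sum_smul (pullbackConnection cov₂ φ) Finset.univ
      (fun a _ ↦ hc a) (fun a _ ↦ mdifferentiableAt_apply_spinorFrame φ ψ x a)
    refine Eq.trans ?_ h3
    refine covariantDerivative_congr (pullbackConnection cov₂ φ) hψb ?_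
    filter_upwards [hsum] with y hy
    rw [hy, map_sum]
    simp only [map_smul]
  have hco (k : Fin 2) : spinorCoframe S x k (b x) = c k x := by
    simp only [spinorCoframe, ContinuousLinearMap.comp_apply, c]
    rw [Trivialization.continuousLinearMapAt_apply, Trivialization.linearMapAt_apply,
      if_pos hbase]
    rfl
  rw [h1, h2, twistedCov]
  simp only [FunLike.coe_sum, Finset.sum_apply, ContinuousLinearMap.smulRight_apply, hco,
    _root_.add_apply, _root_.smul_apply, map_sum, map_add, map_smul]
  rw [← Finset.sum_sub_distrib]
  refine Finset.sum_congr rfl fun k _ ↦ ?_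
  rw [smul_sub]
  abel

end PullbackConnection

/-! ### Metric connections, tangent vector by tangent vector -/

section MetricConnection

variable {EB : Type*} [NormedAddCommGroup EB] [NormedSpace ℝ EB]
  {HB : Type*} [TopologicalSpace HB] {I : ModelWithCorners ℝ EB HB}
  {M : Type*} [TopologicalSpace M] [ChartedSpace HB M] [IsManifold I 1 M]
  {F : Type*} [NormedAddCommGroup F] [NormedSpace ℝ F] [FiniteDimensional ℝ F]
  {V : M → Type*} [TopologicalSpace (TotalSpace F V)]
  [∀ x, NormedAddCommGroup (V x)] [∀ x, InnerProductSpace ℝ (V x)]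
  [FiberBundle F V] [VectorBundle ℝ F V] [ContMDiffVectorBundle 1 F V I]
  [IsContMDiffRiemannianBundle I 1 F V]

/-- Metric compatibility is stated for vector fields; a single tangent vector is extended to one. -/
theorem mvfderiv_inner_apply {cov : CovariantDerivative I F V} (hcov : cov.IsMetricCompatible)
    {s t : Π x, V x} {x : M}
    (hs : MDifferentiableAt I (I.prod 𝓘(ℝ, F)) (fun y ↦ TotalSpace.mk' F y (s y)) x)
    (ht : MDifferentiableAt I (I.prod 𝓘(ℝ, F)) (fun y ↦ TotalSpace.mk' F y (t y)) x)
    (v : TangentSpace I x) :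
    mvfderiv I (fun y ↦ inner ℝ (s y) (t y)) x v =
      inner ℝ (cov s x v) (t x) + inner ℝ (s x) (cov t x v) := by
  have h := hcov.mvfderiv_inner_eq (FiberBundle.extend EB v) hs ht
  simpa only [FiberBundle.extend_apply_self] using h

end MetricConnection

/-! ### Smooth connections on locally defined sections -/

section SmoothConnection

variable {EB : Type*} [NormedAddCommGroup EB] [NormedSpace ℝ EB] [FiniteDimensional ℝ EB]
  {HB : Type*} [TopologicalSpace HB] {I : ModelWithCorners ℝ EB HB}
  {M : Type*} [TopologicalSpace M] [T2Space M] [ChartedSpace HB M] [IsManifold I ∞ M]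
  {F : Type*} [NormedAddCommGroup F] [NormedSpace ℝ F]
  {V : M → Type*} [TopologicalSpace (TotalSpace F V)]
  [∀ x, AddCommGroup (V x)] [∀ x, Module ℝ (V x)] [∀ x : M, TopologicalSpace (V x)]
  [∀ x, IsTopologicalAddGroup (V x)] [∀ x, ContinuousSMul ℝ (V x)]
  [FiberBundle F V] [VectorBundle ℝ F V] [ContMDiffVectorBundle ∞ F V I]

/-- The smoothness hypothesis concerns globally smooth sections. A section smooth on `U` is
multiplied by a bump function supported in `U`, which changes neither it nor its covariant
derivative near `x`. -/
theorem contMDiffAt_covariantDerivative {cov : CovariantDerivative I F V}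
    (hcov : cov.ContMDiffCovariantDerivative ∞) {s : Π x, V x} {U : Set M} (hU : IsOpen U)
    (hs : ContMDiffOn I (I.prod 𝓘(ℝ, F)) ∞ (fun y ↦ TotalSpace.mk' F y (s y)) U) {x : M}
    (hx : x ∈ U) :
    ContMDiffAt I (I.prod 𝓘(ℝ, EB →L[ℝ] F)) ∞ (fun y ↦ TotalSpace.mk' (EB →L[ℝ] F)
      (E := fun y ↦ TangentSpace I y →L[ℝ] V y) y (cov s y)) x := by
  obtain ⟨ρ, -, hρ⟩ := (SmoothBumpFunction.nhds_basis_tsupport (I := I) x).mem_iff.1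
    (hU.mem_nhds hx)
  have h1 : ContMDiff I (I.prod 𝓘(ℝ, F)) ∞ (fun y ↦ TotalSpace.mk' F y (((ρ : M → ℝ) • s) y)) :=
    ContMDiffOn.smul_section_of_tsupport (ρ.contMDiff.contMDiffOn) hU hρ hs
  have h2 := hcov.contMDiff.contMDiff (σ := (ρ : M → ℝ) • s) h1.contMDiffOn
  refine ((h2 x trivial).contMDiffAt Filter.univ_mem).congr_of_eventuallyEq ?_
  -- The covariant derivative at `y` depends on the germ at `y`, so `ρ = 1` is needed on a
  -- neighbourhood of each nearby `y`, not just at `y`.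
  filter_upwards [ρ.eventuallyEq_one.eventually_nhds, hU.mem_nhds hx] with y hy hyU
  congr 1
  refine covariantDerivative_congr cov
    ((hs.contMDiffAt (hU.mem_nhds hyU)).mdifferentiableAt (by simp)) ?_
  filter_upwards [hy] with z hz
  simp [hz]

end SmoothConnection

/-! ### Smoothness of directional derivatives -/

section SmoothDerivative

variable {EB : Type*} [NormedAddCommGroup EB] [NormedSpace ℝ EB]
  {HB : Type*} [TopologicalSpace HB] {I : ModelWithCorners ℝ EB HB}
  {M : Type*} [TopologicalSpace M] [ChartedSpace HB M] [IsManifold I ∞ M]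

theorem contMDiffOn_mvfderiv_apply {f : M → ℝ} {w : Π x : M, TangentSpace I x} {U : Set M}
    (hU : IsOpen U) (hf : ContMDiffOn I 𝓘(ℝ) ∞ f U)
    (hw : ContMDiffOn I (I.prod 𝓘(ℝ, EB)) ∞
      (fun y ↦ TotalSpace.mk' EB (E := fun y : M ↦ TangentSpace I y) y (w y)) U) :
    ContMDiffOn I 𝓘(ℝ) ∞ (fun y ↦ mvfderiv I f y (w y)) U := by
  have h1 := hf.contMDiffOn_tangentMapWithin (m := ∞) (by simp) hU.uniqueMDiffOn
  have h2 : ContMDiffOn I 𝓘(ℝ).tangent ∞ (fun y ↦ tangentMapWithin I 𝓘(ℝ) f U ⟨y, w y⟩) U :=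
    h1.comp hw fun y hy ↦ hy
  refine ((contMDiff_snd_tangentBundle_modelSpace ℝ 𝓘(ℝ)).comp_contMDiffOn h2).congr
    fun y hy ↦ ?_
  simp only [Function.comp, tangentMapWithin, mfderivWithin_of_isOpen hU hy]
  rfl

end SmoothDerivative

/-! ### The pullback connection is metric -/

section PullbackMetric

variable {M₁ : Type*} [TopologicalSpace M₁] [ChartedSpace (EuclideanSpace ℝ (Fin 2)) M₁]
  [IsManifold (𝓡 2) ∞ M₁]
  [RiemannianBundle (fun x : M₁ ↦ TangentSpace (𝓡 2) x)]
  [IsContMDiffRiemannianBundle (𝓡 2) ∞ (EuclideanSpace ℝ (Fin 2))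
    (fun x : M₁ ↦ TangentSpace (𝓡 2) x)]
  {S : M₁ → Type*} [TopologicalSpace (TotalSpace (EuclideanSpace ℝ (Fin 2)) S)]
  [∀ x, NormedAddCommGroup (S x)] [∀ x, InnerProductSpace ℝ (S x)]
  [FiberBundle (EuclideanSpace ℝ (Fin 2)) S] [VectorBundle ℝ (EuclideanSpace ℝ (Fin 2)) S]
  [ContMDiffVectorBundle ∞ (EuclideanSpace ℝ (Fin 2)) S (𝓡 2)]
  [IsContMDiffRiemannianBundle (𝓡 2) ∞ (EuclideanSpace ℝ (Fin 2)) S]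
  {ω₁ : AreaForm (𝓡 2) (EuclideanSpace ℝ (Fin 2)) (fun x : M₁ ↦ TangentSpace (𝓡 2) x)}
  {n : ℕ} {M₂ : Type*} [TopologicalSpace M₂] [ChartedSpace (EuclideanSpace ℝ (Fin n)) M₂]
  [IsManifold (𝓡 n) ∞ M₂]
  [RiemannianBundle (fun q : M₂ ↦ TangentSpace (𝓡 n) q)]
  [IsContMDiffRiemannianBundle (𝓡 n) ∞ (EuclideanSpace ℝ (Fin n))
    (fun q : M₂ ↦ TangentSpace (𝓡 n) q)]

theorem contMDiffAt_pullbackInner (φ : C^∞⟮𝓡 2, M₁; 𝓡 n, M₂⟯)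
    {y z : Π x, ((φ : M₁ → M₂) *ᵖ (fun q : M₂ ↦ TangentSpace (𝓡 n) q)) x} {x : M₁}
    (hy : ContMDiffAt (𝓡 2) ((𝓡 2).prod 𝓘(ℝ, EuclideanSpace ℝ (Fin n))) ∞
      (fun x' ↦ TotalSpace.mk' (EuclideanSpace ℝ (Fin n)) x' (y x')) x)
    (hz : ContMDiffAt (𝓡 2) ((𝓡 2).prod 𝓘(ℝ, EuclideanSpace ℝ (Fin n))) ∞
      (fun x' ↦ TotalSpace.mk' (EuclideanSpace ℝ (Fin n)) x' (z x')) x) :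
    ContMDiffAt (𝓡 2) 𝓘(ℝ) ∞ (fun x' ↦ pullbackInner φ x' (y x') (z x')) x :=
  ContMDiffAt.inner_bundle (IB := 𝓡 n) (F := EuclideanSpace ℝ (Fin n))
    (E := fun q : M₂ ↦ TangentSpace (𝓡 n) q) (b := φ)
    ((contMDiffAt_pullback_iff φ).1 hy) ((contMDiffAt_pullback_iff φ).1 hz)

/-- The frame of `φ*TM₂` around `x` which is the pullback of `targetFrame (φ x)`. -/
def frameAlong (φ : C^∞⟮𝓡 2, M₁; 𝓡 n, M₂⟯) (x : M₁) (a : Fin n) (x' : M₁) :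
    ((φ : M₁ → M₂) *ᵖ (fun q : M₂ ↦ TangentSpace (𝓡 n) q)) x' :=
  toPullback φ x' (targetFrame (φ x) a (φ x'))

theorem contMDiffAt_targetFrame (q₀ : M₂) (a : Fin n) {q : M₂}
    (hq : q ∈ (trivializationAt (EuclideanSpace ℝ (Fin n))
      (fun q : M₂ ↦ TangentSpace (𝓡 n) q) q₀).baseSet) :
    ContMDiffAt (𝓡 n) ((𝓡 n).prod 𝓘(ℝ, EuclideanSpace ℝ (Fin n))) ∞
      (fun q ↦ TotalSpace.mk' (EuclideanSpace ℝ (Fin n))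
        (E := fun q : M₂ ↦ TangentSpace (𝓡 n) q) q (targetFrame q₀ a q)) q :=
  contMDiffAt_symm_const (I := 𝓡 n) (V := fun q : M₂ ↦ TangentSpace (𝓡 n) q) q₀ _ hq

theorem contMDiffAt_frameAlong (φ : C^∞⟮𝓡 2, M₁; 𝓡 n, M₂⟯) (x : M₁) (a : Fin n) {x' : M₁}
    (hx : φ x' ∈ (trivializationAt (EuclideanSpace ℝ (Fin n))
      (fun q : M₂ ↦ TangentSpace (𝓡 n) q) (φ x)).baseSet) :
    ContMDiffAt (𝓡 2) ((𝓡 2).prod 𝓘(ℝ, EuclideanSpace ℝ (Fin n))) ∞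
      (fun x' ↦ TotalSpace.mk' (EuclideanSpace ℝ (Fin n)) x' (frameAlong φ x a x')) x' :=
  (contMDiffAt_pullback_iff φ).2
    ((contMDiffAt_targetFrame (φ x) a hx).comp x' φ.contMDiff.contMDiffAt)

theorem pullbackCov_frameAlong
    (cov₂ : CovariantDerivative (𝓡 n) (EuclideanSpace ℝ (Fin n))
      (fun q : M₂ ↦ TangentSpace (𝓡 n) q))
    (φ : C^∞⟮𝓡 2, M₁; 𝓡 n, M₂⟯) (x : M₁) (a : Fin n) {x' : M₁}
    (hx : φ x' ∈ (trivializationAt (EuclideanSpace ℝ (Fin n))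
      (fun q : M₂ ↦ TangentSpace (𝓡 n) q) (φ x)).baseSet) (v : TangentSpace (𝓡 2) x') :
    pullbackCov cov₂ φ (frameAlong φ x a) x' v =
      toPullback φ x' (cov₂ (targetFrame (φ x) a) (φ x') (mfderiv (𝓡 2) (𝓡 n) φ x' v)) := by
  have h := pullbackCov_comp cov₂ φ (mdifferentiableAt_targetFrame (φ x) a hx)
  exact congrArg (fun f ↦ f v) h

/-- Expansion of a covariant derivative in the frame around a nearby point. -/
theorem pullbackCov_eq_sum
    (cov₂ : CovariantDerivative (𝓡 n) (EuclideanSpace ℝ (Fin n))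
      (fun q : M₂ ↦ TangentSpace (𝓡 n) q))
    (φ : C^∞⟮𝓡 2, M₁; 𝓡 n, M₂⟯)
    {y : Π x, ((φ : M₁ → M₂) *ᵖ (fun q : M₂ ↦ TangentSpace (𝓡 n) q)) x} {x x' : M₁}
    (hy : MDifferentiableAt (𝓡 2) ((𝓡 2).prod 𝓘(ℝ, EuclideanSpace ℝ (Fin n)))
      (fun x' ↦ TotalSpace.mk' (EuclideanSpace ℝ (Fin n)) x' (y x')) x')
    (hc : ∀ a, MDifferentiableAt (𝓡 2) 𝓘(ℝ) (pullbackCoeff φ y x a) x')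
    (hx : φ x' ∈ (trivializationAt (EuclideanSpace ℝ (Fin n))
      (fun q : M₂ ↦ TangentSpace (𝓡 n) q) (φ x)).baseSet) (v : TangentSpace (𝓡 2) x') :
    pullbackCov cov₂ φ y x' v =
      ∑ a, (pullbackCoeff φ y x a x' • pullbackCov cov₂ φ (frameAlong φ x a) x' v +
        mvfderiv (𝓡 2) (pullbackCoeff φ y x a) x' v • frameAlong φ x a x') := by
  have h1 := covariantDerivative_sum_smul (pullbackConnection cov₂ φ) Finset.univ (x := x')
    (c := pullbackCoeff φ y x) (e := frameAlong φ x) (fun a _ ↦ hc a)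
    (fun a _ ↦ (contMDiffAt_frameAlong φ x a hx).mdifferentiableAt (by simp))
  have h2 : pullbackConnection cov₂ φ y x' = pullbackConnection cov₂ φ
      (fun x' ↦ ∑ a, pullbackCoeff φ y x a x' • frameAlong φ x a x') x' := by
    refine covariantDerivative_congr _ hy ?_
    filter_upwards [φ.contMDiff.continuous.continuousAt.eventually_mem
      ((trivializationAt (EuclideanSpace ℝ (Fin n))
      (fun q : M₂ ↦ TangentSpace (𝓡 n) q) (φ x)).open_baseSet.mem_nhds hx)] with z hz
    exact eq_sum_pullbackCoeff φ y hz
  have h3 := congrArg (fun f ↦ f v) (h2.trans h1)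
  simp only [FunLike.coe_sum, Finset.sum_apply, _root_.add_apply, _root_.smul_apply,
    ContinuousLinearMap.smulRight_apply] at h3
  exact h3

/-- For the pulled back frame this is metric compatibility on `M₂` along `dφ(v)`, because the Gram
matrix of that frame is a function on `M₂` composed with `φ`. General `y`, `z` follow from the
Leibniz rule for their coefficients. -/
theorem mvfderiv_pullbackInner
    {cov₂ : CovariantDerivative (𝓡 n) (EuclideanSpace ℝ (Fin n))
      (fun q : M₂ ↦ TangentSpace (𝓡 n) q)} (hcov₂ : IsLeviCivita cov₂)
    (φ : C^∞⟮𝓡 2, M₁; 𝓡 n, M₂⟯)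
    {y z : Π x, ((φ : M₁ → M₂) *ᵖ (fun q : M₂ ↦ TangentSpace (𝓡 n) q)) x} {x : M₁}
    (hy : MDifferentiableAt (𝓡 2) ((𝓡 2).prod 𝓘(ℝ, EuclideanSpace ℝ (Fin n)))
      (fun x' ↦ TotalSpace.mk' (EuclideanSpace ℝ (Fin n)) x' (y x')) x)
    (hz : MDifferentiableAt (𝓡 2) ((𝓡 2).prod 𝓘(ℝ, EuclideanSpace ℝ (Fin n)))
      (fun x' ↦ TotalSpace.mk' (EuclideanSpace ℝ (Fin n)) x' (z x')) x)
    (v : TangentSpace (𝓡 2) x) :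
    mvfderiv (𝓡 2) (fun x' ↦ pullbackInner φ x' (y x') (z x')) x v =
      pullbackInner φ x (pullbackCov cov₂ φ y x v) (z x) +
        pullbackInner φ x (y x) (pullbackCov cov₂ φ z x v) := by
  have hbase := FiberBundle.mem_baseSet_trivializationAt' (F := EuclideanSpace ℝ (Fin n))
    (E := fun q : M₂ ↦ TangentSpace (𝓡 n) q) (φ x)
  have hcy (a : Fin n) := mdifferentiableAt_pullbackCoeff φ hy a
  have hcz (a : Fin n) := mdifferentiableAt_pullbackCoeff φ hz a
  set G : Fin n → Fin n → M₁ → ℝ := fun a b x' ↦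
    pullbackInner φ x' (frameAlong φ x a x') (frameAlong φ x b x')
  have hG (a b : Fin n) : MDifferentiableAt (𝓡 2) 𝓘(ℝ) (G a b) x :=
    (contMDiffAt_pullbackInner φ (contMDiffAt_frameAlong φ x a hbase)
      (contMDiffAt_frameAlong φ x b hbase)).mdifferentiableAt (by simp)
  have hdG (a b : Fin n) : mvfderiv (𝓡 2) (G a b) x v =
      pullbackInner φ x (pullbackCov cov₂ φ (frameAlong φ x a) x v) (frameAlong φ x b x) +
      pullbackInner φ x (frameAlong φ x a x) (pullbackCov cov₂ φ (frameAlong φ x b) x v) := by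
    have : IsContMDiffRiemannianBundle (𝓡 n) 1 (EuclideanSpace ℝ (Fin n))
      (fun q : M₂ ↦ TangentSpace (𝓡 n) q) := .of_le (n := ∞) (by norm_cast)
    have h1 := mvfderiv_inner_apply hcov₂.metric (mdifferentiableAt_targetFrame (φ x) a hbase)
      (mdifferentiableAt_targetFrame (φ x) b hbase) (mfderiv (𝓡 2) (𝓡 n) φ x v)
    have h2 : MDifferentiableAt (𝓡 n) 𝓘(ℝ) (fun q ↦ inner ℝ (targetFrame (φ x) a q)
        (targetFrame (φ x) b q)) (φ x) :=
      (mdifferentiableAt_targetFrame (φ x) a hbase).inner_bundle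
        (mdifferentiableAt_targetFrame (φ x) b hbase)
    rw [pullbackCov_frameAlong _ _ _ _ hbase, pullbackCov_frameAlong _ _ _ _ hbase]
    refine Eq.trans ?_ h1
    have h3 := congrArg (fun f ↦ f v) (mvfderiv_comp x h2 φ.mdifferentiableAt)
    exact h3
  have hB (x' : M₁) (f g : Fin n → ((φ : M₁ → M₂) *ᵖ (fun q : M₂ ↦ TangentSpace (𝓡 n) q)) x') :
      pullbackInner φ x' (∑ a, f a) (∑ b, g b) =
        ∑ p : Fin n × Fin n, pullbackInner φ x' (f p.1) (g p.2) := by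
    simp only [map_sum, LinearMap.sum_apply, Fintype.sum_prod_type]
    exact Finset.sum_comm
  -- The pairing is a finite sum of products of two coefficients and a Gram entry, each
  -- differentiable at `x`.
  have hsum : (fun x' ↦ pullbackInner φ x' (y x') (z x')) =ᶠ[nhds x]
      ∑ p : Fin n × Fin n, pullbackCoeff φ y x p.1 * (pullbackCoeff φ z x p.2 * G p.1 p.2) := by
    filter_upwards [eventually_mem_baseSet_comp φ x] with x' hx'
    rw [eq_sum_pullbackCoeff φ y hx', eq_sum_pullbackCoeff φ z hx', hB]
    simp only [map_smul, LinearMap.smul_apply, smul_eq_mul, Finset.sum_apply, Pi.mul_apply, G,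
      frameAlong]
    exact Finset.sum_congr rfl fun p _ ↦ by ring
  rw [mvfderiv_congr hsum, (mvfderiv_finset_sum Finset.univ fun p _ ↦
    (hcy p.1).mul ((hcz p.2).mul (hG p.1 p.2))).2, pullbackCov_eq_sum cov₂ φ hy hcy hbase,
    pullbackCov_eq_sum cov₂ φ hz hcz hbase, eq_sum_pullbackCoeff φ y hbase,
    eq_sum_pullbackCoeff φ z hbase, hB, hB, ← Finset.sum_add_distrib, FunLike.coe_sum,
    Finset.sum_apply]
  refine Finset.sum_congr rfl fun p _ ↦ ?_
  rw [mvfderiv_mul (hcy p.1) ((hcz p.2).mul (hG p.1 p.2)), mvfderiv_mul (hcz p.2) (hG p.1 p.2)]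
  simp only [_root_.add_apply, _root_.smul_apply, hdG, Pi.mul_apply, smul_eq_mul, map_add,
    map_smul, LinearMap.add_apply, LinearMap.smul_apply]
  simp only [G, frameAlong]
  ring

end PullbackMetric

/-! ### Local oriented orthonormal spin frames -/

section SpinFrame

variable {M₁ : Type*} [TopologicalSpace M₁] [ChartedSpace (EuclideanSpace ℝ (Fin 2)) M₁]
  [IsManifold (𝓡 2) ∞ M₁]
  [RiemannianBundle (fun x : M₁ ↦ TangentSpace (𝓡 2) x)]
  [IsContMDiffRiemannianBundle (𝓡 2) ∞ (EuclideanSpace ℝ (Fin 2))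
    (fun x : M₁ ↦ TangentSpace (𝓡 2) x)]
  {S : M₁ → Type*} [TopologicalSpace (TotalSpace (EuclideanSpace ℝ (Fin 2)) S)]
  [∀ x, NormedAddCommGroup (S x)] [∀ x, InnerProductSpace ℝ (S x)]
  [FiberBundle (EuclideanSpace ℝ (Fin 2)) S] [VectorBundle ℝ (EuclideanSpace ℝ (Fin 2)) S]
  [ContMDiffVectorBundle ∞ (EuclideanSpace ℝ (Fin 2)) S (𝓡 2)]
  [IsContMDiffRiemannianBundle (𝓡 2) ∞ (EuclideanSpace ℝ (Fin 2)) S]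
  {ω₁ : AreaForm (𝓡 2) (EuclideanSpace ℝ (Fin 2)) (fun x : M₁ ↦ TangentSpace (𝓡 2) x)}
  {n : ℕ} {M₂ : Type*} [TopologicalSpace M₂] [ChartedSpace (EuclideanSpace ℝ (Fin n)) M₂]
  [IsManifold (𝓡 n) ∞ M₂]

/-- A smooth frame of the spinor bundle on an open set which is oriented and orthonormal. -/
structure IsSpinFrameOn (σ : SpinStructure S ω₁) (b₁ b₂ : Π x, S x) (U : Set M₁) : Prop where
  isOpen : IsOpen U
  contMDiffOn_left : ContMDiffOn (𝓡 2) ((𝓡 2).prod 𝓘(ℝ, EuclideanSpace ℝ (Fin 2))) ∞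
    (fun y ↦ TotalSpace.mk' (EuclideanSpace ℝ (Fin 2)) y (b₁ y)) U
  contMDiffOn_right : ContMDiffOn (𝓡 2) ((𝓡 2).prod 𝓘(ℝ, EuclideanSpace ℝ (Fin 2))) ∞
    (fun y ↦ TotalSpace.mk' (EuclideanSpace ℝ (Fin 2)) y (b₂ y)) U
  isSpinPair : ∀ x ∈ U, IsSpinPair σ (b₁ x) (b₂ x)

theorem IsSpinFrameOn.mono {σ : SpinStructure S ω₁} {b₁ b₂ : Π x, S x} {U W : Set M₁}
    (h : IsSpinFrameOn σ b₁ b₂ U) (hW : IsOpen W) (hWU : W ⊆ U) : IsSpinFrameOn σ b₁ b₂ W :=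
  ⟨hW, h.contMDiffOn_left.mono hWU, h.contMDiffOn_right.mono hWU,
    fun x hx ↦ h.isSpinPair x (hWU hx)⟩

/-- Gram–Schmidt applied to the frame of a trivialization, with the sign of the second vector
corrected by the area form. -/
theorem exists_isSpinFrameOn (σ : SpinStructure S ω₁) (x₀ : M₁) :
    ∃ (U : Set M₁) (b₁ b₂ : Π x, S x), x₀ ∈ U ∧ IsSpinFrameOn σ b₁ b₂ U := by
  set e := trivializationAt (EuclideanSpace ℝ (Fin 2)) S x₀
  set s₀ : Π x, S x := spinorFrame S x₀ 0
  set s₁ : Π x, S x := spinorFrame S x₀ 1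
  have hs₀ : ContMDiffOn (𝓡 2) ((𝓡 2).prod 𝓘(ℝ, EuclideanSpace ℝ (Fin 2))) ∞
      (fun y ↦ TotalSpace.mk' (EuclideanSpace ℝ (Fin 2)) y (s₀ y)) e.baseSet :=
    fun x hx ↦ (contMDiffAt_symm_const (I := 𝓡 2) x₀ _ hx).contMDiffWithinAt
  have hs₁ : ContMDiffOn (𝓡 2) ((𝓡 2).prod 𝓘(ℝ, EuclideanSpace ℝ (Fin 2))) ∞
      (fun y ↦ TotalSpace.mk' (EuclideanSpace ℝ (Fin 2)) y (s₁ y)) e.baseSet :=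
    fun x hx ↦ (contMDiffAt_symm_const (I := 𝓡 2) x₀ _ hx).contMDiffWithinAt
  have happ (x : M₁) (hx : x ∈ e.baseSet) (k : Fin 2) :
      e.continuousLinearMapAt ℝ x (spinorFrame S x₀ k x) = EuclideanSpace.single k 1 := by
    have := e.continuousLinearMapAt_symmL (R := ℝ) hx (EuclideanSpace.single k 1)
    rwa [Trivialization.symmL_apply _ hx] at this
  have hne₀ (x : M₁) (hx : x ∈ e.baseSet) : s₀ x ≠ 0 := fun h ↦ by
    have h1 := happ x hx 0
    rw [show spinorFrame S x₀ 0 x = 0 from h, map_zero] at h1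
    simpa using congrArg (fun v : EuclideanSpace ℝ (Fin 2) ↦ v 0) h1
  -- Linear independence of the frame, in the form that keeps the second Gram–Schmidt vector from
  -- vanishing.
  have hne₁ (x : M₁) (hx : x ∈ e.baseSet) (c : ℝ) : s₁ x - c • s₀ x ≠ 0 := fun h ↦ by
    have h1 := congrArg (e.continuousLinearMapAt ℝ x) h
    rw [map_sub, map_smul, map_zero, happ x hx 0, happ x hx 1] at h1
    simpa using congrArg (fun v : EuclideanSpace ℝ (Fin 2) ↦ v 1) h1
  set f : M₁ → ℝ := fun x ↦ ‖s₀ x‖⁻¹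
  have hf : ContMDiffOn (𝓡 2) 𝓘(ℝ) ∞ f e.baseSet := by
    intro x hx
    have h1 := (hs₀ x hx).inner_bundle (hs₀ x hx)
    have h2 : inner ℝ (s₀ x) (s₀ x) ≠ 0 := by simpa using hne₀ x hx
    have h3 : ContDiffAt ℝ ∞ (fun t : ℝ ↦ (√t)⁻¹) (inner ℝ (s₀ x) (s₀ x)) :=
      (Real.contDiffAt_sqrt h2).inv (by simpa [Real.sqrt_eq_zero'] using hne₀ x hx)
    refine (h3.contMDiffAt.comp_contMDiffWithinAt x h1).congr_of_eventuallyEq ?_ ?_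
    · filter_upwards with y
      simp only [f, Function.comp, real_inner_self_eq_norm_sq, Real.sqrt_sq (norm_nonneg _)]
    · simp only [f, Function.comp, real_inner_self_eq_norm_sq, Real.sqrt_sq (norm_nonneg _)]
  set b₁ : Π x, S x := f • s₀
  have hb₁ : ContMDiffOn (𝓡 2) ((𝓡 2).prod 𝓘(ℝ, EuclideanSpace ℝ (Fin 2))) ∞
      (fun y ↦ TotalSpace.mk' (EuclideanSpace ℝ (Fin 2)) y (b₁ y)) e.baseSet := hf.smul_section hs₀
  set g : M₁ → ℝ := fun x ↦ inner ℝ (b₁ x) (s₁ x)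
  set w : Π x, S x := s₁ - g • b₁
  have hw : ContMDiffOn (𝓡 2) ((𝓡 2).prod 𝓘(ℝ, EuclideanSpace ℝ (Fin 2))) ∞
      (fun y ↦ TotalSpace.mk' (EuclideanSpace ℝ (Fin 2)) y (w y)) e.baseSet :=
    hs₁.sub_section ((hb₁.inner_bundle hs₁).smul_section hb₁)
  have hw0 (x : M₁) (hx : x ∈ e.baseSet) : w x ≠ 0 := by
    have := hne₁ x hx (g x * f x)
    rwa [mul_smul] at this
  have hn₁ (x : M₁) (hx : x ∈ e.baseSet) : ‖b₁ x‖ = 1 := by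
    have : ‖b₁ x‖ = ‖s₀ x‖⁻¹ * ‖s₀ x‖ := by
      simp only [b₁, f, Pi.smul_apply', norm_smul, norm_inv, norm_norm]
    rw [this, inv_mul_cancel₀ (norm_ne_zero_iff.2 (hne₀ x hx))]
  have hbw (x : M₁) (hx : x ∈ e.baseSet) : inner ℝ (b₁ x) (w x) = 0 := by
    simp only [w, Pi.sub_apply, Pi.smul_apply', inner_sub_right, real_inner_smul_right,
      real_inner_self_eq_norm_sq, hn₁ x hx, g]
    ring
  set A : M₁ → ℝ := fun x ↦ σ.area.toFun x (b₁ x) (w x)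
  have hA : ContMDiffOn (𝓡 2) 𝓘(ℝ) ∞ A e.baseSet := by
    intro x hx
    have h1 : ContMDiffWithinAt (𝓡 2) ((𝓡 2).prod 𝓘(ℝ)) ∞
        (fun y ↦ TotalSpace.mk' ℝ (E := Bundle.Trivial M₁ ℝ) y
          (σ.area.toFun y (b₁ y) (w y))) e.baseSet x :=
      ContMDiffWithinAt.clm_bundle_apply₂ (F₁ := EuclideanSpace ℝ (Fin 2))
        (F₂ := EuclideanSpace ℝ (Fin 2)) (b := fun y : M₁ ↦ y)
        (σ.area.contMDiff x).contMDiffWithinAt (hb₁ x hx) (hw x hx)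
    simp only [contMDiffWithinAt_totalSpace] at h1
    exact h1.2
  have hAsq (x : M₁) (hx : x ∈ e.baseSet) : A x ^ 2 = ‖w x‖ ^ 2 := by
    simp only [A]
    rw [σ.area.sq_eq, hn₁ x hx, hbw x hx]; ring
  set N : M₁ → ℝ := fun x ↦ inner ℝ (w x) (w x)
  have hN0 (x : M₁) (hx : x ∈ e.baseSet) : N x ≠ 0 := by simpa [N] using hw0 x hx
  have hN : ContMDiffOn (𝓡 2) 𝓘(ℝ) ∞ N e.baseSet := hw.inner_bundle hw
  -- Since `A² = |w|² = N`, the factor `A / N` is `±1 / |w|`: it normalizes `w` and picks the sign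
  -- for which `area(b₁, b₂) = A² / N = 1`, while staying smooth.
  set b₂ : Π x, S x := (fun x ↦ A x / N x) • w
  have hAN : ContMDiffOn (𝓡 2) 𝓘(ℝ) ∞ (fun x ↦ A x / N x) e.baseSet :=
    hA.div₀ hN hN0
  refine ⟨e.baseSet, b₁, b₂, FiberBundle.mem_baseSet_trivializationAt' x₀, e.open_baseSet, hb₁,
    hAN.smul_section hw, fun x hx ↦ ⟨hn₁ x hx, ?_, ?_, ?_⟩⟩
  · have h1 : ‖b₂ x‖ ^ 2 = 1 := by
      simp only [b₂, Pi.smul_apply', norm_smul, mul_pow, Real.norm_eq_abs, sq_abs, div_pow,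
        hAsq x hx]
      simp only [N, real_inner_self_eq_norm_sq]
      have := norm_ne_zero_iff.2 (hw0 x hx)
      field_simp
    exact (pow_eq_one_iff_of_nonneg (norm_nonneg _) two_ne_zero).1 h1
  · simp only [b₂, Pi.smul_apply', real_inner_smul_right, hbw x hx, mul_zero]
  · simp only [b₂, Pi.smul_apply', map_smul, smul_eq_mul]
    change A x / N x * A x = 1
    rw [div_mul_eq_mul_div, ← sq, hAsq x hx]
    simp only [N, real_inner_self_eq_norm_sq]
    exact div_self (pow_ne_zero 2 (norm_ne_zero_iff.2 (hw0 x hx)))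

end SpinFrame

/-! ### The connection form of a spin frame -/

section SpinConnectionForm

variable {M₁ : Type*} [TopologicalSpace M₁] [ChartedSpace (EuclideanSpace ℝ (Fin 2)) M₁]
  [IsManifold (𝓡 2) ∞ M₁]
  [RiemannianBundle (fun x : M₁ ↦ TangentSpace (𝓡 2) x)]
  [IsContMDiffRiemannianBundle (𝓡 2) ∞ (EuclideanSpace ℝ (Fin 2))
    (fun x : M₁ ↦ TangentSpace (𝓡 2) x)]
  {S : M₁ → Type*} [TopologicalSpace (TotalSpace (EuclideanSpace ℝ (Fin 2)) S)]
  [∀ x, NormedAddCommGroup (S x)] [∀ x, InnerProductSpace ℝ (S x)]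
  [FiberBundle (EuclideanSpace ℝ (Fin 2)) S] [VectorBundle ℝ (EuclideanSpace ℝ (Fin 2)) S]
  [ContMDiffVectorBundle ∞ (EuclideanSpace ℝ (Fin 2)) S (𝓡 2)]
  [IsContMDiffRiemannianBundle (𝓡 2) ∞ (EuclideanSpace ℝ (Fin 2)) S]
  {ω₁ : AreaForm (𝓡 2) (EuclideanSpace ℝ (Fin 2)) (fun x : M₁ ↦ TangentSpace (𝓡 2) x)}
  {n : ℕ} {M₂ : Type*} [TopologicalSpace M₂] [ChartedSpace (EuclideanSpace ℝ (Fin n)) M₂]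
  [IsManifold (𝓡 n) ∞ M₂]

theorem contMDiffOn_sq (σ : SpinStructure S ω₁) {s t : Π x, S x} {U : Set M₁}
    (hs : ContMDiffOn (𝓡 2) ((𝓡 2).prod 𝓘(ℝ, EuclideanSpace ℝ (Fin 2))) ∞
      (fun y ↦ TotalSpace.mk' (EuclideanSpace ℝ (Fin 2)) y (s y)) U)
    (ht : ContMDiffOn (𝓡 2) ((𝓡 2).prod 𝓘(ℝ, EuclideanSpace ℝ (Fin 2))) ∞
      (fun y ↦ TotalSpace.mk' (EuclideanSpace ℝ (Fin 2)) y (t y)) U) :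
    ContMDiffOn (𝓡 2) ((𝓡 2).prod 𝓘(ℝ, EuclideanSpace ℝ (Fin 2))) ∞
      (fun y ↦ TotalSpace.mk' (EuclideanSpace ℝ (Fin 2))
        (E := fun y : M₁ ↦ TangentSpace (𝓡 2) y) y (σ.sq y (s y) (t y))) U :=
  fun x hx ↦ ContMDiffWithinAt.clm_bundle_apply₂ (F₁ := EuclideanSpace ℝ (Fin 2))
    (F₂ := EuclideanSpace ℝ (Fin 2)) (b := fun y : M₁ ↦ y)
    (σ.contMDiff x).contMDiffWithinAt (hs x hx) (ht x hx)

namespace IsSpinFrameOn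

variable {σ : SpinStructure S ω₁} {b₁ b₂ : Π x, S x} {U : Set M₁}

theorem mdifferentiableAt_left (h : IsSpinFrameOn σ b₁ b₂ U) {x : M₁} (hx : x ∈ U) :
    MDifferentiableAt (𝓡 2) ((𝓡 2).prod 𝓘(ℝ, EuclideanSpace ℝ (Fin 2)))
      (fun y ↦ TotalSpace.mk' (EuclideanSpace ℝ (Fin 2)) y (b₁ y)) x :=
  (h.contMDiffOn_left.contMDiffAt (h.isOpen.mem_nhds hx)).mdifferentiableAt (by simp)

theorem mdifferentiableAt_right (h : IsSpinFrameOn σ b₁ b₂ U) {x : M₁} (hx : x ∈ U) :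
    MDifferentiableAt (𝓡 2) ((𝓡 2).prod 𝓘(ℝ, EuclideanSpace ℝ (Fin 2)))
      (fun y ↦ TotalSpace.mk' (EuclideanSpace ℝ (Fin 2)) y (b₂ y)) x :=
  (h.contMDiffOn_right.contMDiffAt (h.isOpen.mem_nhds hx)).mdifferentiableAt (by simp)

variable {cov₁ : CovariantDerivative (𝓡 2) (EuclideanSpace ℝ (Fin 2))
    (fun x : M₁ ↦ TangentSpace (𝓡 2) x)}
  {covS : CovariantDerivative (𝓡 2) (EuclideanSpace ℝ (Fin 2)) S}

/-- Differentiate the constants `⟨bᵢ, bⱼ⟩`: the connection matrix in an orthonormal frame is skew,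
hence given by the single form `⟨b₂, ∇b₁⟩`. -/
theorem inner_covariantDerivative (h : IsSpinFrameOn σ b₁ b₂ U)
    (hS : IsSpinConnection σ cov₁ covS) {x : M₁} (hx : x ∈ U) (v : TangentSpace (𝓡 2) x) :
    inner ℝ (b₁ x) (covS b₁ x v) = 0 ∧ inner ℝ (b₂ x) (covS b₂ x v) = 0 ∧
      inner ℝ (b₁ x) (covS b₂ x v) = -inner ℝ (b₂ x) (covS b₁ x v) := by
  have : IsContMDiffRiemannianBundle (𝓡 2) 1 (EuclideanSpace ℝ (Fin 2)) S :=
    .of_le (n := ∞) (by norm_cast)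
  have : ContMDiffVectorBundle 1 (EuclideanSpace ℝ (Fin 2)) S (𝓡 2) :=
    .of_le (n := ∞) (by norm_cast)
  have hconst {f : M₁ → ℝ} {c : ℝ} (hf : ∀ y ∈ U, f y = c) : mvfderiv (𝓡 2) f x v = 0 := by
    have hf' : f =ᶠ[nhds x] fun _ ↦ c := by
      filter_upwards [h.isOpen.mem_nhds hx] with y hy using hf y hy
    rw [mvfderiv_congr hf', mvfderiv_const]
    rfl
  have h1 := h.mdifferentiableAt_left hx
  have h2 := h.mdifferentiableAt_right hx
  have h11 := mvfderiv_inner_apply hS.metric h1 h1 v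
  have h22 := mvfderiv_inner_apply hS.metric h2 h2 v
  have h12 := mvfderiv_inner_apply hS.metric h1 h2 v
  rw [hconst (c := 1) fun y hy ↦ by
    rw [real_inner_self_eq_norm_sq, (h.isSpinPair y hy).norm_left, one_pow]] at h11
  rw [hconst (c := 1) fun y hy ↦ by
    rw [real_inner_self_eq_norm_sq, (h.isSpinPair y hy).norm_right, one_pow]] at h22
  rw [hconst (c := 0) fun y hy ↦ (h.isSpinPair y hy).inner_eq] at h12
  rw [real_inner_comm] at h11 h22 h12
  exact ⟨by linarith, by linarith, by linarith⟩

theorem covariantDerivative_left (h : IsSpinFrameOn σ b₁ b₂ U)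
    (hS : IsSpinConnection σ cov₁ covS) {x : M₁} (hx : x ∈ U) (v : TangentSpace (𝓡 2) x) :
    covS b₁ x v = (inner ℝ (b₂ x) (covS b₁ x v) : ℝ) • b₂ x := by
  obtain ⟨h1, -, -⟩ := h.inner_covariantDerivative hS hx v
  conv_lhs => rw [(h.isSpinPair x hx).eq_add (covS b₁ x v), h1, zero_smul, zero_add]

theorem covariantDerivative_right (h : IsSpinFrameOn σ b₁ b₂ U)
    (hS : IsSpinConnection σ cov₁ covS) {x : M₁} (hx : x ∈ U) (v : TangentSpace (𝓡 2) x) :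
    covS b₂ x v = -(inner ℝ (b₂ x) (covS b₁ x v) : ℝ) • b₁ x := by
  obtain ⟨-, h1, h2⟩ := h.inner_covariantDerivative hS hx v
  conv_lhs => rw [(h.isSpinPair x hx).eq_add (covS b₂ x v), h1, zero_smul, add_zero, h2]

/-- Hides `⟨b₂, ∇b₁⟩` behind an opaque `θ`, so that rewriting `∇b₁` by `θ b₂` does not reintroduce
`∇b₁` and the algebra sees an atom. -/
theorem exists_connectionForm (h : IsSpinFrameOn σ b₁ b₂ U)
    (hS : IsSpinConnection σ cov₁ covS) {x : M₁} (hx : x ∈ U) :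
    ∃ θ : TangentSpace (𝓡 2) x → ℝ, (∀ v, inner ℝ (b₂ x) (covS b₁ x v) = θ v) ∧
      (∀ v, covS b₁ x v = θ v • b₂ x) ∧ ∀ v, covS b₂ x v = -θ v • b₁ x :=
  ⟨_, fun _ ↦ rfl, h.covariantDerivative_left hS hx, h.covariantDerivative_right hS hx⟩

/-- Put `e₁ = b₁·b₁` and `e₂ = b₁·b₂`. The lift property and `b₂·b₂ = -b₁·b₁` give `∇e₁ = 2θ e₂` and
`∇e₂ = -2θ e₁`; without torsion, `[e₁, e₂] = ∇_{e₁} e₂ - ∇_{e₂} e₁`. The factor `2` reflects `TM₁ ≃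
W ⊗ W`. -/
theorem mlieBracket_sq (h : IsSpinFrameOn σ b₁ b₂ U) (h₁ : IsLeviCivita cov₁)
    (hS : IsSpinConnection σ cov₁ covS) {x : M₁} (hx : x ∈ U) :
    VectorField.mlieBracket (𝓡 2) (fun y ↦ σ.sq y (b₁ y) (b₁ y)) (fun y ↦ σ.sq y (b₁ y) (b₂ y)) x =
      (-2 * inner ℝ (b₂ x) (covS b₁ x (σ.sq x (b₁ x) (b₁ x)))) • σ.sq x (b₁ x) (b₁ x) +
      (-2 * inner ℝ (b₂ x) (covS b₁ x (σ.sq x (b₁ x) (b₂ x)))) • σ.sq x (b₁ x) (b₂ x) := by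
  have h1 := h.mdifferentiableAt_left hx
  have h2 := h.mdifferentiableAt_right hx
  have hd1 := ((contMDiffOn_sq σ h.contMDiffOn_left h.contMDiffOn_left).contMDiffAt
    (h.isOpen.mem_nhds hx)).mdifferentiableAt (by simp)
  have hd2 := ((contMDiffOn_sq σ h.contMDiffOn_left h.contMDiffOn_right).contMDiffAt
    (h.isOpen.mem_nhds hx)).mdifferentiableAt (by simp)
  rw [← (CovariantDerivative.torsion_eq_zero_iff cov₁).1 h₁.torsion_eq_zero hd1 hd2,
    hS.lift _ _ x h1 h2, hS.lift _ _ x h1 h1]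
  obtain ⟨θ, hθ, hl, hr⟩ := h.exists_connectionForm hS hx
  rw [hθ, hθ, hl, hl, hr]
  simp only [map_smul, _root_.smul_apply, (h.isSpinPair x hx).sq_right_right,
    σ.symm x (b₂ x) (b₁ x)]
  module

end IsSpinFrameOn

end SpinConnectionForm

/-! ### The symmetry defect as a divergence -/

section DiracDefect

variable {M₁ : Type*} [TopologicalSpace M₁] [ChartedSpace (EuclideanSpace ℝ (Fin 2)) M₁]
  [IsManifold (𝓡 2) ∞ M₁]
  [RiemannianBundle (fun x : M₁ ↦ TangentSpace (𝓡 2) x)]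
  [IsContMDiffRiemannianBundle (𝓡 2) ∞ (EuclideanSpace ℝ (Fin 2))
    (fun x : M₁ ↦ TangentSpace (𝓡 2) x)]
  {S : M₁ → Type*} [TopologicalSpace (TotalSpace (EuclideanSpace ℝ (Fin 2)) S)]
  [∀ x, NormedAddCommGroup (S x)] [∀ x, InnerProductSpace ℝ (S x)]
  [FiberBundle (EuclideanSpace ℝ (Fin 2)) S] [VectorBundle ℝ (EuclideanSpace ℝ (Fin 2)) S]
  [ContMDiffVectorBundle ∞ (EuclideanSpace ℝ (Fin 2)) S (𝓡 2)]
  [IsContMDiffRiemannianBundle (𝓡 2) ∞ (EuclideanSpace ℝ (Fin 2)) S]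
  {ω₁ : AreaForm (𝓡 2) (EuclideanSpace ℝ (Fin 2)) (fun x : M₁ ↦ TangentSpace (𝓡 2) x)}
  {n : ℕ} {M₂ : Type*} [TopologicalSpace M₂] [ChartedSpace (EuclideanSpace ℝ (Fin n)) M₂]
  [IsManifold (𝓡 n) ∞ M₂]
  [RiemannianBundle (fun q : M₂ ↦ TangentSpace (𝓡 n) q)]
  [IsContMDiffRiemannianBundle (𝓡 n) ∞ (EuclideanSpace ℝ (Fin n))
    (fun q : M₂ ↦ TangentSpace (𝓡 n) q)]

theorem contMDiffAt_twistedSection_apply (φ : C^∞⟮𝓡 2, M₁; 𝓡 n, M₂⟯) (ψ : TwistedSection S φ)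
    {s : Π x, S x} {x : M₁}
    (hs : ContMDiffAt (𝓡 2) ((𝓡 2).prod 𝓘(ℝ, EuclideanSpace ℝ (Fin 2))) ∞
      (fun y ↦ TotalSpace.mk' (EuclideanSpace ℝ (Fin 2)) y (s y)) x) :
    ContMDiffAt (𝓡 2) ((𝓡 2).prod 𝓘(ℝ, EuclideanSpace ℝ (Fin n))) ∞
      (fun x' ↦ TotalSpace.mk' (EuclideanSpace ℝ (Fin n))
        (E := (φ : M₁ → M₂) *ᵖ (fun q : M₂ ↦ TangentSpace (𝓡 n) q)) x' (ψ x' (s x'))) x :=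
  ContMDiffAt.clm_bundle_apply (F₁ := EuclideanSpace ℝ (Fin 2)) (E₁ := S)
    (b := fun y : M₁ ↦ y) (ψ.contMDiff x) hs

variable {σ : SpinStructure S ω₁} {b₁ b₂ : Π x, S x} {U : Set M₁}
  {cov₁ : CovariantDerivative (𝓡 2) (EuclideanSpace ℝ (Fin 2))
    (fun x : M₁ ↦ TangentSpace (𝓡 2) x)}
  {covS : CovariantDerivative (𝓡 2) (EuclideanSpace ℝ (Fin 2)) S}
  {cov₂ : CovariantDerivative (𝓡 n) (EuclideanSpace ℝ (Fin n))
        (fun q : M₂ ↦ TangentSpace (𝓡 n) q)}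

/-- In an oriented orthonormal frame of the spinor bundle, the failure of the Dirac operator to be
symmetric at a point is the divergence of the vector field `-Q e₁ + P e₂`. -/
theorem twistedInner_dirac_sub (h : IsSpinFrameOn σ b₁ b₂ U)
    (hS : IsSpinConnection σ cov₁ covS) (h₂ : IsLeviCivita cov₂) (φ : C^∞⟮𝓡 2, M₁; 𝓡 n, M₂⟯)
    (ψ χ : TwistedSection S φ) {x : M₁} (hx : x ∈ U) :
    twistedInner σ φ x (ψ x) (dirac σ covS cov₂ φ χ x) -
        twistedInner σ φ x (dirac σ covS cov₂ φ ψ x) (χ x) =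
      -mvfderiv (𝓡 2) (fun y ↦ pullbackInner φ y (ψ y (b₁ y)) (χ y (b₂ y)) +
          pullbackInner φ y (ψ y (b₂ y)) (χ y (b₁ y))) x (σ.sq x (b₁ x) (b₁ x)) +
        mvfderiv (𝓡 2) (fun y ↦ pullbackInner φ y (ψ y (b₁ y)) (χ y (b₁ y)) -
          pullbackInner φ y (ψ y (b₂ y)) (χ y (b₂ y))) x (σ.sq x (b₁ x) (b₂ x)) +
        (-2 * inner ℝ (b₂ x) (covS b₁ x (σ.sq x (b₁ x) (b₁ x)))) *
          (pullbackInner φ x (ψ x (b₁ x)) (χ x (b₁ x)) -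
            pullbackInner φ x (ψ x (b₂ x)) (χ x (b₂ x))) +
        (-2 * inner ℝ (b₂ x) (covS b₁ x (σ.sq x (b₁ x) (b₂ x)))) *
          (pullbackInner φ x (ψ x (b₁ x)) (χ x (b₂ x)) +
            pullbackInner φ x (ψ x (b₂ x)) (χ x (b₁ x))) := by
  have hU := h.isOpen.mem_nhds hx
  have hb1 := h.mdifferentiableAt_left hx
  have hb2 := h.mdifferentiableAt_right hx
  have c1 := contMDiffAt_twistedSection_apply φ ψ (h.contMDiffOn_left.contMDiffAt hU)
  have c2 := contMDiffAt_twistedSection_apply φ ψ (h.contMDiffOn_right.contMDiffAt hU)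
  have d1 := contMDiffAt_twistedSection_apply φ χ (h.contMDiffOn_left.contMDiffAt hU)
  have d2 := contMDiffAt_twistedSection_apply φ χ (h.contMDiffOn_right.contMDiffAt hU)
  have c1' := c1.mdifferentiableAt (n := ∞) (by simp)
  have c2' := c2.mdifferentiableAt (n := ∞) (by simp)
  have d1' := d1.mdifferentiableAt (n := ∞) (by simp)
  have d2' := d2.mdifferentiableAt (n := ∞) (by simp)
  have s11 := (contMDiffAt_pullbackInner φ c1 d1).mdifferentiableAt (n := ∞) (by simp)
  have s12 := (contMDiffAt_pullbackInner φ c1 d2).mdifferentiableAt (n := ∞) (by simp)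
  have s21 := (contMDiffAt_pullbackInner φ c2 d1).mdifferentiableAt (n := ∞) (by simp)
  have s22 := (contMDiffAt_pullbackInner φ c2 d2).mdifferentiableAt (n := ∞) (by simp)
  have e1 := mvfderiv_add s12 s21
  have e2 := mvfderiv_sub s11 s22
  have e1' := congrArg (fun f ↦ f (σ.sq x (b₁ x) (b₁ x))) e1
  have e2' := congrArg (fun f ↦ f (σ.sq x (b₁ x) (b₂ x))) e2
  simp only [_root_.add_apply, _root_.sub_apply, mvfderiv_pullbackInner h₂ φ c1' d2',
    mvfderiv_pullbackInner h₂ φ c2' d1', mvfderiv_pullbackInner h₂ φ c1' d1',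
    mvfderiv_pullbackInner h₂ φ c2' d2'] at e1' e2'
  have hp := h.isSpinPair x hx
  rw [twistedInner_eq σ φ hp, twistedInner_eq σ φ hp, dirac_apply_left σ covS cov₂ φ χ hp,
    dirac_apply_right σ covS cov₂ φ χ hp, dirac_apply_left σ covS cov₂ φ ψ hp,
    dirac_apply_right σ covS cov₂ φ ψ hp]
  obtain ⟨θ, hθ, hl, hr⟩ := h.exists_connectionForm hS hx
  simp only [hθ]
  -- Presents `Q` and `P` as a sum and a difference of functions, the form in which their
  -- derivatives were computed above.
  change _ = -mvfderiv (𝓡 2) ((fun y ↦ pullbackInner φ y (ψ y (b₁ y)) (χ y (b₂ y))) +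
    fun y ↦ pullbackInner φ y (ψ y (b₂ y)) (χ y (b₁ y))) x (σ.sq x (b₁ x) (b₁ x)) +
    mvfderiv (𝓡 2) ((fun y ↦ pullbackInner φ y (ψ y (b₁ y)) (χ y (b₁ y))) -
    fun y ↦ pullbackInner φ y (ψ y (b₂ y)) (χ y (b₂ y))) x (σ.sq x (b₁ x) (b₂ x)) + _ + _
  rw [e1', e2']
  -- By the product rule `(∇ᵥχ)(b₁) = ∇ᵥ(χ b₁) - θ(v) χ(b₂)` and `(∇ᵥχ)(b₂) = ∇ᵥ(χ b₂) + θ(v)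
  -- χ(b₁)`, and likewise for `ψ`; what remains is polynomial algebra.
  simp only [twistedCov_apply covS cov₂ φ _ hb1, twistedCov_apply covS cov₂ φ _ hb2,
    hl, hr, map_smul, map_add, map_sub, map_neg, LinearMap.add_apply, LinearMap.sub_apply,
    LinearMap.neg_apply, LinearMap.smul_apply, smul_eq_mul]
  ring

end DiracDefect

/-! ### Continuity of the integrands -/

section Smoothness

variable {M₁ : Type*} [TopologicalSpace M₁] [ChartedSpace (EuclideanSpace ℝ (Fin 2)) M₁]
  [IsManifold (𝓡 2) ∞ M₁]
  [RiemannianBundle (fun x : M₁ ↦ TangentSpace (𝓡 2) x)]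
  [IsContMDiffRiemannianBundle (𝓡 2) ∞ (EuclideanSpace ℝ (Fin 2))
    (fun x : M₁ ↦ TangentSpace (𝓡 2) x)]
  {S : M₁ → Type*} [TopologicalSpace (TotalSpace (EuclideanSpace ℝ (Fin 2)) S)]
  [∀ x, NormedAddCommGroup (S x)] [∀ x, InnerProductSpace ℝ (S x)]
  [FiberBundle (EuclideanSpace ℝ (Fin 2)) S] [VectorBundle ℝ (EuclideanSpace ℝ (Fin 2)) S]
  [ContMDiffVectorBundle ∞ (EuclideanSpace ℝ (Fin 2)) S (𝓡 2)]
  [IsContMDiffRiemannianBundle (𝓡 2) ∞ (EuclideanSpace ℝ (Fin 2)) S]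
  {ω₁ : AreaForm (𝓡 2) (EuclideanSpace ℝ (Fin 2)) (fun x : M₁ ↦ TangentSpace (𝓡 2) x)}
  {n : ℕ} {M₂ : Type*} [TopologicalSpace M₂] [ChartedSpace (EuclideanSpace ℝ (Fin n)) M₂]
  [IsManifold (𝓡 n) ∞ M₂]
  [T2Space M₂] [RiemannianBundle (fun q : M₂ ↦ TangentSpace (𝓡 n) q)]
  [IsContMDiffRiemannianBundle (𝓡 n) ∞ (EuclideanSpace ℝ (Fin n))
    (fun q : M₂ ↦ TangentSpace (𝓡 n) q)]
  {cov₂ : CovariantDerivative (𝓡 n) (EuclideanSpace ℝ (Fin n))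
        (fun q : M₂ ↦ TangentSpace (𝓡 n) q)}

theorem contMDiffAt_pullbackCoeff (φ : C^∞⟮𝓡 2, M₁; 𝓡 n, M₂⟯)
    {y : Π x, ((φ : M₁ → M₂) *ᵖ (fun q : M₂ ↦ TangentSpace (𝓡 n) q)) x} {x x' : M₁}
    (hy : ContMDiffAt (𝓡 2) ((𝓡 2).prod 𝓘(ℝ, EuclideanSpace ℝ (Fin n))) ∞
      (fun x' ↦ TotalSpace.mk' (EuclideanSpace ℝ (Fin n)) x' (y x')) x')
    (hx : φ x' ∈ (trivializationAt (EuclideanSpace ℝ (Fin n))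
      (fun q : M₂ ↦ TangentSpace (𝓡 n) q) (φ x)).baseSet) (a : Fin n) :
    ContMDiffAt (𝓡 2) 𝓘(ℝ) ∞ (pullbackCoeff φ y x a) x' := by
  have hx' : x' ∈ (trivializationAt (EuclideanSpace ℝ (Fin n))
    ((φ : M₁ → M₂) *ᵖ (fun q : M₂ ↦ TangentSpace (𝓡 n) q)) x).baseSet := hx
  rw [(trivializationAt (EuclideanSpace ℝ (Fin n))
    ((φ : M₁ → M₂) *ᵖ (fun q : M₂ ↦ TangentSpace (𝓡 n) q)) x).contMDiffAt_section_iff hx'] at hy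
  have h2 := ((EuclideanSpace.proj a :
    EuclideanSpace ℝ (Fin n) →L[ℝ] ℝ).contMDiff (n := ∞)).contMDiffAt.comp x' hy
  refine h2.congr_of_eventuallyEq ?_
  filter_upwards [(trivializationAt (EuclideanSpace ℝ (Fin n))
    ((φ : M₁ → M₂) *ᵖ (fun q : M₂ ↦ TangentSpace (𝓡 n) q)) x).open_baseSet.mem_nhds hx']
    with z hz
  simp only [pullbackCoeff, Function.comp]
  rw [Trivialization.continuousLinearMapAt_apply, Trivialization.linearMapAt_apply, if_pos hz]
  rfl

/-- The definition of `pullbackCov` at `x'` uses the frame around `φ x'`, so it does not exhibit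
smoothness in `x'`. `pullbackCov_eq_sum` rewrites it near `x` in the one fixed frame around `φ x`,
where every ingredient is smooth. -/
theorem contMDiffAt_pullbackCov (h₂ : IsLeviCivita cov₂) (φ : C^∞⟮𝓡 2, M₁; 𝓡 n, M₂⟯)
    {y : Π x, ((φ : M₁ → M₂) *ᵖ (fun q : M₂ ↦ TangentSpace (𝓡 n) q)) x}
    {w : Π x : M₁, TangentSpace (𝓡 2) x} {U : Set M₁} (hU : IsOpen U)
    (hy : ContMDiffOn (𝓡 2) ((𝓡 2).prod 𝓘(ℝ, EuclideanSpace ℝ (Fin n))) ∞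
      (fun x' ↦ TotalSpace.mk' (EuclideanSpace ℝ (Fin n)) x' (y x')) U)
    (hw : ContMDiffOn (𝓡 2) ((𝓡 2).prod 𝓘(ℝ, EuclideanSpace ℝ (Fin 2))) ∞
      (fun y ↦ TotalSpace.mk' (EuclideanSpace ℝ (Fin 2))
        (E := fun y : M₁ ↦ TangentSpace (𝓡 2) y) y (w y)) U) {x : M₁} (hx : x ∈ U) :
    ContMDiffAt (𝓡 2) ((𝓡 2).prod 𝓘(ℝ, EuclideanSpace ℝ (Fin n))) ∞
      (fun x' ↦ TotalSpace.mk' (EuclideanSpace ℝ (Fin n))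
        (E := (φ : M₁ → M₂) *ᵖ (fun q : M₂ ↦ TangentSpace (𝓡 n) q)) x'
        (pullbackCov cov₂ φ y x' (w x'))) x := by
  set e := trivializationAt (EuclideanSpace ℝ (Fin n)) (fun q : M₂ ↦ TangentSpace (𝓡 n) q) (φ x)
  have hbase : φ x ∈ e.baseSet := FiberBundle.mem_baseSet_trivializationAt' (φ x)
  set W : Set M₁ := U ∩ φ ⁻¹' e.baseSet
  have hW : IsOpen W := hU.inter (e.open_baseSet.preimage φ.contMDiff.continuous)
  have hxW : x ∈ W := ⟨hx, hbase⟩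
  have hc (a : Fin n) : ContMDiffOn (𝓡 2) 𝓘(ℝ) ∞ (pullbackCoeff φ y x a) W := fun z hz ↦
    (contMDiffAt_pullbackCoeff φ (hy.contMDiffAt (hU.mem_nhds hz.1)) hz.2 a).contMDiffWithinAt
  have hdc (a : Fin n) := (contMDiffOn_mvfderiv_apply hW (hc a)
    (hw.mono Set.inter_subset_left)).contMDiffAt (hW.mem_nhds hxW)
  have hdφ : ContMDiffAt (𝓡 2) ((𝓡 n).prod 𝓘(ℝ, EuclideanSpace ℝ (Fin n))) ∞
      (fun z ↦ TotalSpace.mk' (EuclideanSpace ℝ (Fin n))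
        (E := fun q : M₂ ↦ TangentSpace (𝓡 n) q) (φ z) (mfderiv (𝓡 2) (𝓡 n) φ z (w z))) x :=
    ((φ.contMDiff.contMDiff_tangentMap (m := ∞) (by simp)).contMDiffAt).comp x
      (hw.contMDiffAt (hU.mem_nhds hx))
  have hE (a : Fin n) : ContMDiffAt (𝓡 2) ((𝓡 2).prod 𝓘(ℝ, EuclideanSpace ℝ (Fin n))) ∞
      (fun z ↦ TotalSpace.mk' (EuclideanSpace ℝ (Fin n)) z (toPullback φ z
        (cov₂ (targetFrame (φ x) a) (φ z) (mfderiv (𝓡 2) (𝓡 n) φ z (w z))))) x := by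
    refine (contMDiffAt_pullback_iff φ).2 ?_
    refine ContMDiffAt.clm_bundle_apply (IB := 𝓡 n) (F₁ := EuclideanSpace ℝ (Fin n))
      (E₁ := fun q : M₂ ↦ TangentSpace (𝓡 n) q) (b := φ)
      (ϕ := fun z ↦ cov₂ (targetFrame (φ x) a) (φ z)) ?_ hdφ
    exact (contMDiffAt_covariantDerivative h₂.smooth e.open_baseSet
      (fun q hq ↦ (contMDiffAt_targetFrame (φ x) a hq).contMDiffWithinAt) hbase).comp x
      φ.contMDiff.contMDiffAt
  have hsum : ContMDiffAt (𝓡 2) ((𝓡 2).prod 𝓘(ℝ, EuclideanSpace ℝ (Fin n))) ∞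
      (fun z ↦ TotalSpace.mk' (EuclideanSpace ℝ (Fin n))
        (E := (φ : M₁ → M₂) *ᵖ (fun q : M₂ ↦ TangentSpace (𝓡 n) q)) z
        (∑ a, (pullbackCoeff φ y x a z • toPullback φ z
          (cov₂ (targetFrame (φ x) a) (φ z) (mfderiv (𝓡 2) (𝓡 n) φ z (w z))) +
          mvfderiv (𝓡 2) (pullbackCoeff φ y x a) z (w z) • frameAlong φ x a z))) x :=
    .sum_section fun a _ ↦ (((hc a).contMDiffAt (hW.mem_nhds hxW)).smul_section (hE a)).add_section
      ((hdc a).smul_section (contMDiffAt_frameAlong φ x a hbase))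
  refine hsum.congr_of_eventuallyEq ?_
  filter_upwards [hW.mem_nhds hxW] with z hz
  rw [pullbackCov_eq_sum cov₂ φ ((hy.contMDiffAt (hU.mem_nhds hz.1)).mdifferentiableAt (by simp))
    (fun a ↦ ((hc a).contMDiffAt (hW.mem_nhds hz)).mdifferentiableAt (by simp)) hz.2]
  simp only [pullbackCov_frameAlong cov₂ φ x _ hz.2]

variable {σ : SpinStructure S ω₁} {b₁ b₂ : Π x, S x} {U : Set M₁}
  {cov₁ : CovariantDerivative (𝓡 2) (EuclideanSpace ℝ (Fin 2))
    (fun x : M₁ ↦ TangentSpace (𝓡 2) x)}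
  {covS : CovariantDerivative (𝓡 2) (EuclideanSpace ℝ (Fin 2)) S}

theorem contMDiffAt_twistedCov_apply [T2Space M₁] (hS : IsSpinConnection σ cov₁ covS)
    (h₂ : IsLeviCivita cov₂) (φ : C^∞⟮𝓡 2, M₁; 𝓡 n, M₂⟯) (ψ : TwistedSection S φ)
    {s : Π x, S x} {w : Π x : M₁, TangentSpace (𝓡 2) x} (hU : IsOpen U)
    (hs : ContMDiffOn (𝓡 2) ((𝓡 2).prod 𝓘(ℝ, EuclideanSpace ℝ (Fin 2))) ∞
      (fun x' ↦ TotalSpace.mk' (EuclideanSpace ℝ (Fin 2)) x' (s x')) U)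
    (hw : ContMDiffOn (𝓡 2) ((𝓡 2).prod 𝓘(ℝ, EuclideanSpace ℝ (Fin 2))) ∞
      (fun y ↦ TotalSpace.mk' (EuclideanSpace ℝ (Fin 2))
        (E := fun y : M₁ ↦ TangentSpace (𝓡 2) y) y (w y)) U) {x : M₁} (hx : x ∈ U) :
    ContMDiffAt (𝓡 2) ((𝓡 2).prod 𝓘(ℝ, EuclideanSpace ℝ (Fin n))) ∞
      (fun x' ↦ TotalSpace.mk' (EuclideanSpace ℝ (Fin n))
        (E := (φ : M₁ → M₂) *ᵖ (fun q : M₂ ↦ TangentSpace (𝓡 n) q)) x'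
        (twistedCov covS cov₂ φ ψ x' (w x') (s x'))) x := by
  have h1 := contMDiffAt_pullbackCov h₂ φ hU (fun z hz ↦ (contMDiffAt_twistedSection_apply φ ψ
    (hs.contMDiffAt (hU.mem_nhds hz))).contMDiffWithinAt) hw hx
  have h2 : ContMDiffAt (𝓡 2) ((𝓡 2).prod 𝓘(ℝ, EuclideanSpace ℝ (Fin 2))) ∞
      (fun z ↦ TotalSpace.mk' (EuclideanSpace ℝ (Fin 2)) z (covS s z (w z))) x :=
    ContMDiffAt.clm_bundle_apply (F₁ := EuclideanSpace ℝ (Fin 2))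
      (E₁ := fun y : M₁ ↦ TangentSpace (𝓡 2) y) (b := fun y : M₁ ↦ y)
      (contMDiffAt_covariantDerivative hS.smooth hU hs hx) (hw.contMDiffAt (hU.mem_nhds hx))
  refine (h1.sub_section (contMDiffAt_twistedSection_apply φ ψ h2)).congr_of_eventuallyEq ?_
  filter_upwards [hU.mem_nhds hx] with z hz
  rw [twistedCov_apply covS cov₂ φ ψ ((hs.contMDiffAt (hU.mem_nhds hz)).mdifferentiableAt
    (by simp))]
  rfl

/-- The basis defining `⟨·,·⟩_E` is chosen pointwise without continuity; a local spin frame replaces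
it by a smooth expression. The same device handles `Dχ` below. -/
theorem continuous_twistedInner (σ : SpinStructure S ω₁) (φ : C^∞⟮𝓡 2, M₁; 𝓡 n, M₂⟯)
    (ψ χ : TwistedSection S φ) : Continuous fun x ↦ twistedInner σ φ x (ψ x) (χ x) := by
  refine continuous_iff_continuousAt.2 fun x ↦ ?_
  obtain ⟨U, b₁, b₂, hx, h⟩ := exists_isSpinFrameOn σ x
  have hU := h.isOpen.mem_nhds hx
  have c1 (ψ : TwistedSection S φ) :=
    contMDiffAt_twistedSection_apply φ ψ (h.contMDiffOn_left.contMDiffAt hU)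
  have c2 (ψ : TwistedSection S φ) :=
    contMDiffAt_twistedSection_apply φ ψ (h.contMDiffOn_right.contMDiffAt hU)
  refine ((contMDiffAt_pullbackInner φ (c1 ψ) (c2 χ)).sub
    (contMDiffAt_pullbackInner φ (c2 ψ) (c1 χ))).continuousAt.congr ?_
  filter_upwards [hU] with z hz
  rw [twistedInner_eq σ φ (h.isSpinPair z hz)]

theorem continuous_twistedInner_dirac [T2Space M₁] (hS : IsSpinConnection σ cov₁ covS)
    (h₂ : IsLeviCivita cov₂) (φ : C^∞⟮𝓡 2, M₁; 𝓡 n, M₂⟯) (ψ χ : TwistedSection S φ) :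
    Continuous fun x ↦ twistedInner σ φ x (ψ x) (dirac σ covS cov₂ φ χ x) := by
  refine continuous_iff_continuousAt.2 fun x ↦ ?_
  obtain ⟨U, b₁, b₂, hx, h⟩ := exists_isSpinFrameOn σ x
  have hU := h.isOpen.mem_nhds hx
  have c1 := contMDiffAt_twistedSection_apply φ ψ (h.contMDiffOn_left.contMDiffAt hU)
  have c2 := contMDiffAt_twistedSection_apply φ ψ (h.contMDiffOn_right.contMDiffAt hU)
  have he1 := contMDiffOn_sq σ h.contMDiffOn_left h.contMDiffOn_left
  have he2 := contMDiffOn_sq σ h.contMDiffOn_left h.contMDiffOn_right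
  have d11 := contMDiffAt_twistedCov_apply hS h₂ φ χ h.isOpen h.contMDiffOn_left he1 hx
  have d12 := contMDiffAt_twistedCov_apply hS h₂ φ χ h.isOpen h.contMDiffOn_left he2 hx
  have d21 := contMDiffAt_twistedCov_apply hS h₂ φ χ h.isOpen h.contMDiffOn_right he1 hx
  have d22 := contMDiffAt_twistedCov_apply hS h₂ φ χ h.isOpen h.contMDiffOn_right he2 hx
  refine ((contMDiffAt_pullbackInner φ c1 (d21.neg_section.add_section d12)).sub
    (contMDiffAt_pullbackInner φ c2 (d11.add_section d22))).continuousAt.congr ?_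
  filter_upwards [hU] with z hz
  rw [twistedInner_eq σ φ (h.isSpinPair z hz), dirac_apply_left σ covS cov₂ φ χ
    (h.isSpinPair z hz), dirac_apply_right σ covS cov₂ φ χ (h.isSpinPair z hz)]
  rfl

/-- Skew because the area form is skew and `g₂` symmetric. This is the sign that anticommuting
coefficients later absorb. -/
theorem twistedInner_swap (σ : SpinStructure S ω₁) (φ : C^∞⟮𝓡 2, M₁; 𝓡 n, M₂⟯) (x : M₁)
    (A B : TwistedFiber S φ x) : twistedInner σ φ x A B = -twistedInner σ φ x B A := by
  obtain ⟨U, b₁, b₂, hx, h⟩ := exists_isSpinFrameOn σ x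
  rw [twistedInner_eq σ φ (h.isSpinPair x hx), twistedInner_eq σ φ (h.isSpinPair x hx),
    pullbackInner_comm φ x (A (b₁ x)), pullbackInner_comm φ x (A (b₂ x))]
  ring

end Smoothness

/-! ### The Riemannian measure in charts -/

section Measure

variable {n : ℕ} {M : Type*} [TopologicalSpace M]
  [ChartedSpace (EuclideanSpace ℝ (Fin n)) M]

/-- If `A` is the matrix of `T` and `G` the Gram matrix of `L`, the Gram matrix of `L ∘ T` is `Aᵀ G
A`. -/
theorem sqrt_det_gram_comp {F : Type*} [NormedAddCommGroup F] [InnerProductSpace ℝ F]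
    (L : EuclideanSpace ℝ (Fin n) →ₗ[ℝ] F)
    (T : EuclideanSpace ℝ (Fin n) →ₗ[ℝ] EuclideanSpace ℝ (Fin n)) :
    √(Matrix.of fun i j : Fin n ↦ inner ℝ (L (T (EuclideanSpace.single i 1)))
      (L (T (EuclideanSpace.single j 1)))).det =
    |LinearMap.det T| * √(Matrix.of fun i j : Fin n ↦ inner ℝ (L (EuclideanSpace.single i 1))
      (L (EuclideanSpace.single j 1))).det := by
  set b := (EuclideanSpace.basisFun (Fin n) ℝ).toBasis
  set A := LinearMap.toMatrix b b T
  have hA (i k : Fin n) : A k i = T (EuclideanSpace.single i 1) k := by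
    simp [A, b, LinearMap.toMatrix_apply]
  have hT (i : Fin n) : L (T (EuclideanSpace.single i 1)) =
      ∑ k, A k i • L (EuclideanSpace.single k 1) := by
    have h := (EuclideanSpace.basisFun (Fin n) ℝ).sum_repr (T (EuclideanSpace.single i 1))
    rw [← h, map_sum]
    simp [hA]
  set G := Matrix.of fun i j : Fin n ↦ inner ℝ (L (EuclideanSpace.single i 1))
      (L (EuclideanSpace.single j 1))
  have h : (Matrix.of fun i j : Fin n ↦ inner ℝ (L (T (EuclideanSpace.single i 1)))
      (L (T (EuclideanSpace.single j 1)))) = A.transpose * G * A := by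
    ext i j
    simp only [Matrix.of_apply, hT, Matrix.mul_apply, sum_inner, inner_sum, real_inner_smul_left,
      real_inner_smul_right, Matrix.transpose_apply, G, Finset.sum_mul]
    exact Finset.sum_congr rfl fun _ _ ↦ Finset.sum_congr rfl fun _ _ ↦ by ring
  rw [h, Matrix.det_mul, Matrix.det_mul, Matrix.det_transpose,
    show A.det * G.det * A.det = A.det ^ 2 * G.det by ring, Real.sqrt_mul (sq_nonneg _),
    Real.sqrt_sq_eq_abs, LinearMap.det_toMatrix]

variable [RiemannianBundle (fun x : M ↦ TangentSpace (𝓡 n) x)]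

/-- Transport of base points: `p` may be only propositionally equal to `κ⁻¹(y)`, so `L` is compared
with the differential inside the model space, where the tangent spaces at both points live. -/
theorem chartDensity_eq {c p : M} {y : EuclideanSpace ℝ (Fin n)}
    (hp : (chartAt (EuclideanSpace ℝ (Fin n)) c).symm y = p)
    (L : EuclideanSpace ℝ (Fin n) →ₗ[ℝ] TangentSpace (𝓡 n) p)
    (hL : ∀ v : EuclideanSpace ℝ (Fin n), (mfderiv (𝓡 n) (𝓡 n)
      (chartAt (EuclideanSpace ℝ (Fin n)) c).symm y v : EuclideanSpace ℝ (Fin n)) = L v) :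
    chartDensity c y = √(Matrix.of fun i j : Fin n ↦ inner ℝ (L (EuclideanSpace.single i 1))
      (L (EuclideanSpace.single j 1))).det := by
  subst hp
  unfold chartDensity
  refine congrArg (fun A : Matrix (Fin n) (Fin n) ℝ ↦ √A.det) (Matrix.ext fun i j ↦ ?_)
  exact congrArg₂ (fun a b : TangentSpace (𝓡 n)
    ((chartAt (EuclideanSpace ℝ (Fin n)) c).symm y) ↦ inner ℝ a b) (hL _) (hL _)

variable [IsManifold (𝓡 n) ∞ M]

theorem mdifferentiableAt_chart_symm (c : M) {y : EuclideanSpace ℝ (Fin n)}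
    (hy : y ∈ (chartAt (EuclideanSpace ℝ (Fin n)) c).target) :
    MDifferentiableAt (𝓡 n) (𝓡 n) (chartAt (EuclideanSpace ℝ (Fin n)) c).symm y :=
  mdifferentiableAt_atlas_symm (chart_mem_atlas _ c) hy

theorem mdifferentiableAt_chart (c : M) {x : M}
    (hx : x ∈ (chartAt (EuclideanSpace ℝ (Fin n)) c).source) :
    MDifferentiableAt (𝓡 n) (𝓡 n) (chartAt (EuclideanSpace ℝ (Fin n)) c) x :=
  mdifferentiableAt_atlas (chart_mem_atlas _ c) hx

theorem differentiableAt_chart_change (c c' : M) {y : EuclideanSpace ℝ (Fin n)}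
    (hy : y ∈ (chartAt (EuclideanSpace ℝ (Fin n)) c).target)
    (hy' : (chartAt (EuclideanSpace ℝ (Fin n)) c).symm y ∈
      (chartAt (EuclideanSpace ℝ (Fin n)) c').source) :
    DifferentiableAt ℝ (chartAt (EuclideanSpace ℝ (Fin n)) c' ∘
      (chartAt (EuclideanSpace ℝ (Fin n)) c).symm) y := by
  have h := (mdifferentiableAt_chart c' hy').comp y (mdifferentiableAt_chart_symm c hy)
  exact mdifferentiableAt_iff_differentiableAt.1 h

/-- Near `y` one has `κ⁻¹ = κ'⁻¹ ∘ τ` with `τ` the transition map; the chain rule and the Gram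
determinant formula give the Jacobian factor. -/
theorem chartDensity_change (c c' : M) {y : EuclideanSpace ℝ (Fin n)}
    (hy : y ∈ (chartAt (EuclideanSpace ℝ (Fin n)) c).target)
    (hy' : (chartAt (EuclideanSpace ℝ (Fin n)) c).symm y ∈
      (chartAt (EuclideanSpace ℝ (Fin n)) c').source) :
    chartDensity c y = |(fderiv ℝ (chartAt (EuclideanSpace ℝ (Fin n)) c' ∘
        (chartAt (EuclideanSpace ℝ (Fin n)) c).symm) y).det| *
      chartDensity c' ((chartAt (EuclideanSpace ℝ (Fin n)) c' ∘
        (chartAt (EuclideanSpace ℝ (Fin n)) c).symm) y) := by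
  set κ := chartAt (EuclideanSpace ℝ (Fin n)) c
  set κ' := chartAt (EuclideanSpace ℝ (Fin n)) c'
  set τ := κ' ∘ κ.symm
  have hτ := differentiableAt_chart_change c c' hy hy'
  have h1 : κ'.symm (τ y) = κ.symm y := κ'.left_inv hy'
  have hty : τ y ∈ κ'.target := κ'.map_source hy'
  have h2 : κ.symm =ᶠ[nhds y] κ'.symm ∘ τ := by
    filter_upwards [κ.open_target.mem_nhds hy, (κ.continuousAt_symm hy).preimage_mem_nhds
      (κ'.open_source.mem_nhds hy')] with z _ hz'
    exact (κ'.left_inv hz').symm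
  have h3 := h2.mfderiv_eq (I := 𝓡 n) (I' := 𝓡 n)
  have h4 : mfderiv (𝓡 n) (𝓡 n) (κ'.symm ∘ τ) y = _ := mfderiv_comp y
    (mdifferentiableAt_chart_symm c' hty) hτ.mdifferentiableAt
  obtain ⟨L, hL⟩ : ∃ L : EuclideanSpace ℝ (Fin n) →ₗ[ℝ] TangentSpace (𝓡 n) (κ.symm y),
      ∀ v : EuclideanSpace ℝ (Fin n), (mfderiv (𝓡 n) (𝓡 n) κ'.symm (τ y) v :
        EuclideanSpace ℝ (Fin n)) = L v :=
    ⟨(mfderiv (𝓡 n) (𝓡 n) κ'.symm (τ y)).toLinearMap, fun _ ↦ rfl⟩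
  rw [chartDensity_eq (c := c') h1 L hL, ContinuousLinearMap.det, ← sqrt_det_gram_comp]
  refine chartDensity_eq (c := c) rfl (L ∘ₗ (fderiv ℝ τ y).toLinearMap) fun v ↦ ?_
  rw [h3, h4, mfderiv_eq_fderiv]
  exact hL _

/-- The coordinate fields of a chart are the frame of the tangent bundle trivialization, which is
smooth; this is the source of continuity of the density. -/
theorem chartDensity_chart_eq (c : M) {x : M}
    (hx : x ∈ (chartAt (EuclideanSpace ℝ (Fin n)) c).source) :
    chartDensity c (chartAt (EuclideanSpace ℝ (Fin n)) c x) =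
      √(Matrix.of fun i j : Fin n ↦ inner ℝ
        (targetFrame c i x : TangentSpace (𝓡 n) x) (targetFrame c j x)).det := by
  have hb : x ∈ (trivializationAt (EuclideanSpace ℝ (Fin n))
      (fun x : M ↦ TangentSpace (𝓡 n) x) c).baseSet := by simpa using hx
  have h := TangentBundle.symmL_trivializationAt (𝕜 := ℝ) (I := 𝓡 n) hx
  simp only [modelWithCornersSelf_coe, Set.range_id, mfderivWithin_univ] at h
  refine (chartDensity_eq ((chartAt _ c).left_inv hx) ((trivializationAt (EuclideanSpace ℝ (Fin n))
    (fun x : M ↦ TangentSpace (𝓡 n) x) c).symmL ℝ x).toLinearMap fun v ↦ ?_).trans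
    (congrArg (fun A : Matrix (Fin n) (Fin n) ℝ ↦ √A.det) (Matrix.ext fun i j ↦
      congrArg₂ (fun a b : TangentSpace (𝓡 n) x ↦ inner ℝ a b)
        (Trivialization.symmL_apply _ hb _) (Trivialization.symmL_apply _ hb _)))
  exact (DFunLike.congr_fun h v).symm

theorem continuousOn_chartDensity [IsContMDiffRiemannianBundle (𝓡 n) ∞ (EuclideanSpace ℝ (Fin n))
      (fun x : M ↦ TangentSpace (𝓡 n) x)] (c : M) :
    ContinuousOn (fun x ↦ chartDensity c (chartAt (EuclideanSpace ℝ (Fin n)) c x))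
      (chartAt (EuclideanSpace ℝ (Fin n)) c).source := by
  intro x hx
  refine ContinuousAt.continuousWithinAt ?_
  have h (i j : Fin n) : ContinuousAt (fun x ↦ inner ℝ
      (targetFrame c i x : TangentSpace (𝓡 n) x) (targetFrame c j x)) x :=
    (ContMDiffAt.inner_bundle (contMDiffAt_targetFrame c i (by simpa using hx))
      (contMDiffAt_targetFrame c j (by simpa using hx))).continuousAt
  have h2 : ContinuousAt (fun x ↦ √(Matrix.of fun i j : Fin n ↦ inner ℝ
        (targetFrame c i x : TangentSpace (𝓡 n) x) (targetFrame c j x)).det) x := by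
    refine Real.continuous_sqrt.continuousAt.comp ?_
    simp only [Matrix.det_apply]
    refine tendsto_finsetSum _ fun τ _ ↦ Filter.Tendsto.const_smul ?_ _
    exact tendsto_finsetProd _ fun i _ ↦ h _ _
  refine h2.congr ?_
  filter_upwards [(chartAt (EuclideanSpace ℝ (Fin n)) c).open_source.mem_nhds hx] with z hz
  exact (chartDensity_chart_eq c hz).symm

variable [MeasurableSpace M]

variable (n) in
/-- The measure `√det g dy¹ ⋯ dyⁿ` on the domain of the chart at `c`. -/
def chartMeasure (c : M) : Measure M :=
  Measure.map (chartAt (EuclideanSpace ℝ (Fin n)) c).symm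
    ((volume.restrict (chartAt (EuclideanSpace ℝ (Fin n)) c).target).withDensity
      fun y ↦ ENNReal.ofReal (chartDensity c y))

theorem chartMeasure_le_riemannianMeasure (c : M) : chartMeasure n c ≤ riemannianMeasure n M :=
  le_iSup (chartMeasure n) c

variable [BorelSpace M]

theorem aemeasurable_chart_symm (c : M) : AEMeasurable (chartAt (EuclideanSpace ℝ (Fin n)) c).symm
    ((volume.restrict (chartAt (EuclideanSpace ℝ (Fin n)) c).target).withDensity
      fun y ↦ ENNReal.ofReal (chartDensity c y)) :=
  ((chartAt (EuclideanSpace ℝ (Fin n)) c).continuousOn_symm.aemeasurable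
    (chartAt (EuclideanSpace ℝ (Fin n)) c).open_target.measurableSet).mono_ac
    (withDensity_absolutelyContinuous _ _)

theorem chartMeasure_apply (c : M) {A : Set M} (hA : MeasurableSet A) :
    chartMeasure n c A = ∫⁻ y in (chartAt (EuclideanSpace ℝ (Fin n)) c).symm ⁻¹' A ∩
      (chartAt (EuclideanSpace ℝ (Fin n)) c).target, ENNReal.ofReal (chartDensity c y) := by
  rw [chartMeasure, Measure.map_apply_of_aemeasurable (aemeasurable_chart_symm c) hA,
    withDensity_apply', Measure.restrict_restrict'
    (chartAt (EuclideanSpace ℝ (Fin n)) c).open_target.measurableSet]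

theorem chartMeasure_inter_source (c : M) {A : Set M} (hA : MeasurableSet A) :
    chartMeasure n c (A ∩ (chartAt (EuclideanSpace ℝ (Fin n)) c).source) = chartMeasure n c A := by
  rw [chartMeasure_apply c hA, chartMeasure_apply c
    (hA.inter (chartAt (EuclideanSpace ℝ (Fin n)) c).open_source.measurableSet)]
  congr 2
  ext y
  simp only [Set.mem_inter_iff, Set.mem_preimage]
  exact ⟨fun h ↦ ⟨h.1.1, h.2⟩, fun h ↦ ⟨⟨h.1, (chartAt _ c).map_target h.2⟩, h.2⟩⟩

theorem measurableSet_preimage_chart_symm (c : M) {A : Set M} (hA : MeasurableSet A) :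
    MeasurableSet ((chartAt (EuclideanSpace ℝ (Fin n)) c).symm ⁻¹' A ∩
      (chartAt (EuclideanSpace ℝ (Fin n)) c).target) := by
  have h := (chartAt (EuclideanSpace ℝ (Fin n)) c).continuousOn_symm.domRestrict.measurable hA
  have h2 := (chartAt (EuclideanSpace ℝ (Fin n)) c).open_target.measurableSet.subtype_image h
  convert h2 using 1
  ext y
  simp

/-- Change of variables along the transition map; its Jacobian is exactly the factor relating the
two densities. -/
theorem chartMeasure_apply_eq (c c' : M) {A : Set M} (hA : MeasurableSet A)
    (hc : A ⊆ (chartAt (EuclideanSpace ℝ (Fin n)) c).source)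
    (hc' : A ⊆ (chartAt (EuclideanSpace ℝ (Fin n)) c').source) :
    chartMeasure n c A = chartMeasure n c' A := by
  set κ := chartAt (EuclideanSpace ℝ (Fin n)) c
  set κ' := chartAt (EuclideanSpace ℝ (Fin n)) c'
  rw [chartMeasure_apply c hA, chartMeasure_apply c' hA]
  have himg : κ'.symm ⁻¹' A ∩ κ'.target = (κ' ∘ κ.symm) '' (κ.symm ⁻¹' A ∩ κ.target) := by
    ext y
    constructor
    · rintro ⟨h1, h2⟩
      refine ⟨κ (κ'.symm y), ⟨?_, κ.map_source (hc h1)⟩, ?_⟩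
      · rwa [Set.mem_preimage, κ.left_inv (hc h1)]
      · rw [Function.comp_apply, κ.left_inv (hc h1), κ'.right_inv h2]
    · rintro ⟨z, ⟨h1, h2⟩, rfl⟩
      refine ⟨?_, κ'.map_source (hc' h1)⟩
      rwa [Set.mem_preimage, Function.comp_apply, κ'.left_inv (hc' h1)]
  have hinj : Set.InjOn (κ' ∘ κ.symm) (κ.symm ⁻¹' A ∩ κ.target) :=
    fun y hy z hz h ↦ κ.symm.injOn hy.2 hz.2 (κ'.injOn (hc' hy.1) (hc' hz.1) h)
  have hd : ∀ y ∈ κ.symm ⁻¹' A ∩ κ.target, HasFDerivWithinAt (κ' ∘ κ.symm)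
      (fderiv ℝ (κ' ∘ κ.symm) y) (κ.symm ⁻¹' A ∩ κ.target) y := fun y hy ↦
    (differentiableAt_chart_change c c' hy.2 (hc' hy.1)).hasFDerivAt.hasFDerivWithinAt
  have hm := measurableSet_preimage_chart_symm (n := n) c hA
  rw [himg, lintegral_image_eq_lintegral_abs_det_fderiv_mul volume hm hd hinj]
  refine setLIntegral_congr_fun hm fun y hy ↦ ?_
  rw [← ENNReal.ofReal_mul (abs_nonneg _)]
  exact congrArg _ (chartDensity_change c c' hy.2 (hc' hy.1))

/-- A supremum of measures need not be the setwise supremum, so the upper bound is obtained from a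
competitor: a measure glued from countably many charts that dominates every chart measure and agrees
with each on its own domain. -/
theorem riemannianMeasure_apply_of_subset [SigmaCompactSpace M] (c : M) {A : Set M}
    (hA : MeasurableSet A) (hc : A ⊆ (chartAt (EuclideanSpace ℝ (Fin n)) c).source) :
    riemannianMeasure n M A = chartMeasure n c A := by
  refine le_antisymm ?_ (chartMeasure_le_riemannianMeasure c A)
  obtain ⟨s, hs, hsU⟩ := countable_cover_nhds_of_sigmaCompact
    (fun x : M ↦ chart_source_mem_nhds (EuclideanSpace ℝ (Fin n)) x)
  have hne : s.Nonempty := by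
    by_contra! h
    have := hsU.symm ▸ Set.mem_univ c
    simp [h] at this
  obtain ⟨f, rfl⟩ := hs.exists_eq_range hne
  set P : ℕ → Set M := disjointed fun i ↦ (chartAt (EuclideanSpace ℝ (Fin n)) (f i)).source
  have hP (i : ℕ) : MeasurableSet (P i) := MeasurableSet.disjointed
    (fun i ↦ (chartAt (EuclideanSpace ℝ (Fin n)) (f i)).open_source.measurableSet) i
  have hPs (i : ℕ) : P i ⊆ (chartAt (EuclideanSpace ℝ (Fin n)) (f i)).source :=
    disjointed_subset _ i
  have hPU : ⋃ i, P i = Set.univ := by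
    rw [iUnion_disjointed, ← hsU, Set.biUnion_range]
  have hsum (μ : Measure M) : μ = Measure.sum fun i ↦ μ.restrict (P i) := by
    rw [← Measure.restrict_iUnion (disjoint_disjointed _) hP, hPU, Measure.restrict_univ]
  -- `ν` uses the `i`-th chart on the `i`-th piece of a countable partition of `M` subordinate to
  -- chart domains.
  set ν : Measure M := Measure.sum fun i ↦ (chartMeasure n (f i)).restrict (P i)
  have hν (c' : M) {B : Set M} (hB : MeasurableSet B)
      (hBc : B ⊆ (chartAt (EuclideanSpace ℝ (Fin n)) c').source) :
      ν B = chartMeasure n c' B := by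
    rw [hsum (chartMeasure n c'), Measure.sum_apply _ hB, Measure.sum_apply _ hB]
    refine tsum_congr fun i ↦ ?_
    rw [Measure.restrict_apply hB, Measure.restrict_apply hB]
    exact chartMeasure_apply_eq _ _ (hB.inter (hP i)) (Set.inter_subset_right.trans (hPs i))
      (Set.inter_subset_left.trans hBc)
  have hle : riemannianMeasure n M ≤ ν := by
    refine iSup_le fun c' ↦ Measure.le_iff.2 fun B hB ↦ ?_
    have h := chartMeasure_inter_source (n := n) c' hB
    rw [← hν c' (hB.inter (chartAt _ c').open_source.measurableSet) Set.inter_subset_right] at h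
    exact h.symm.le.trans (measure_mono Set.inter_subset_left)
  exact (hle A).trans (hν c hA hc).le

theorem restrict_riemannianMeasure [SigmaCompactSpace M] (c : M) :
    (riemannianMeasure n M).restrict (chartAt (EuclideanSpace ℝ (Fin n)) c).source =
      chartMeasure n c := by
  ext A hA
  rw [Measure.restrict_apply hA, riemannianMeasure_apply_of_subset c
    (hA.inter (chartAt _ c).open_source.measurableSet) Set.inter_subset_right,
    chartMeasure_inter_source c hA]

variable [IsContMDiffRiemannianBundle (𝓡 n) ∞ (EuclideanSpace ℝ (Fin n))
  (fun x : M ↦ TangentSpace (𝓡 n) x)]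

/-- Near `x` the density is at most its value at `x` plus one, and the chart maps a small
neighbourhood into a ball, which has finite Lebesgue measure. -/
theorem isLocallyFiniteMeasure_riemannianMeasure [SigmaCompactSpace M] :
    IsLocallyFiniteMeasure (riemannianMeasure n M) := by
  refine ⟨fun x ↦ ?_⟩
  set κ := chartAt (EuclideanSpace ℝ (Fin n)) x
  have hx : x ∈ κ.source := mem_chart_source _ x
  have h1 : ∀ᶠ z in nhds x, chartDensity x (κ z) < chartDensity x (κ x) + 1 :=
    ((continuousOn_chartDensity x).continuousAt (κ.open_source.mem_nhds hx)).eventually_lt_const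
      (lt_add_one _)
  have h2 : ∀ᶠ z in nhds x, κ z ∈ Metric.ball (κ x) 1 :=
    (κ.continuousAt hx) (Metric.ball_mem_nhds _ one_pos)
  obtain ⟨U, hU, hUo, hxU⟩ := mem_nhds_iff.1
    ((h1.and h2).and (κ.open_source.mem_nhds hx))
  refine ⟨U, hUo.mem_nhds hxU, ?_⟩
  rw [riemannianMeasure_apply_of_subset x hUo.measurableSet fun z hz ↦ (hU hz).2,
    chartMeasure_apply x hUo.measurableSet]
  have hm := measurableSet_preimage_chart_symm (n := n) x hUo.measurableSet
  have hb : ∀ y ∈ κ.symm ⁻¹' U ∩ κ.target, y ∈ Metric.ball (κ x) 1 ∧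
      chartDensity x y ≤ chartDensity x (κ x) + 1 := fun y hy ↦ by
    have h := (hU hy.1).1
    rw [κ.right_inv hy.2] at h
    exact ⟨h.2, h.1.le⟩
  calc ∫⁻ y in κ.symm ⁻¹' U ∩ κ.target, ENNReal.ofReal (chartDensity x y)
      ≤ ∫⁻ y in κ.symm ⁻¹' U ∩ κ.target, ENNReal.ofReal (chartDensity x (κ x) + 1) :=
        setLIntegral_mono' hm fun y hy ↦ ENNReal.ofReal_le_ofReal (hb y hy).2
    _ ≤ ∫⁻ y in Metric.ball (κ x) 1, ENNReal.ofReal (chartDensity x (κ x) + 1) :=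
        lintegral_mono_set fun y hy ↦ (hb y hy).1
    _ < ⊤ := by
        rw [setLIntegral_const]
        exact ENNReal.mul_lt_top ENNReal.ofReal_lt_top measure_ball_lt_top

theorem chartDensity_nonneg (c : M) (y : EuclideanSpace ℝ (Fin n)) : 0 ≤ chartDensity c y :=
  Real.sqrt_nonneg _

theorem integral_riemannianMeasure_of_subset [SigmaCompactSpace M] (c : M) {f : M → ℝ}
    (hf : Continuous f)
    (hc : Function.support f ⊆ (chartAt (EuclideanSpace ℝ (Fin n)) c).source) :
    ∫ x, f x ∂(riemannianMeasure n M) = ∫ y in (chartAt (EuclideanSpace ℝ (Fin n)) c).target,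
      chartDensity c y * f ((chartAt (EuclideanSpace ℝ (Fin n)) c).symm y) := by
  have hmeas : AEMeasurable (fun y ↦ ENNReal.ofReal (chartDensity c y))
      (volume.restrict (chartAt (EuclideanSpace ℝ (Fin n)) c).target) := by
    refine ENNReal.measurable_ofReal.comp_aemeasurable (ContinuousOn.aemeasurable ?_
      (chartAt (EuclideanSpace ℝ (Fin n)) c).open_target.measurableSet)
    have h := (continuousOn_chartDensity c).comp
      (chartAt (EuclideanSpace ℝ (Fin n)) c).continuousOn_symm
      fun y hy ↦ (chartAt (EuclideanSpace ℝ (Fin n)) c).map_target hy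
    refine h.congr fun y hy ↦ ?_
    rw [Function.comp_apply, (chartAt (EuclideanSpace ℝ (Fin n)) c).right_inv hy]
  rw [← setIntegral_eq_integral_of_forall_compl_eq_zero
    (s := (chartAt (EuclideanSpace ℝ (Fin n)) c).source)
    fun x hx ↦ Function.notMem_support.1 fun h ↦ hx (hc h), restrict_riemannianMeasure,
    chartMeasure, integral_map (aemeasurable_chart_symm c) hf.aestronglyMeasurable,
    integral_withDensity_eq_integral_toReal_smul₀ hmeas (by simp)]
  simp only [ENNReal.toReal_ofReal (chartDensity_nonneg c _), smul_eq_mul]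

end Measure

/-! ### Divergence in the plane -/

section Divergence

theorem integral_fderiv_apply_eq_zero {n : ℕ} {f : EuclideanSpace ℝ (Fin n) → ℝ}
    (hf : ContDiff ℝ 1 f) (hs : HasCompactSupport f) (v : EuclideanSpace ℝ (Fin n)) :
    Integrable (fun x ↦ fderiv ℝ f x v) ∧ ∫ x, fderiv ℝ f x v = 0 := by
  have h1 : Integrable (fun x ↦ fderiv ℝ f x v) :=
    ((hf.continuous_fderiv one_ne_zero).clm_apply continuous_const).integrable_of_hasCompactSupport
      (hs.fderiv_apply ℝ v)
  refine ⟨h1, ?_⟩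
  -- Integration by parts against the constant function `1`.
  have h := integral_mul_fderiv_eq_neg_fderiv_mul_of_integrable (μ := volume) (f := fun _ ↦ (1 : ℝ))
    (g := f) (v := v) (by simp) (by simpa using h1)
    (by simpa using hf.continuous.integrable_of_hasCompactSupport hs)
    (fun x _ ↦ differentiableAt_const _) (fun x _ ↦ (hf.differentiable one_ne_zero) x)
  simpa using h

/-- The divergence of the vector field `f X₂ - g X₁` with respect to the density for which
`X₁, X₂` is a unimodular frame of the plane. -/
theorem divergence_frame {X₁ X₂ : EuclideanSpace ℝ (Fin 2) → EuclideanSpace ℝ (Fin 2)}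
    {f g : EuclideanSpace ℝ (Fin 2) → ℝ} {y : EuclideanSpace ℝ (Fin 2)} {a b : ℝ}
    (h₁ : DifferentiableAt ℝ X₁ y) (h₂ : DifferentiableAt ℝ X₂ y) (hf : DifferentiableAt ℝ f y)
    (hg : DifferentiableAt ℝ g y)
    (hb : VectorField.lieBracket ℝ X₁ X₂ y = a • X₁ y + b • X₂ y)
    (hD : X₁ y 0 * X₂ y 1 - X₁ y 1 * X₂ y 0 ≠ 0) :
    ∑ i, fderiv ℝ (fun z ↦ |X₁ z 0 * X₂ z 1 - X₁ z 1 * X₂ z 0|⁻¹ *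
      (f z * X₂ z i - g z * X₁ z i)) y (EuclideanSpace.single i 1) =
    |X₁ y 0 * X₂ y 1 - X₁ y 1 * X₂ y 0|⁻¹ *
      (fderiv ℝ f y (X₂ y) - fderiv ℝ g y (X₁ y) + a * f y + b * g y) := by
  have hp (i : Fin 2) (v : EuclideanSpace ℝ (Fin 2)) :
      (EuclideanSpace.proj i : EuclideanSpace ℝ (Fin 2) →L[ℝ] ℝ) v = v i := rfl
  have c₁ (i : Fin 2) : HasFDerivAt (fun z ↦ X₁ z i)
      ((EuclideanSpace.proj i : EuclideanSpace ℝ (Fin 2) →L[ℝ] ℝ).comp (fderiv ℝ X₁ y)) y :=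
    (EuclideanSpace.proj i : EuclideanSpace ℝ (Fin 2) →L[ℝ] ℝ).hasFDerivAt.comp y h₁.hasFDerivAt
  have c₂ (i : Fin 2) : HasFDerivAt (fun z ↦ X₂ z i)
      ((EuclideanSpace.proj i : EuclideanSpace ℝ (Fin 2) →L[ℝ] ℝ).comp (fderiv ℝ X₂ y)) y :=
    (EuclideanSpace.proj i : EuclideanSpace ℝ (Fin 2) →L[ℝ] ℝ).hasFDerivAt.comp y h₂.hasFDerivAt
  have dD := ((c₁ 0).mul (c₂ 1)).sub ((c₁ 1).mul (c₂ 0))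
  -- The determinant has constant sign near `y`, so its absolute value is removed before
  -- differentiating, at the price of a locally constant `s = ±1`.
  obtain ⟨s, hs⟩ : ∃ s : ℝ, ∀ᶠ z in nhds y, |X₁ z 0 * X₂ z 1 - X₁ z 1 * X₂ z 0|⁻¹ =
      s * (X₁ z 0 * X₂ z 1 - X₁ z 1 * X₂ z 0)⁻¹ := by
    rcases lt_or_gt_of_ne hD with h | h
    · refine ⟨-1, (dD.continuousAt.eventually_lt_const h).mono fun z hz ↦ ?_⟩
      simp only [Pi.sub_apply, Pi.mul_apply] at hz
      rw [abs_of_neg hz, inv_neg]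
      ring
    · refine ⟨1, (dD.continuousAt.eventually_const_lt h).mono fun z hz ↦ ?_⟩
      simp only [Pi.sub_apply, Pi.mul_apply] at hz
      rw [abs_of_pos hz, one_mul]
  have key (i : Fin 2) := ((((hasDerivAt_inv hD).comp_hasFDerivAt y dD).const_mul s).mul
    ((hf.hasFDerivAt.mul (c₂ i)).sub (hg.hasFDerivAt.mul (c₁ i)))).fderiv
  have heq (i : Fin 2) : (fun z ↦ |X₁ z 0 * X₂ z 1 - X₁ z 1 * X₂ z 0|⁻¹ *
      (f z * X₂ z i - g z * X₁ z i)) =ᶠ[nhds y] fun z ↦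
      s * (X₁ z 0 * X₂ z 1 - X₁ z 1 * X₂ z 0)⁻¹ * (f z * X₂ z i - g z * X₁ z i) := by
    filter_upwards [hs] with z hz
    rw [hz]
  have hlin (L : EuclideanSpace ℝ (Fin 2) →L[ℝ] ℝ) (v : EuclideanSpace ℝ (Fin 2)) :
      L v = v 0 * L (EuclideanSpace.single 0 1) + v 1 * L (EuclideanSpace.single 1 1) := by
    conv_lhs => rw [← (EuclideanSpace.basisFun (Fin 2) ℝ).sum_repr v]
    simp
  have hb0 := congrArg (fun v : EuclideanSpace ℝ (Fin 2) ↦ v 0) hb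
  have hb1 := congrArg (fun v : EuclideanSpace ℝ (Fin 2) ↦ v 1) hb
  have e1 (i : Fin 2) (v : EuclideanSpace ℝ (Fin 2)) := hlin
    ((EuclideanSpace.proj i : EuclideanSpace ℝ (Fin 2) →L[ℝ] ℝ).comp (fderiv ℝ X₁ y)) v
  have e2 (i : Fin 2) (v : EuclideanSpace ℝ (Fin 2)) := hlin
    ((EuclideanSpace.proj i : EuclideanSpace ℝ (Fin 2) →L[ℝ] ℝ).comp (fderiv ℝ X₂ y)) v
  simp only [ContinuousLinearMap.comp_apply, hp] at e1 e2
  simp only [VectorField.lieBracket, PiLp.sub_apply, PiLp.add_apply, PiLp.smul_apply, smul_eq_mul,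
    e1 _ (X₂ y), e2 _ (X₁ y)] at hb0 hb1
  rw [Fin.sum_univ_two, (heq 0).fderiv_eq, (heq 1).fderiv_eq, hs.self_of_nhds]
  have k0 := congrArg (fun L ↦ L (EuclideanSpace.single (0 : Fin 2) (1 : ℝ))) (key 0)
  have k1 := congrArg (fun L ↦ L (EuclideanSpace.single (1 : Fin 2) (1 : ℝ))) (key 1)
  refine (congrArg₂ (· + ·) k0 k1).trans ?_
  clear k0 k1 key
  rw [hlin (fderiv ℝ f y), hlin (fderiv ℝ g y)]
  simp only [_root_.add_apply, _root_.sub_apply, _root_.smul_apply, Pi.sub_apply, Pi.mul_apply,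
    Function.comp_apply, ContinuousLinearMap.comp_apply, hp, smul_eq_mul]
  generalize X₁ y 0 = p at *
  generalize X₁ y 1 = q at *
  generalize X₂ y 0 = r at *
  generalize X₂ y 1 = t at *
  field_simp
  -- Cramer's rule for the bracket relation: `det([X₁, X₂], X₂) = a det(X₁, X₂)` is `t * hb0 - r *
  -- hb1`, and `det(X₁, [X₁, X₂]) = b det(X₁, X₂)` is `p * hb1 - q * hb0`.
  linear_combination s * f y * (t * hb0 - r * hb1) + s * g y * (p * hb1 - q * hb0)

end Divergence

/-! ### The divergence theorem in a chart -/

section LocalStokes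

variable {M : Type*} [TopologicalSpace M] [ChartedSpace (EuclideanSpace ℝ (Fin 2)) M]
  [IsManifold (𝓡 2) ∞ M] [RiemannianBundle (fun x : M ↦ TangentSpace (𝓡 2) x)]

theorem isInvertible_mfderiv_chart_symm (c : M) {y : EuclideanSpace ℝ (Fin 2)}
    (hy : y ∈ (chartAt (EuclideanSpace ℝ (Fin 2)) c).target) :
    (mfderiv (𝓡 2) (𝓡 2) (chartAt (EuclideanSpace ℝ (Fin 2)) c).symm y).IsInvertible :=
  ⟨(mdifferentiable_chart (I := 𝓡 2) c).symm.mfderiv hy, rfl⟩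

/-- The Riemannian density in a chart is the inverse of the determinant of an orthonormal frame. -/
theorem chartDensity_mul_abs_det (c : M) {y v w : EuclideanSpace ℝ (Fin 2)}
    (hv : ‖mfderiv (𝓡 2) (𝓡 2) (chartAt (EuclideanSpace ℝ (Fin 2)) c).symm y v‖ = 1)
    (hw : ‖mfderiv (𝓡 2) (𝓡 2) (chartAt (EuclideanSpace ℝ (Fin 2)) c).symm y w‖ = 1)
    (hvw : inner ℝ (mfderiv (𝓡 2) (𝓡 2) (chartAt (EuclideanSpace ℝ (Fin 2)) c).symm y v)
      (mfderiv (𝓡 2) (𝓡 2) (chartAt (EuclideanSpace ℝ (Fin 2)) c).symm y w) = 0) :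
    |v 0 * w 1 - v 1 * w 0| * chartDensity c y = 1 := by
  set b := (EuclideanSpace.basisFun (Fin 2) ℝ).toBasis
  -- `T` sends the standard basis to `v, w`, so `L ∘ T` has Gram matrix the identity and
  -- `sqrt_det_gram_comp` becomes `1 = |det T|` times the density.
  set T : EuclideanSpace ℝ (Fin 2) →ₗ[ℝ] EuclideanSpace ℝ (Fin 2) := b.constr ℝ ![v, w]
  have hbi (i : Fin 2) : b i = EuclideanSpace.single i 1 := by simp [b]
  have hT0 : T (EuclideanSpace.single 0 1) = v := by
    rw [← hbi]
    exact b.constr_basis ℝ ![v, w] 0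
  have hT1 : T (EuclideanSpace.single 1 1) = w := by
    rw [← hbi]
    exact b.constr_basis ℝ ![v, w] 1
  have hdet : LinearMap.det T = v 0 * w 1 - v 1 * w 0 := by
    rw [← LinearMap.det_toMatrix b, Matrix.det_fin_two]
    simp [LinearMap.toMatrix_apply, b, hT0, hT1]
    ring
  set L := (mfderiv (𝓡 2) (𝓡 2) (chartAt (EuclideanSpace ℝ (Fin 2)) c).symm y).toLinearMap
  have h := sqrt_det_gram_comp (F := TangentSpace (𝓡 2)
    ((chartAt (EuclideanSpace ℝ (Fin 2)) c).symm y)) L T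
  rw [hdet] at h
  refine h.symm.trans ?_
  rw [Matrix.det_fin_two]
  simp only [Matrix.of_apply, hT0, hT1]
  change √(inner ℝ (mfderiv (𝓡 2) (𝓡 2) (chartAt (EuclideanSpace ℝ (Fin 2)) c).symm y v)
      (mfderiv (𝓡 2) (𝓡 2) (chartAt (EuclideanSpace ℝ (Fin 2)) c).symm y v) *
    inner ℝ (mfderiv (𝓡 2) (𝓡 2) (chartAt (EuclideanSpace ℝ (Fin 2)) c).symm y w)
      (mfderiv (𝓡 2) (𝓡 2) (chartAt (EuclideanSpace ℝ (Fin 2)) c).symm y w) -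
    inner ℝ (mfderiv (𝓡 2) (𝓡 2) (chartAt (EuclideanSpace ℝ (Fin 2)) c).symm y v)
      (mfderiv (𝓡 2) (𝓡 2) (chartAt (EuclideanSpace ℝ (Fin 2)) c).symm y w) *
    inner ℝ (mfderiv (𝓡 2) (𝓡 2) (chartAt (EuclideanSpace ℝ (Fin 2)) c).symm y w)
      (mfderiv (𝓡 2) (𝓡 2) (chartAt (EuclideanSpace ℝ (Fin 2)) c).symm y v)) = 1
  rw [real_inner_self_eq_norm_sq, real_inner_self_eq_norm_sq, hv, hw, hvw]
  simp

variable [MeasurableSpace M] [BorelSpace M] [SigmaCompactSpace M]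
  [IsContMDiffRiemannianBundle (𝓡 2) ∞ (EuclideanSpace ℝ (Fin 2))
    (fun x : M ↦ TangentSpace (𝓡 2) x)]

/-- The divergence theorem for a compactly supported vector field `-Q e₁ + P e₂`, where `e₁, e₂`
is an orthonormal frame on an open subset of the domain of a chart. -/
theorem integral_divergence_eq_zero (c : M) {U K : Set M} (hU : IsOpen U)
    (hUc : U ⊆ (chartAt (EuclideanSpace ℝ (Fin 2)) c).source) (hK : IsCompact K) (hKU : K ⊆ U)
    {e₁ e₂ : Π x : M, TangentSpace (𝓡 2) x} {P Q F a b : M → ℝ}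
    (he₁ : ContMDiffOn (𝓡 2) ((𝓡 2).prod 𝓘(ℝ, EuclideanSpace ℝ (Fin 2))) ∞
      (fun y ↦ TotalSpace.mk' (EuclideanSpace ℝ (Fin 2))
        (E := fun y : M ↦ TangentSpace (𝓡 2) y) y (e₁ y)) U)
    (he₂ : ContMDiffOn (𝓡 2) ((𝓡 2).prod 𝓘(ℝ, EuclideanSpace ℝ (Fin 2))) ∞
      (fun y ↦ TotalSpace.mk' (EuclideanSpace ℝ (Fin 2))
        (E := fun y : M ↦ TangentSpace (𝓡 2) y) y (e₂ y)) U)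
    (h₁ : ∀ x ∈ U, ‖e₁ x‖ = 1) (h₂ : ∀ x ∈ U, ‖e₂ x‖ = 1) (h₁₂ : ∀ x ∈ U, inner ℝ (e₁ x) (e₂ x) = 0)
    (hb : ∀ x ∈ U, VectorField.mlieBracket (𝓡 2) e₁ e₂ x = a x • e₁ x + b x • e₂ x)
    (hP : ContMDiffOn (𝓡 2) 𝓘(ℝ) ∞ P U) (hQ : ContMDiffOn (𝓡 2) 𝓘(ℝ) ∞ Q U)
    (hPK : ∀ x ∉ K, P x = 0) (hQK : ∀ x ∉ K, Q x = 0) (hF : Continuous F)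
    (hFK : ∀ x ∉ K, F x = 0)
    (hFU : ∀ x ∈ U, F x = -mvfderiv (𝓡 2) Q x (e₁ x) + mvfderiv (𝓡 2) P x (e₂ x) +
      a x * P x + b x * Q x) :
    ∫ x, F x ∂(riemannianMeasure 2 M) = 0 := by
  set κ := chartAt (EuclideanSpace ℝ (Fin 2)) c
  set Ω : Set (EuclideanSpace ℝ (Fin 2)) := κ.target ∩ κ.symm ⁻¹' U
  have hΩ : IsOpen Ω := κ.symm.isOpen_inter_preimage hU
  set E₁ : EuclideanSpace ℝ (Fin 2) → EuclideanSpace ℝ (Fin 2) :=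
    VectorField.mpullback (𝓡 2) (𝓡 2) κ.symm e₁
  set E₂ : EuclideanSpace ℝ (Fin 2) → EuclideanSpace ℝ (Fin 2) :=
    VectorField.mpullback (𝓡 2) (𝓡 2) κ.symm e₂
  set D : EuclideanSpace ℝ (Fin 2) → ℝ := fun y ↦ E₁ y 0 * E₂ y 1 - E₁ y 1 * E₂ y 0
  have hinv (y) (hy : y ∈ Ω) : (mfderiv (𝓡 2) (𝓡 2) κ.symm y).IsInvertible :=
    isInvertible_mfderiv_chart_symm c hy.1
  have hsm (y) (hy : y ∈ Ω) : ContMDiffAt (𝓡 2) (𝓡 2) ∞ κ.symm y :=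
    (contMDiffOn_chart_symm (I := 𝓡 2) (n := ∞) (x := c)).contMDiffAt (κ.open_target.mem_nhds hy.1)
  have hc {e : Π x : M, TangentSpace (𝓡 2) x}
      (he : ContMDiffOn (𝓡 2) ((𝓡 2).prod 𝓘(ℝ, EuclideanSpace ℝ (Fin 2))) ∞
        (fun y ↦ TotalSpace.mk' (EuclideanSpace ℝ (Fin 2))
          (E := fun y : M ↦ TangentSpace (𝓡 2) y) y (e y)) U) (y) (hy : y ∈ Ω) :
      ContDiffAt ℝ ∞ (VectorField.mpullback (𝓡 2) (𝓡 2) κ.symm e) y :=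
    contMDiffAt_vectorSpace_iff_contDiffAt.1 (ContMDiffAt.mpullback_vectorField_preimage
      (he.contMDiffAt (hU.mem_nhds hy.2)) (hsm y hy) (hinv y hy) (by simp))
  have hmf (e : Π x : M, TangentSpace (𝓡 2) x) (y) (hy : y ∈ Ω) :
      mfderiv (𝓡 2) (𝓡 2) κ.symm y (VectorField.mpullback (𝓡 2) (𝓡 2) κ.symm e y) =
        e (κ.symm y) := (hinv y hy).self_apply_inverse _
  have hdens (y) (hy : y ∈ Ω) : |D y| * chartDensity c y = 1 := by
    refine chartDensity_mul_abs_det c ?_ ?_ ?_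
    · exact (congrArg norm (hmf e₁ y hy)).trans (h₁ _ hy.2)
    · exact (congrArg norm (hmf e₂ y hy)).trans (h₂ _ hy.2)
    · exact (congrArg₂ (fun v w : TangentSpace (𝓡 2) (κ.symm y) ↦ inner ℝ v w)
        (hmf e₁ y hy) (hmf e₂ y hy)).trans (h₁₂ _ hy.2)
  have hD (y) (hy : y ∈ Ω) : D y ≠ 0 := fun h ↦ by simpa [h] using hdens y hy
  -- Lie brackets commute with pullback by a local diffeomorphism, so the structure functions `a`,
  -- `b` carry over to the chart.
  have hbr (y) (hy : y ∈ Ω) : VectorField.lieBracket ℝ E₁ E₂ y =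
      a (κ.symm y) • E₁ y + b (κ.symm y) • E₂ y := by
    have h2 : (2 : ℕ∞ω) ≤ ∞ := WithTop.coe_le_coe.2 (le_top (a := (2 : ℕ∞)))
    have hm : minSmoothness ℝ 2 ≤ ∞ := by rwa [minSmoothness_of_isRCLikeNormedField]
    have : IsManifold (𝓡 2) (minSmoothness ℝ 2) M := .of_le hm
    have h := VectorField.mpullback_mlieBracket (𝕜 := ℝ) (n := ∞)
      ((he₁.contMDiffAt (hU.mem_nhds hy.2)).mdifferentiableAt (by simp))
      ((he₂.contMDiffAt (hU.mem_nhds hy.2)).mdifferentiableAt (by simp)) (hsm y hy) hm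
    rw [VectorField.mpullback_apply, hb _ hy.2, map_add, map_smul, map_smul,
      ← VectorField.mlieBracketWithin_univ,
      VectorField.mlieBracketWithin_eq_lieBracketWithin] at h
    exact (congrFun (VectorField.lieBracketWithin_univ (𝕜 := ℝ) (V := E₁) (W := E₂)) y).symm.trans
      h.symm
  have hs {f : M → ℝ} (hf : ContMDiffOn (𝓡 2) 𝓘(ℝ) ∞ f U) (y) (hy : y ∈ Ω) :
      ContDiffAt ℝ ∞ (f ∘ κ.symm) y :=
    ((hf.contMDiffAt (hU.mem_nhds hy.2)).comp y (hsm y hy)).contDiffAt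
  have hfd {f : M → ℝ} (hf : ContMDiffOn (𝓡 2) 𝓘(ℝ) ∞ f U) (e : Π x : M, TangentSpace (𝓡 2) x)
      (y) (hy : y ∈ Ω) :
      fderiv ℝ (f ∘ κ.symm) y (VectorField.mpullback (𝓡 2) (𝓡 2) κ.symm e y) =
        mvfderiv (𝓡 2) f (κ.symm y) (e (κ.symm y)) := by
    have h := mfderiv_comp y ((hf.contMDiffAt (hU.mem_nhds hy.2)).mdifferentiableAt (by simp))
      ((hsm y hy).mdifferentiableAt (by simp))
    rw [← hmf e y hy, ← mfderiv_eq_fderiv]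
    exact DFunLike.congr_fun h _
  have hKκ : IsClosed (κ '' K) :=
    (hK.image_of_continuousOn (κ.continuousOn.mono (hKU.trans hUc))).isClosed
  have hKΩ : κ '' K ⊆ Ω := by
    rintro _ ⟨x, hx, rfl⟩
    refine ⟨κ.map_source (hUc (hKU hx)), ?_⟩
    rw [Set.mem_preimage, κ.left_inv (hUc (hKU hx))]
    exact hKU hx
  have hnot (y) (hy : y ∈ κ.target) (hyK : y ∉ κ '' K) : κ.symm y ∉ K :=
    fun h ↦ hyK ⟨_, h, κ.right_inv hy⟩
  -- `Z₀` has the components of `P e₂ - Q e₁` times the density `|D|⁻¹`. Its extension `Z` by zero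
  -- is `C¹` on the whole plane because it vanishes off the compact set `κ(K) ⊆ Ω`.
  set Z₀ : Fin 2 → EuclideanSpace ℝ (Fin 2) → ℝ := fun i z ↦
    |E₁ z 0 * E₂ z 1 - E₁ z 1 * E₂ z 0|⁻¹ *
      ((P ∘ κ.symm) z * E₂ z i - (Q ∘ κ.symm) z * E₁ z i)
  set Z : Fin 2 → EuclideanSpace ℝ (Fin 2) → ℝ := fun i ↦ Ω.indicator (Z₀ i)
  have hZΩ (i) (y) (hy : y ∈ Ω) : Z i =ᶠ[nhds y] Z₀ i := by
    filter_upwards [hΩ.mem_nhds hy] with z hz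
    exact Set.indicator_of_mem hz _
  have hZ0 (i) (y) (hy : y ∉ κ '' K) : Z i y = 0 := by
    by_cases hyΩ : y ∈ Ω
    · have h := hnot y hyΩ.1 hy
      simp only [Z, Z₀, Set.indicator_of_mem hyΩ, Function.comp_apply, hPK _ h, hQK _ h]
      simp
    · exact Set.indicator_of_notMem hyΩ _
  have hZK (i) (y) (hy : y ∉ κ '' K) : Z i =ᶠ[nhds y] fun _ ↦ 0 := by
    filter_upwards [hKκ.isOpen_compl.mem_nhds hy] with z hz
    exact hZ0 i z hz
  have hcomp {X : EuclideanSpace ℝ (Fin 2) → EuclideanSpace ℝ (Fin 2)} {y}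
      (hX : ContDiffAt ℝ ∞ X y) (i : Fin 2) : ContDiffAt ℝ ∞ (fun z ↦ X z i) y :=
    (EuclideanSpace.proj i : EuclideanSpace ℝ (Fin 2) →L[ℝ] ℝ).contDiff.contDiffAt.comp y hX
  have hZs (i) : ContDiff ℝ 1 (Z i) := by
    refine contDiff_iff_contDiffAt.2 fun y ↦ ?_
    by_cases hy : y ∈ Ω
    · refine ContDiffAt.congr_of_eventuallyEq ?_ (hZΩ i y hy)
      have hDs : ContDiffAt ℝ ∞ D y := ((hcomp (hc he₁ y hy) 0).mul (hcomp (hc he₂ y hy) 1)).sub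
        ((hcomp (hc he₁ y hy) 1).mul (hcomp (hc he₂ y hy) 0))
      exact ((((hDs.abs (hD y hy)).inv (abs_ne_zero.2 (hD y hy))).mul
        (((hs hP y hy).mul (hcomp (hc he₂ y hy) i)).sub
          ((hs hQ y hy).mul (hcomp (hc he₁ y hy) i))))).of_le (by simp)
    · exact contDiffAt_const.congr_of_eventuallyEq (hZK i y fun h ↦ hy (hKΩ h))
  have hZc (i) : HasCompactSupport (Z i) :=
    HasCompactSupport.intro (hK.image_of_continuousOn (κ.continuousOn.mono (hKU.trans hUc)))
      fun y hy ↦ hZ0 i y hy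
  -- On `Ω` this is `divergence_frame` combined with density `= |D|⁻¹`; off `Ω` both sides vanish.
  have hpt (y) : κ.target.indicator (fun y ↦ chartDensity c y * F (κ.symm y)) y =
      ∑ i, fderiv ℝ (Z i) y (EuclideanSpace.single i 1) := by
    by_cases hy : y ∈ Ω
    · rw [Set.indicator_of_mem hy.1]
      simp only [(hZΩ _ y hy).fderiv_eq]
      have h := divergence_frame ((hc he₁ y hy).differentiableAt (by simp))
        ((hc he₂ y hy).differentiableAt (by simp)) ((hs hP y hy).differentiableAt (by simp))
        ((hs hQ y hy).differentiableAt (by simp)) (hbr y hy) (hD y hy)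
      refine Eq.trans ?_ h.symm
      rw [eq_inv_of_mul_eq_one_right (hdens y hy), hFU _ hy.2, hfd hP, hfd hQ]
      · simp only [Function.comp_apply, D]
        ring
      · exact hy
      · exact hy
    · have hyK : y ∉ κ '' K := fun h ↦ hy (hKΩ h)
      simp only [(hZK _ y hyK).fderiv_eq]
      by_cases hyt : y ∈ κ.target
      · rw [Set.indicator_of_mem hyt, hFK _ (hnot y hyt hyK)]
        simp
      · rw [Set.indicator_of_notMem hyt]
        simp
  have hsupp : Function.support F ⊆ κ.source := fun x hx ↦ by
    by_contra h
    exact hx (hFK x fun hxK ↦ h (hUc (hKU hxK)))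
  rw [integral_riemannianMeasure_of_subset c hF hsupp,
    ← integral_indicator κ.open_target.measurableSet]
  refine (integral_congr_ae (.of_forall hpt)).trans ?_
  rw [integral_finsetSum _ fun i _ ↦ (integral_fderiv_apply_eq_zero (hZs i) (hZc i) _).1]
  exact Finset.sum_eq_zero fun i _ ↦ (integral_fderiv_apply_eq_zero (hZs i) (hZc i) _).2

end LocalStokes

/-! ### Globalization by a partition of unity -/

section GlobalSymmetry

variable {M₁ : Type*} [TopologicalSpace M₁] [ChartedSpace (EuclideanSpace ℝ (Fin 2)) M₁]
  [IsManifold (𝓡 2) ∞ M₁]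
  [RiemannianBundle (fun x : M₁ ↦ TangentSpace (𝓡 2) x)]
  [IsContMDiffRiemannianBundle (𝓡 2) ∞ (EuclideanSpace ℝ (Fin 2))
    (fun x : M₁ ↦ TangentSpace (𝓡 2) x)]
  {S : M₁ → Type*} [TopologicalSpace (TotalSpace (EuclideanSpace ℝ (Fin 2)) S)]
  [∀ x, NormedAddCommGroup (S x)] [∀ x, InnerProductSpace ℝ (S x)]
  [FiberBundle (EuclideanSpace ℝ (Fin 2)) S] [VectorBundle ℝ (EuclideanSpace ℝ (Fin 2)) S]
  [ContMDiffVectorBundle ∞ (EuclideanSpace ℝ (Fin 2)) S (𝓡 2)]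
  [IsContMDiffRiemannianBundle (𝓡 2) ∞ (EuclideanSpace ℝ (Fin 2)) S]
  {ω₁ : AreaForm (𝓡 2) (EuclideanSpace ℝ (Fin 2)) (fun x : M₁ ↦ TangentSpace (𝓡 2) x)}
  {n : ℕ} {M₂ : Type*} [TopologicalSpace M₂] [ChartedSpace (EuclideanSpace ℝ (Fin n)) M₂]
  [IsManifold (𝓡 n) ∞ M₂]
  [RiemannianBundle (fun q : M₂ ↦ TangentSpace (𝓡 n) q)]
  [IsContMDiffRiemannianBundle (𝓡 n) ∞ (EuclideanSpace ℝ (Fin n))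
    (fun q : M₂ ↦ TangentSpace (𝓡 n) q)]
  {σ : SpinStructure S ω₁}
  {cov₁ : CovariantDerivative (𝓡 2) (EuclideanSpace ℝ (Fin 2))
    (fun x : M₁ ↦ TangentSpace (𝓡 2) x)}
  {covS : CovariantDerivative (𝓡 2) (EuclideanSpace ℝ (Fin 2)) S}
  {cov₂ : CovariantDerivative (𝓡 n) (EuclideanSpace ℝ (Fin n))
    (fun q : M₂ ↦ TangentSpace (𝓡 n) q)}

theorem dirac_eq_zero_of_eventually (σ : SpinStructure S ω₁)
    (covS : CovariantDerivative (𝓡 2) (EuclideanSpace ℝ (Fin 2)) S)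
    (cov₂ : CovariantDerivative (𝓡 n) (EuclideanSpace ℝ (Fin n))
      (fun q : M₂ ↦ TangentSpace (𝓡 n) q))
    (φ : C^∞⟮𝓡 2, M₁; 𝓡 n, M₂⟯) {ψ : TwistedSection S φ} {x : M₁}
    (h : ∀ᶠ y in nhds x, ψ y = 0) : dirac σ covS cov₂ φ ψ x = 0 := by
  have h0 : dirac σ covS cov₂ φ (0 : TwistedSection S φ) x = 0 :=
    (diracAt σ covS cov₂ φ x).map_zero
  rw [← h0]
  have hx : ψ x = (0 : TwistedSection S φ) x := h.self_of_nhds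
  have hp (k : Fin 2) : pullbackCov cov₂ φ (fun x' ↦ ψ x' (spinorFrame S x k x')) x =
      pullbackCov cov₂ φ (fun x' ↦ (0 : TwistedSection S φ) x' (spinorFrame S x k x')) x :=
    pullbackCov_eq_of_eventuallyEq cov₂ φ (h.mono fun y hy ↦ by rw [hy]; rfl)
  simp only [dirac, twistedCov, hp, hx]

/-- The failure at `x` of the Dirac operator to be symmetric, as a linear function of the first
section. -/
def diracDefect (σ : SpinStructure S ω₁)
    (covS : CovariantDerivative (𝓡 2) (EuclideanSpace ℝ (Fin 2)) S)
    (cov₂ : CovariantDerivative (𝓡 n) (EuclideanSpace ℝ (Fin n))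
      (fun q : M₂ ↦ TangentSpace (𝓡 n) q))
    (φ : C^∞⟮𝓡 2, M₁; 𝓡 n, M₂⟯) (χ : TwistedSection S φ) (x : M₁) : TwistedSection S φ →ₗ[ℝ] ℝ :=
  (twistedInner σ φ x).flip (diracAt σ covS cov₂ φ x χ) ∘ₗ evalSection φ x -
    (twistedInner σ φ x).flip (evalSection φ x χ) ∘ₗ diracAt σ covS cov₂ φ x

variable [T2Space M₁] [CompactSpace M₁] [MeasurableSpace M₁] [BorelSpace M₁] [T2Space M₂]

theorem integrable_riemannianMeasure {f : M₁ → ℝ} (hf : Continuous f) :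
    Integrable f (riemannianMeasure 2 M₁) :=
  have := isLocallyFiniteMeasure_riemannianMeasure (n := 2) (M := M₁)
  hf.integrable_of_hasCompactSupport (HasCompactSupport.of_compactSpace f)

theorem continuous_dirac_twistedInner (hS : IsSpinConnection σ cov₁ covS)
    (h₂ : IsLeviCivita cov₂) (φ : C^∞⟮𝓡 2, M₁; 𝓡 n, M₂⟯) (ψ χ : TwistedSection S φ) :
    Continuous fun x ↦ twistedInner σ φ x (dirac σ covS cov₂ φ ψ x) (χ x) := by
  simp only [twistedInner_swap σ φ _ (dirac σ covS cov₂ φ ψ _)]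
  exact (continuous_twistedInner_dirac hS h₂ φ χ ψ).neg

/-- `P` and `Q` are bilinear in `ψ` and `χ`, so the field `-Q e₁ + P e₂` is supported in `K` as soon
as `ψ` is; `χ` needs no cutoff. -/
theorem IsSpinFrameOn.integral_twistedInner_dirac_sub {b₁ b₂ : Π x, S x} {U K : Set M₁}
    (h : IsSpinFrameOn σ b₁ b₂ U) (h₁ : IsLeviCivita cov₁) (hS : IsSpinConnection σ cov₁ covS)
    (h₂ : IsLeviCivita cov₂) (φ : C^∞⟮𝓡 2, M₁; 𝓡 n, M₂⟯) (c : M₁)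
    (hUc : U ⊆ (chartAt (EuclideanSpace ℝ (Fin 2)) c).source) (hK : IsClosed K) (hKU : K ⊆ U)
    (ψ χ : TwistedSection S φ) (hψ : ∀ x ∉ K, ψ x = 0) :
    ∫ x, (twistedInner σ φ x (ψ x) (dirac σ covS cov₂ φ χ x) -
      twistedInner σ φ x (dirac σ covS cov₂ φ ψ x) (χ x)) ∂(riemannianMeasure 2 M₁) = 0 := by
  have hU (x) (hx : x ∈ U) := h.isOpen.mem_nhds hx
  have c1 (ψ : TwistedSection S φ) (x) (hx : x ∈ U) :=
    contMDiffAt_twistedSection_apply φ ψ (h.contMDiffOn_left.contMDiffAt (hU x hx))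
  have c2 (ψ : TwistedSection S φ) (x) (hx : x ∈ U) :=
    contMDiffAt_twistedSection_apply φ ψ (h.contMDiffOn_right.contMDiffAt (hU x hx))
  refine integral_divergence_eq_zero c h.isOpen hUc hK.isCompact hKU
    (contMDiffOn_sq σ h.contMDiffOn_left h.contMDiffOn_left)
    (contMDiffOn_sq σ h.contMDiffOn_left h.contMDiffOn_right)
    (fun x hx ↦ (h.isSpinPair x hx).norm_sq_left) (fun x hx ↦ (h.isSpinPair x hx).norm_sq_right)
    (fun x hx ↦ (h.isSpinPair x hx).inner_sq) (fun x hx ↦ h.mlieBracket_sq h₁ hS hx)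
    (P := fun y ↦ pullbackInner φ y (ψ y (b₁ y)) (χ y (b₁ y)) -
      pullbackInner φ y (ψ y (b₂ y)) (χ y (b₂ y)))
    (Q := fun y ↦ pullbackInner φ y (ψ y (b₁ y)) (χ y (b₂ y)) +
      pullbackInner φ y (ψ y (b₂ y)) (χ y (b₁ y)))
    (fun x hx ↦ ((contMDiffAt_pullbackInner φ (c1 ψ x hx) (c1 χ x hx)).sub
      (contMDiffAt_pullbackInner φ (c2 ψ x hx) (c2 χ x hx))).contMDiffWithinAt)
    (fun x hx ↦ ((contMDiffAt_pullbackInner φ (c1 ψ x hx) (c2 χ x hx)).add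
      (contMDiffAt_pullbackInner φ (c2 ψ x hx) (c1 χ x hx))).contMDiffWithinAt)
    (fun x hx ↦ by simp [hψ x hx]) (fun x hx ↦ by simp [hψ x hx])
    ((continuous_twistedInner_dirac hS h₂ φ ψ χ).sub (continuous_dirac_twistedInner hS h₂ φ ψ χ))
    (fun x hx ↦ ?_) (fun x hx ↦ twistedInner_dirac_sub h hS h₂ φ ψ χ hx)
  -- `K` is closed, so `ψ` vanishes near `x`, and `D` is local.
  have hev : ∀ᶠ y in nhds x, ψ y = 0 := by
    filter_upwards [hK.isOpen_compl.mem_nhds hx] with y hy using hψ y hy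
  rw [dirac_eq_zero_of_eventually σ covS cov₂ φ hev, hψ x hx]
  simp

/-- Decomposition of a section by a partition of unity subordinate to a cover. -/
theorem exists_sum_eq_twistedSection (φ : C^∞⟮𝓡 2, M₁; 𝓡 n, M₂⟯) (ψ : TwistedSection S φ)
    {U : M₁ → Set M₁} (hU : ∀ x, IsOpen (U x)) (hx : ∀ x, x ∈ U x) :
    ∃ (t : Finset M₁) (η : t → TwistedSection S φ), ψ = ∑ i, η i ∧
      ∀ i : t, ∃ K, IsClosed K ∧ K ⊆ U i ∧ ∀ x ∉ K, η i x = 0 := by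
  obtain ⟨t, ht⟩ := CompactSpace.elim_nhds_subcover U fun x ↦ (hU x).mem_nhds (hx x)
  obtain ⟨ρ, hρ⟩ := SmoothPartitionOfUnity.exists_isSubordinate (𝓡 2) (isClosed_univ (X := M₁))
    (fun i : t ↦ U i) (fun i ↦ hU i) fun x _ ↦ by
      have hx : x ∈ ⋃ y ∈ t, U y := ht ▸ Set.mem_univ x
      simpa using hx
  refine ⟨t, fun i ↦ ⟨fun x ↦ ρ i x • ψ x, (ρ i).contMDiff.smul_section ψ.contMDiff⟩, ?_,
    fun i ↦ ⟨tsupport (ρ i), isClosed_tsupport (ρ i), hρ i, fun x hx ↦ ?_⟩⟩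
  · ext x : 1
    have h1 := ρ.sum_eq_one (Set.mem_univ x)
    rw [finsum_eq_sum_of_fintype] at h1
    refine Eq.symm ((map_sum (evalSection φ x) _ Finset.univ).trans ?_)
    refine (Finset.sum_smul (f := fun i ↦ ρ i x) (x := ψ x) (s := Finset.univ)).symm.trans ?_
    exact (congrArg (fun r : ℝ ↦ r • ψ x) h1).trans (one_smul ℝ (ψ x))
  · have h0 : ρ i x = 0 := image_eq_zero_of_notMem_tsupport hx
    exact (congrArg (fun r : ℝ ↦ r • ψ x) h0).trans (zero_smul ℝ (ψ x))

/-- The defect is linear in `ψ`, so it suffices to treat pieces of `ψ` supported in the domain of a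
spin frame inside a chart. -/
theorem integral_diracDefect (h₁ : IsLeviCivita cov₁) (hS : IsSpinConnection σ cov₁ covS)
    (h₂ : IsLeviCivita cov₂) (φ : C^∞⟮𝓡 2, M₁; 𝓡 n, M₂⟯) (ψ χ : TwistedSection S φ) :
    ∫ x, diracDefect σ covS cov₂ φ χ x ψ ∂(riemannianMeasure 2 M₁) = 0 := by
  choose W b₁ b₂ hxW hW using exists_isSpinFrameOn σ
  have hUo (x) : IsOpen (W x ∩ (chartAt (EuclideanSpace ℝ (Fin 2)) x).source) :=
    (hW x).isOpen.inter (chartAt _ x).open_source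
  obtain ⟨t, η, rfl, hη⟩ := exists_sum_eq_twistedSection φ ψ hUo
    fun x ↦ ⟨hxW x, mem_chart_source _ x⟩
  have hint (i : t) : Integrable (fun x ↦ diracDefect σ covS cov₂ φ χ x (η i))
      (riemannianMeasure 2 M₁) :=
    (integrable_riemannianMeasure (continuous_twistedInner_dirac hS h₂ φ (η i) χ)).sub
      (integrable_riemannianMeasure (continuous_dirac_twistedInner hS h₂ φ (η i) χ))
  simp only [map_sum]
  rw [integral_finsetSum _ fun i _ ↦ hint i]
  refine Finset.sum_eq_zero fun i _ ↦ ?_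
  obtain ⟨K, hK, hKU, h0⟩ := hη i
  exact ((hW i).mono (hUo i) Set.inter_subset_left).integral_twistedInner_dirac_sub h₁ hS h₂ φ i
    Set.inter_subset_right hK hKU (η i) χ h0

/-- The Dirac operator is symmetric with respect to the skew-symmetric pairing
`∫ ⟨ψ, χ⟩_E dvol`. -/
theorem integral_twistedInner_dirac (h₁ : IsLeviCivita cov₁) (hS : IsSpinConnection σ cov₁ covS)
    (h₂ : IsLeviCivita cov₂) (φ : C^∞⟮𝓡 2, M₁; 𝓡 n, M₂⟯) (ψ χ : TwistedSection S φ) :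
    ∫ x, twistedInner σ φ x (ψ x) (dirac σ covS cov₂ φ χ x) ∂(riemannianMeasure 2 M₁) =
      ∫ x, twistedInner σ φ x (dirac σ covS cov₂ φ ψ x) (χ x) ∂(riemannianMeasure 2 M₁) := by
  rw [← sub_eq_zero, ← integral_sub
    (integrable_riemannianMeasure (continuous_twistedInner_dirac hS h₂ φ ψ χ))
    (integrable_riemannianMeasure (continuous_dirac_twistedInner hS h₂ φ ψ χ))]
  exact integral_diracDefect h₁ hS h₂ φ ψ χ

end GlobalSymmetry

/-! ### Extension to Grassmann coefficients -/

section Grassmann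

variable {V : Type*} [AddCommGroup V] [Module ℝ V]

/-- The exterior algebra is the Clifford algebra of the zero form, for which any two vectors are
orthogonal; odd elements built from orthogonal vectors anticommute. -/
theorem mul_eq_neg_mul_of_mem_grassmannPart_one {a b : ExteriorAlgebra ℝ V}
    (ha : a ∈ grassmannPart V 1) (hb : b ∈ grassmannPart V 1) : a * b = -(b * a) := by
  have h := CliffordAlgebra.map_mul_map_eq_neg_of_isOrtho_of_mem_evenOdd_one
    (QuadraticMap.Isometry.id (0 : QuadraticForm ℝ V))
    (QuadraticMap.Isometry.id (0 : QuadraticForm ℝ V))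
    (fun x y ↦ by simp [QuadraticMap.IsOrtho]) a b ha hb
  simpa only [CliffordAlgebra.map_id, AlgHom.id_apply, neg_mul] using h

theorem mul_mem_grassmannPart_zero {a b : ExteriorAlgebra ℝ V}
    (ha : a ∈ grassmannPart V 1) (hb : b ∈ grassmannPart V 1) : a * b ∈ grassmannPart V 0 := by
  have h := CliffordAlgebra.evenOdd_mul_le (0 : QuadraticForm ℝ V) 1 1 (Submodule.mul_mem_mul ha hb)
  -- The degree `1 + 1` is `0` in `ZMod 2` by computation.
  exact h

section Extension

variable {N N' : Type*} [AddCommGroup N] [Module ℝ N] [AddCommGroup N'] [Module ℝ N']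

variable (V) in
/-- The `Λ`-valued extension `(z₁ ⊗ λ₁, z₂ ⊗ λ₂) ↦ β(z₁, z₂) λ₁ ∧ λ₂` of a bilinear form. -/
def grassmannForm (β : N →ₗ[ℝ] N →ₗ[ℝ] ℝ) : N ⊗[ℝ] ExteriorAlgebra ℝ V →ₗ[ℝ]
    N ⊗[ℝ] ExteriorAlgebra ℝ V →ₗ[ℝ] ExteriorAlgebra ℝ V :=
  (TensorProduct.map₂ β (LinearMap.mul ℝ (ExteriorAlgebra ℝ V))).compr₂
    (TensorProduct.lid ℝ (ExteriorAlgebra ℝ V)).toLinearMap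

theorem grassmannForm_tmul (β : N →ₗ[ℝ] N →ₗ[ℝ] ℝ) (z₁ z₂ : N) (l₁ l₂ : ExteriorAlgebra ℝ V) :
    grassmannForm V β (z₁ ⊗ₜ l₁) (z₂ ⊗ₜ l₂) = β z₁ z₂ • (l₁ * l₂) := rfl

/-- Absorbs evaluation at `x`, or `D` followed by evaluation, into the real form. The fibrewise
pairings thereby become a family, indexed by `x`, of forms on the one space of sections, and can be
integrated. -/
theorem grassmannForm_rTensor (β : N →ₗ[ℝ] N →ₗ[ℝ] ℝ) (f g : N' →ₗ[ℝ] N)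
    (z w : N' ⊗[ℝ] ExteriorAlgebra ℝ V) :
    grassmannForm V β (f.rTensor _ z) (g.rTensor _ w) = grassmannForm V (β.compl₁₂ f g) z w := by
  induction z using TensorProduct.induction_on with
  | zero => simp
  | add z z' hz hz' =>
    rw [map_add, map_add, map_add, LinearMap.add_apply, LinearMap.add_apply, hz, hz']
  | tmul ψ a =>
    induction w using TensorProduct.induction_on with
    | zero => simp
    | add w w' hw hw' => rw [map_add, map_add, map_add, hw, hw']
    | tmul χ b => rfl

/-- On pure tensors the sign of the skew form and the sign of two anticommuting odd coefficients
cancel. -/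
theorem grassmannForm_swap {β : N →ₗ[ℝ] N →ₗ[ℝ] ℝ} (hβ : ∀ z w, β z w = -β w z)
    (z w : N ⊗[ℝ] grassmannPart V 1) :
    grassmannForm V β ((grassmannPart V 1).subtype.lTensor N z)
        ((grassmannPart V 1).subtype.lTensor N w) =
      grassmannForm V β ((grassmannPart V 1).subtype.lTensor N w)
        ((grassmannPart V 1).subtype.lTensor N z) := by
  induction z using TensorProduct.induction_on with
  | zero => simp
  | add z z' hz hz' => rw [map_add, map_add, map_add, LinearMap.add_apply, hz, hz']
  | tmul ψ a =>
    induction w using TensorProduct.induction_on with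
    | zero => simp
    | add w w' hw hw' => rw [map_add, map_add, map_add, LinearMap.add_apply, hw, hw']
    | tmul χ b =>
      simp only [LinearMap.lTensor_tmul, grassmannForm_tmul, Submodule.subtype_apply]
      rw [hβ, mul_eq_neg_mul_of_mem_grassmannPart_one a.2 b.2, neg_smul_neg]

theorem grassmannForm_mem_grassmannPart_zero (β : N →ₗ[ℝ] N →ₗ[ℝ] ℝ)
    (z w : N ⊗[ℝ] grassmannPart V 1) :
    grassmannForm V β ((grassmannPart V 1).subtype.lTensor N z)
        ((grassmannPart V 1).subtype.lTensor N w) ∈ grassmannPart V 0 := by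
  induction z using TensorProduct.induction_on with
  | zero => simp
  | add z z' hz hz' =>
    rw [map_add, map_add, LinearMap.add_apply]
    exact Submodule.add_mem _ hz hz'
  | tmul ψ a =>
    induction w using TensorProduct.induction_on with
    | zero => simp
    | add w w' hw hw' =>
      rw [map_add, map_add]
      exact Submodule.add_mem _ hw hw'
    | tmul χ b => exact Submodule.smul_mem _ _ (mul_mem_grassmannPart_zero a.2 b.2)

variable {X : Type*} [MeasurableSpace X] {μ : Measure X} {β : X → N →ₗ[ℝ] N →ₗ[ℝ] ℝ}

theorem grassmannIntegrable_grassmannForm (hβ : ∀ z w, Integrable (fun x ↦ β x z w) μ)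
    (z w : N ⊗[ℝ] ExteriorAlgebra ℝ V) :
    GrassmannIntegrable μ fun x ↦ grassmannForm V (β x) z w := by
  intro l
  induction z using TensorProduct.induction_on with
  | zero => simp
  | add z z' hz hz' =>
    simp only [map_add, LinearMap.add_apply]
    exact hz.add hz'
  | tmul ψ a =>
    induction w using TensorProduct.induction_on with
    | zero => simp
    | add w w' hw hw' =>
      simp only [map_add]
      exact hw.add hw'
    | tmul χ b =>
      simp only [grassmannForm_tmul, map_smul, smul_eq_mul]
      exact (hβ ψ χ).mul_const _

/-- The integral of a family of bilinear forms with integrable values. -/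
def integralForm (hβ : ∀ z w, Integrable (fun x ↦ β x z w) μ) : N →ₗ[ℝ] N →ₗ[ℝ] ℝ :=
  LinearMap.mk₂ ℝ (fun z w ↦ ∫ x, β x z w ∂μ)
    (fun z z' w ↦ by simpa using integral_add (hβ z w) (hβ z' w))
    (fun c z w ↦ by simpa using integral_const_mul c fun x ↦ β x z w)
    (fun z w w' ↦ by simpa using integral_add (hβ z w) (hβ z w'))
    (fun c z w ↦ by simpa using integral_const_mul c fun x ↦ β x z w)

variable [Module.Finite ℝ V]

theorem grassmannIntegral_add {f g : X → ExteriorAlgebra ℝ V} (hf : GrassmannIntegrable μ f)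
    (hg : GrassmannIntegrable μ g) :
    grassmannIntegral μ (fun x ↦ f x + g x) = grassmannIntegral μ f + grassmannIntegral μ g := by
  simp only [grassmannIntegral, map_add, Finsupp.add_apply, ← Finset.sum_add_distrib, ← add_smul]
  refine Finset.sum_congr rfl fun i _ ↦ congrArg (· • _) ?_
  exact integral_add (hf ((Module.finBasis ℝ V).ExteriorAlgebra.coord i))
    (hg ((Module.finBasis ℝ V).ExteriorAlgebra.coord i))

theorem grassmannIntegral_smul_const (f : X → ℝ) (a : ExteriorAlgebra ℝ V) :
    grassmannIntegral μ (fun x ↦ f x • a) = (∫ x, f x ∂μ) • a := by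
  simp only [grassmannIntegral, map_smul, Finsupp.smul_apply, smul_eq_mul, integral_mul_const,
    mul_smul, ← Finset.smul_sum, Module.Basis.sum_repr]

/-- On pure tensors the integrand is a real function times a fixed element of `Λ`; additivity does
the rest. Every statement about `Λ`-valued integrals thus becomes one about the real form
`integralForm`. -/
theorem grassmannIntegral_grassmannForm (hβ : ∀ z w, Integrable (fun x ↦ β x z w) μ)
    (z w : N ⊗[ℝ] ExteriorAlgebra ℝ V) :
    grassmannIntegral μ (fun x ↦ grassmannForm V (β x) z w) =
      grassmannForm V (integralForm hβ) z w := by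
  induction z using TensorProduct.induction_on with
  | zero => simp [grassmannIntegral]
  | add z z' hz hz' =>
    simp only [map_add, LinearMap.add_apply]
    rw [grassmannIntegral_add (grassmannIntegrable_grassmannForm hβ z w)
      (grassmannIntegrable_grassmannForm hβ z' w), hz, hz']
  | tmul ψ a =>
    induction w using TensorProduct.induction_on with
    | zero => simp [grassmannIntegral]
    | add w w' hw hw' =>
      simp only [map_add]
      rw [grassmannIntegral_add (grassmannIntegrable_grassmannForm hβ _ w)
        (grassmannIntegrable_grassmannForm hβ _ w'), hw, hw']
    | tmul χ b =>
      simp only [grassmannForm_tmul]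
      exact grassmannIntegral_smul_const _ _

end Extension

end Grassmann

end SuperDirac

end

/-! ### Symmetry of the Dirac operator on odd sections -/

theorem mainTheorem5
    {M₁ : Type*} [TopologicalSpace M₁] [ChartedSpace (EuclideanSpace ℝ (Fin 2)) M₁]
    [IsManifold (𝓡 2) ∞ M₁] [T2Space M₁] [CompactSpace M₁] [MeasurableSpace M₁] [BorelSpace M₁]
    [RiemannianBundle (fun x : M₁ ↦ TangentSpace (𝓡 2) x)]
    [IsContMDiffRiemannianBundle (𝓡 2) ∞ (EuclideanSpace ℝ (Fin 2))
      (fun x : M₁ ↦ TangentSpace (𝓡 2) x)]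
    (ω₁ : SuperDirac.AreaForm (𝓡 2) (EuclideanSpace ℝ (Fin 2))
      (fun x : M₁ ↦ TangentSpace (𝓡 2) x))
    {S : M₁ → Type*} [TopologicalSpace (TotalSpace (EuclideanSpace ℝ (Fin 2)) S)]
    [∀ x, NormedAddCommGroup (S x)] [∀ x, InnerProductSpace ℝ (S x)]
    [FiberBundle (EuclideanSpace ℝ (Fin 2)) S] [VectorBundle ℝ (EuclideanSpace ℝ (Fin 2)) S]
    [ContMDiffVectorBundle ∞ (EuclideanSpace ℝ (Fin 2)) S (𝓡 2)]
    [IsContMDiffRiemannianBundle (𝓡 2) ∞ (EuclideanSpace ℝ (Fin 2)) S]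
    (σ : SuperDirac.SpinStructure S ω₁)
    {n : ℕ} {M₂ : Type*} [TopologicalSpace M₂] [ChartedSpace (EuclideanSpace ℝ (Fin n)) M₂]
    [IsManifold (𝓡 n) ∞ M₂] [T2Space M₂]
    [RiemannianBundle (fun q : M₂ ↦ TangentSpace (𝓡 n) q)]
    [IsContMDiffRiemannianBundle (𝓡 n) ∞ (EuclideanSpace ℝ (Fin n))
      (fun q : M₂ ↦ TangentSpace (𝓡 n) q)]
    (φ : C^∞⟮𝓡 2, M₁; 𝓡 n, M₂⟯)
    (cov₁ : CovariantDerivative (𝓡 2) (EuclideanSpace ℝ (Fin 2))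
      (fun x : M₁ ↦ TangentSpace (𝓡 2) x))
    (hcov₁ : SuperDirac.IsLeviCivita cov₁)
    (cov₂ : CovariantDerivative (𝓡 n) (EuclideanSpace ℝ (Fin n))
      (fun q : M₂ ↦ TangentSpace (𝓡 n) q))
    (hcov₂ : SuperDirac.IsLeviCivita cov₂)
    (covS : CovariantDerivative (𝓡 2) (EuclideanSpace ℝ (Fin 2)) S)
    (hcovS : SuperDirac.IsSpinConnection σ cov₁ covS)
    (V : Type*) [AddCommGroup V] [Module ℝ V] [Module.Finite ℝ V]
    (ψ χ : SuperDirac.GrassmannSection V S φ)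
    (hψ : ψ ∈ SuperDirac.oddSections V S φ) (hχ : χ ∈ SuperDirac.oddSections V S φ) :
    let s := SuperDirac.evalGrassmann φ ψ
    let t := SuperDirac.evalGrassmann φ χ
    let Ds := SuperDirac.diracGrassmann σ covS cov₂ φ ψ
    let Dt := SuperDirac.diracGrassmann σ covS cov₂ φ χ
    let dvol := SuperDirac.riemannianMeasure 2 M₁
    (SuperDirac.GrassmannIntegrable dvol (fun x ↦ SuperDirac.gradedInner V σ φ x (s x) (t x)) ∧
      SuperDirac.GrassmannIntegrable dvol (fun x ↦ SuperDirac.gradedInner V σ φ x (s x) (Dt x)) ∧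
      SuperDirac.GrassmannIntegrable dvol (fun x ↦ SuperDirac.gradedInner V σ φ x (Ds x) (t x))) ∧
    SuperDirac.scalarProduct σ φ s t = SuperDirac.scalarProduct σ φ t s ∧
    SuperDirac.scalarProduct σ φ s t ∈ SuperDirac.grassmannPart V 0 ∧
    SuperDirac.scalarProduct σ φ s Dt = SuperDirac.scalarProduct σ φ Ds t := by
  -- `gradedInner` is by definition the Grassmann extension of `twistedInner`, so the three
  -- integrands are Grassmann extensions of real forms on sections.
  have e1 (z w : SuperDirac.GrassmannSection V S φ) (x : M₁) :
      SuperDirac.gradedInner V σ φ x (SuperDirac.evalGrassmann φ z x)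
        (SuperDirac.evalGrassmann φ w x) = SuperDirac.grassmannForm V
        ((SuperDirac.twistedInner σ φ x).compl₁₂ (SuperDirac.evalSection φ x)
          (SuperDirac.evalSection φ x)) z w := SuperDirac.grassmannForm_rTensor _ _ _ z w
  have e2 (x : M₁) :
      SuperDirac.gradedInner V σ φ x (SuperDirac.evalGrassmann φ ψ x)
        (SuperDirac.diracGrassmann σ covS cov₂ φ χ x) = SuperDirac.grassmannForm V
        ((SuperDirac.twistedInner σ φ x).compl₁₂ (SuperDirac.evalSection φ x)
          (SuperDirac.diracAt σ covS cov₂ φ x)) ψ χ := SuperDirac.grassmannForm_rTensor _ _ _ ψ χ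
  have e3 (x : M₁) :
      SuperDirac.gradedInner V σ φ x (SuperDirac.diracGrassmann σ covS cov₂ φ ψ x)
        (SuperDirac.evalGrassmann φ χ x) = SuperDirac.grassmannForm V
        ((SuperDirac.twistedInner σ φ x).compl₁₂ (SuperDirac.diracAt σ covS cov₂ φ x)
          (SuperDirac.evalSection φ x)) ψ χ := SuperDirac.grassmannForm_rTensor _ _ _ ψ χ
  have i1 (z w : SuperDirac.TwistedSection S φ) : Integrable (fun x ↦
      (SuperDirac.twistedInner σ φ x).compl₁₂ (SuperDirac.evalSection φ x)
        (SuperDirac.evalSection φ x) z w) (SuperDirac.riemannianMeasure 2 M₁) :=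
    SuperDirac.integrable_riemannianMeasure (SuperDirac.continuous_twistedInner σ φ z w)
  have i2 (z w : SuperDirac.TwistedSection S φ) : Integrable (fun x ↦
      (SuperDirac.twistedInner σ φ x).compl₁₂ (SuperDirac.evalSection φ x)
        (SuperDirac.diracAt σ covS cov₂ φ x) z w) (SuperDirac.riemannianMeasure 2 M₁) :=
    SuperDirac.integrable_riemannianMeasure
      (SuperDirac.continuous_twistedInner_dirac hcovS hcov₂ φ z w)
  have i3 (z w : SuperDirac.TwistedSection S φ) : Integrable (fun x ↦
      (SuperDirac.twistedInner σ φ x).compl₁₂ (SuperDirac.diracAt σ covS cov₂ φ x)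
        (SuperDirac.evalSection φ x) z w) (SuperDirac.riemannianMeasure 2 M₁) :=
    SuperDirac.integrable_riemannianMeasure
      (SuperDirac.continuous_dirac_twistedInner hcovS hcov₂ φ z w)
  have hswap (z w : SuperDirac.TwistedSection S φ) : SuperDirac.integralForm i1 z w =
      -SuperDirac.integralForm i1 w z := by
    refine Eq.trans ?_ (integral_neg _)
    exact integral_congr_ae (.of_forall fun x ↦ SuperDirac.twistedInner_swap σ φ x (z x) (w x))
  -- The real symmetry of `D`: the integrated forms themselves coincide, hence so do their Grassmann
  -- extensions.
  have hsymm : SuperDirac.integralForm i2 = SuperDirac.integralForm i3 :=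
    LinearMap.ext₂ fun z w ↦ SuperDirac.integral_twistedInner_dirac hcov₁ hcovS hcov₂ φ z w
  obtain ⟨ψ', rfl⟩ := hψ
  obtain ⟨χ', rfl⟩ := hχ
  simp only [SuperDirac.scalarProduct, e1, e2, e3, SuperDirac.grassmannIntegral_grassmannForm i1,
    SuperDirac.grassmannIntegral_grassmannForm i2, SuperDirac.grassmannIntegral_grassmannForm i3,
    hsymm]
  exact ⟨⟨SuperDirac.grassmannIntegrable_grassmannForm i1 _ _,
    SuperDirac.grassmannIntegrable_grassmannForm i2 _ _,
    SuperDirac.grassmannIntegrable_grassmannForm i3 _ _⟩,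
    SuperDirac.grassmannForm_swap hswap ψ' χ',
    SuperDirac.grassmannForm_mem_grassmannPart_zero _ ψ' χ', trivial⟩
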